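/- Consider the following counting problem: given a directed acyclic graph with $n \ge 1$ vertices and $m$ arcs (parallel arcs allowed) with nonnegative integer arc weights, two vertices $s,t$ and a capacity $C \in \mathbb{N}$, determine the number $N$ of directed paths from $s$ to $t$ of total weight at most $C$. There is a deterministic algorithm (one random access machine program, working for all inputs) which, for every such instance and every real $0 < \varepsilon \le 1$ (supplied as the integer $\lceil 1/\varepsilon\rceil$), outputs a floating-point number $Z$ (a natural number given by its mantissa and its exponent) with \[ (1-\varepsilon)\,N \;\le\; Z \;\le\; N, \] in time \[ O\!\left( \max\{1,m\}\; n^2\; \max\{1,\log_2(m/n)\}\; \varepsilon^{-1}\; \max\left\{1,\left\lceil \frac{\log (1/\varepsilon)}{\log \max\{n,2\}} \right\rceil\right\} \right) \] (where $\log_2 (m/n)$ is ignored if $m = 0$) with an absolute implied constant. Here the machine has additions, subtractions, comparisons, binary shifts and indirectly addressed arrays; its words are just long enough to hold $n+m+C+w_{\max}$, where $w_{\max}$ is the largest arc weight, and an operation costs the number of words occupied by the numbers it handles, so that operations on numbers of $O(\log(n+m+C+w_{\max}))$ bits have unit cost up to a constant factor. -/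

import Mathlib

/-! ### Arc-weighted DAGs and their paths -/

/-- A directed acyclic graph on the vertices `0, …, n - 1` with `m` arcs (parallel arcs are
allowed), each arc carrying a nonnegative integer weight. -/
structure WeightedDAG (n m : ℕ) where
  src : Fin m → Fin n
  dst : Fin m → Fin n
  weight : Fin m → ℕ
  acyclic : ∀ v : Fin n,
    ¬ Relation.TransGen (fun x y : Fin n => ∃ a, src a = x ∧ dst a = y) v v

namespace WeightedDAG

variable {n m : ℕ}

/-- `G.IsPath u p v`: the list of arcs `p` is a directed path from `u` to `v`. As `G` is acyclic,
no vertex can repeat. -/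
def IsPath (G : WeightedDAG n m) : Fin n → List (Fin m) → Fin n → Prop
  | u, [], v => u = v
  | u, a :: p, v => G.src a = u ∧ G.IsPath (G.dst a) p v

/-- The total weight of a path. -/
def pathWeight (G : WeightedDAG n m) (p : List (Fin m)) : ℕ := (p.map G.weight).sum

/-- The number of paths from `s` to `t` of total weight at most `C`. -/
noncomputable def pathCount (G : WeightedDAG n m) (s t : Fin n) (C : ℕ) : ℕ :=
  Set.ncard {p : List (Fin m) | G.IsPath s p t ∧ G.pathWeight p ≤ C}

/-- The largest arc weight (`0` if there is no arc). -/
def maxWeight (G : WeightedDAG n m) : ℕ := Finset.univ.sup G.weight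

end WeightedDAG

/-! ### Random access machine programs

The store consists of variables and arrays of natural numbers. With words of `b` bits, handling a
number costs the number of words that it occupies, so that operations on numbers of `O(b)` bits
have unit cost up to a constant factor, and longer numbers are charged for their length. Addresses
are charged like any other number. -/

namespace RAM

/-- The number of `b`-bit words occupied by `x`. -/
def words (b x : ℕ) : ℕ := Nat.size x / b + 1

/-- The contents of the memory: variables, and arrays (array name, then index). -/
structure Store where
  var : ℕ → ℕ
  arr : ℕ → ℕ → ℕ

/-- Arithmetic terms: constants, variables, array cells, addition, truncated subtraction, and
binary shifts to the left and to the right. -/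
inductive Term where
  | const (k : ℕ)
  | var (x : ℕ)
  | cell (a : ℕ) (i : Term)
  | add (e f : Term)
  | sub (e f : Term)
  | shl (e f : Term)
  | shr (e f : Term)

/-- The value of a term. -/
def Term.val (σ : Store) : Term → ℕ
  | const k => k
  | var x => σ.var x
  | cell a i => σ.arr a (i.val σ)
  | add e f => e.val σ + f.val σ
  | sub e f => e.val σ - f.val σ
  | shl e f => e.val σ * 2 ^ f.val σ
  | shr e f => e.val σ / 2 ^ f.val σ

/-- The cost of evaluating a term: every subterm is charged for the length of its value. -/
def Term.cost (b : ℕ) (σ : Store) : Term → ℕ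
  | const k => words b k
  | var x => words b (σ.var x)
  | cell a i => i.cost b σ + words b ((cell a i).val σ)
  | add e f => e.cost b σ + f.cost b σ + words b ((add e f).val σ)
  | sub e f => e.cost b σ + f.cost b σ + words b ((sub e f).val σ)
  | shl e f => e.cost b σ + f.cost b σ + words b ((shl e f).val σ)
  | shr e f => e.cost b σ + f.cost b σ + words b ((shr e f).val σ)

/-- Comparisons. -/
inductive Test where
  | le (e f : Term)
  | eq (e f : Term)

/-- The truth of a comparison. -/
def Test.holds (σ : Store) : Test → Prop
  | le e f => e.val σ ≤ f.val σ
  | eq e f => e.val σ = f.val σ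

/-- The cost of a comparison. -/
def Test.cost (b : ℕ) (σ : Store) : Test → ℕ
  | le e f => e.cost b σ + f.cost b σ + 1
  | eq e f => e.cost b σ + f.cost b σ + 1

/-- Programs. -/
inductive Prog where
  | skip
  | assign (x : ℕ) (e : Term)
  | write (a : ℕ) (i e : Term)
  | seq (p q : Prog)
  | cond (c : Test) (p q : Prog)
  | loop (c : Test) (p : Prog)

/-- The store after an assignment to a variable. -/
def Store.setVar (σ : Store) (x k : ℕ) : Store :=
  { σ with var := Function.update σ.var x k }

/-- The store after an assignment to an array cell. -/
def Store.setCell (σ : Store) (a i k : ℕ) : Store :=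
  { σ with arr := Function.update σ.arr a (Function.update (σ.arr a) i k) }

/-- `Exec b p σ T τ`: on a machine with `b`-bit words, the program `p`, started in the store `σ`,
terminates in the store `τ` after time `T`. -/
inductive Exec (b : ℕ) : Prog → Store → ℕ → Store → Prop
  | skip (σ : Store) : Exec b Prog.skip σ 1 σ
  | assign (σ : Store) (x : ℕ) (e : Term) :
      Exec b (Prog.assign x e) σ (e.cost b σ + 1) (σ.setVar x (e.val σ))
  | write (σ : Store) (a : ℕ) (i e : Term) :
      Exec b (Prog.write a i e) σ (i.cost b σ + e.cost b σ + 1)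
        (σ.setCell a (i.val σ) (e.val σ))
  | seq {p q : Prog} {σ τ ρ : Store} {T U : ℕ} :
      Exec b p σ T τ → Exec b q τ U ρ → Exec b (Prog.seq p q) σ (T + U) ρ
  | cond_true {c : Test} {p q : Prog} {σ τ : Store} {T : ℕ} :
      c.holds σ → Exec b p σ T τ → Exec b (Prog.cond c p q) σ (c.cost b σ + T) τ
  | cond_false {c : Test} {p q : Prog} {σ τ : Store} {T : ℕ} :
      ¬ c.holds σ → Exec b q σ T τ → Exec b (Prog.cond c p q) σ (c.cost b σ + T) τ
  | loop_done {c : Test} {p : Prog} {σ : Store} :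
      ¬ c.holds σ → Exec b (Prog.loop c p) σ (c.cost b σ) σ
  | loop_step {c : Test} {p : Prog} {σ τ ρ : Store} {T U : ℕ} :
      c.holds σ → Exec b p σ T τ → Exec b (Prog.loop c p) τ U ρ →
        Exec b (Prog.loop c p) σ (c.cost b σ + T + U) ρ

end RAM

/-! ### The counting problem as a machine task -/

namespace WeightedDAG

variable {n m : ℕ}

/-- The input store. The variables `0, …, 5` hold `n`, `m`, `s`, `t`, `C` and an integer `E`; the
arrays `0`, `1`, `2` hold the tails, the heads and the weights of the arcs, in any order.
Everything else is `0`. -/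
def input (G : WeightedDAG n m) (s t : Fin n) (C E : ℕ) : RAM.Store where
  var
    | 0 => n
    | 1 => m
    | 2 => s
    | 3 => t
    | 4 => C
    | 5 => E
    | _ => 0
  arr
    | 0, i => if h : i < m then (G.src ⟨i, h⟩ : ℕ) else 0
    | 1, i => if h : i < m then (G.dst ⟨i, h⟩ : ℕ) else 0
    | 2, i => if h : i < m then G.weight ⟨i, h⟩ else 0
    | _, _ => 0

/-- The word length: enough bits for each of `n`, `m`, the capacity and the weights. -/
def wordLength (G : WeightedDAG n m) (C : ℕ) : ℕ := Nat.size (n + m + C + G.maxWeight)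

end WeightedDAG

/-- The floating-point number (mantissa in variable `0`, exponent in variable `1`) that is read off
from a store. -/
def RAM.Store.output (σ : RAM.Store) : ℕ := σ.var 0 * 2 ^ σ.var 1

/-! For a fixed source, each vertex `v` gets a nondecreasing step function approximating `c ↦ 2 ^ h
* pathCount s v c`, stored as a list of breakpoints with floating-point values of `h + 1` mantissa
bits. Splitting off the last arc (`pathCount_eq`) expresses the function of `v` as the sum of the
functions of the tails, each shifted by the weight of the arc, plus the constant one if `v` is the
source. The scaling by `2 ^ h` makes every positive count a normalised number.

Two functions are added by sweeping over their breakpoints. A breakpoint is emitted only when the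
code of the sum (exponent, then mantissa, with the last `s` bits dropped) strictly rises. So the
error is at most `(2 ^ s + 2) / 2 ^ h` relative to the exact sum, and the number of breakpoints is
at most the number of codes, `X * 2 ^ (h + 1 - s)`, where all counts are below `2 ^ X`
(`Merge.spec`, `Good.merge`). Errors are measured against the true value, so successive errors just
add up (`Approx.trans`).

The functions at one vertex are summed in a balanced binary tree. Dropping `s` bits on each level
would cost a factor logarithmic in the indegree in the error. Instead level `k` drops only `s - k /
2` bits. Then the errors decay geometrically over the levels, while the lists grow by `2 ^ (k / 2)`
and their number shrinks by `2 ^ k`, so the work decays geometrically too (`error_step`,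
`potential_step`). One more merge, with the empty list, compresses the result back to the bound `Λ =
X * 2 ^ (h + 1 - s)`. A vertex thus costs `O(Λ)` per incoming arc and adds at most `10 * 2 ^ s / 2 ^
h` to the error.

After `n` vertices the error is `10 * n * 2 ^ s / 2 ^ h`, which is at most `ε` for `h = s + log n +
log (1 / ε) + O(1)`. The number of paths is at most the product of the numbers `1 + indeg u`
(`pathCount_le_prod`), hence at most `(1 + m / n) ^ n` by concavity of the logarithm, and `X = O(n *
max 1 (log (m / n)))`. Hence `Λ = O(n ^ 2 * max 1 (log (m / n)) / ε)`, and the `m` arcs give the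
claimed number of steps. All numbers have `B = 3 * b + log (1 / ε) + O(1)` bits for words of `b`
bits, and `B / b + 1` gives the last factor of the bound.

Program correctness, step counts and number sizes are proved together in a weakest-precondition
calculus (`Wp`). -/

namespace RAM

/-! ### Bounding costs by step counts for numbers of at most `B` bits. -/

/-- The number of nodes of a term. -/
def Term.nodes : Term → ℕ
  | const _ => 1
  | var _ => 1
  | cell _ i => i.nodes + 1
  | add e f => e.nodes + f.nodes + 1
  | sub e f => e.nodes + f.nodes + 1
  | shl e f => e.nodes + f.nodes + 1
  | shr e f => e.nodes + f.nodes + 1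

/-- Constants, sums and left shifts in the term have values of at most `B` bits. -/
def Term.Small (B : ℕ) (σ : Store) : Term → Prop
  | const k => k < 2 ^ B
  | var _ => True
  | cell _ i => i.Small B σ
  | add e f => e.Small B σ ∧ f.Small B σ ∧ e.val σ + f.val σ < 2 ^ B
  | sub e f => e.Small B σ ∧ f.Small B σ
  | shl e f => e.Small B σ ∧ f.Small B σ ∧ e.val σ * 2 ^ f.val σ < 2 ^ B
  | shr e f => e.Small B σ ∧ f.Small B σ

/-- All numbers in the store have at most `B` bits. -/
def Store.Bdd (B : ℕ) (σ : Store) : Prop :=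
  (∀ x, σ.var x < 2 ^ B) ∧ ∀ a i, σ.arr a i < 2 ^ B

theorem Term.val_lt {B : ℕ} {σ : Store} (hσ : σ.Bdd B) :
    ∀ e : Term, e.Small B σ → e.val σ < 2 ^ B
  | const _, h => h
  | var x, _ => hσ.1 x
  | cell a _, _ => hσ.2 a _
  | add _ _, h => h.2.2
  | sub e _, h => lt_of_le_of_lt (Nat.sub_le _ _) (e.val_lt hσ h.1)
  | shl _ _, h => h.2.2
  | shr e _, h => lt_of_le_of_lt (Nat.div_le_self _ _) (e.val_lt hσ h.1)

theorem words_le {b B v : ℕ} (h : v < 2 ^ B) : words b v ≤ B / b + 1 :=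
  Nat.add_le_add_right (Nat.div_le_div_right (Nat.size_le.2 h)) 1

/-- Every node is charged once, for a value of at most `B` bits. Differences, right shifts and cells
cannot exceed the numbers already present, which is why `Term.Small` restricts only the other nodes.
-/
theorem Term.cost_le {b B : ℕ} {σ : Store} (hσ : σ.Bdd B) (e : Term) (h : e.Small B σ) :
    e.cost b σ ≤ e.nodes * (B / b + 1) := by
  induction e with
  | const k => simpa [cost, nodes] using words_le h
  | var x => simpa [cost, nodes] using words_le (hσ.1 x)
  | cell a i ih =>
    have := ih h
    have h1 := words_le (b := b) (Term.val_lt hσ _ h)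
    simp only [cost, nodes, add_mul, one_mul] at *
    omega
  | add e f ihe ihf | sub e f ihe ihf | shl e f ihe ihf | shr e f ihe ihf =>
    have h1 := words_le (b := b) (Term.val_lt hσ _ h)
    have h2 := ihe h.1
    have h3 := ihf (by first | exact h.2.1 | exact h.2)
    simp only [cost, nodes, add_mul, one_mul] at *
    omega

/-- The number of steps charged for a comparison. -/
def Test.nodes : Test → ℕ
  | le e f => e.nodes + f.nodes + 1
  | eq e f => e.nodes + f.nodes + 1

/-- Both sides of the comparison are small. -/
def Test.Small (B : ℕ) (σ : Store) : Test → Prop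
  | le e f => e.Small B σ ∧ f.Small B σ
  | eq e f => e.Small B σ ∧ f.Small B σ

theorem Test.cost_le {b B : ℕ} {σ : Store} (hσ : σ.Bdd B) (c : Test) (h : c.Small B σ) :
    c.cost b σ ≤ c.nodes * (B / b + 1) := by
  cases c with
  | le e f | eq e f =>
    have h1 := e.cost_le (b := b) hσ h.1
    have h2 := f.cost_le (b := b) hσ h.2
    simp only [cost, nodes, add_mul, one_mul] at *
    generalize B / b = W at *
    omega

/-! ### Frames: what a program leaves unchanged. -/

/-- The variables that a program may change. -/
def Prog.vars : Prog → List ℕ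
  | skip => []
  | assign x _ => [x]
  | write _ _ _ => []
  | seq p q => p.vars ++ q.vars
  | cond _ p q => p.vars ++ q.vars
  | loop _ p => p.vars

/-- The arrays that a program may change. -/
def Prog.arrs : Prog → List ℕ
  | skip => []
  | assign _ _ => []
  | write a _ _ => [a]
  | seq p q => p.arrs ++ q.arrs
  | cond _ p q => p.arrs ++ q.arrs
  | loop _ p => p.arrs

/-- The two stores agree outside of what `p` may change. -/
def Prog.Frame (p : Prog) (σ τ : Store) : Prop :=
  (∀ x, x ∉ p.vars → τ.var x = σ.var x) ∧ ∀ a, a ∉ p.arrs → τ.arr a = σ.arr a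

@[simp] theorem Store.setVar_var (σ : Store) (x k y : ℕ) :
    (σ.setVar x k).var y = if y = x then k else σ.var y := by
  simp [setVar, Function.update_apply]

@[simp] theorem Store.setVar_arr (σ : Store) (x k : ℕ) : (σ.setVar x k).arr = σ.arr := rfl

@[simp] theorem Store.setCell_var (σ : Store) (a i k : ℕ) : (σ.setCell a i k).var = σ.var := rfl

@[simp] theorem Store.setCell_arr (σ : Store) (a i k a' i' : ℕ) :
    (σ.setCell a i k).arr a' i' = if a' = a ∧ i' = i then k else σ.arr a' i' := by
  by_cases h : a' = a
  · subst h; simp [setCell, Function.update_apply]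
  · simp [setCell, h]

/-- A syntactic check suffices, so that specifications need to mention only what changes; membership
in the lists is later settled by `decide`. -/
theorem Exec.frame {b : ℕ} {p : Prog} {σ τ : Store} {T : ℕ} (h : Exec b p σ T τ) :
    p.Frame σ τ := by
  induction h with
  | skip σ => exact ⟨fun _ _ => rfl, fun _ _ => rfl⟩
  | assign σ x e =>
    refine ⟨fun y hy => ?_, fun _ _ => rfl⟩
    simp only [Prog.vars, List.mem_singleton] at hy
    simp [hy]
  | write σ a i e =>
    refine ⟨fun _ _ => rfl, fun a' ha => ?_⟩
    simp only [Prog.arrs, List.mem_singleton] at ha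
    funext i'
    simp [ha]
  | seq _ _ h1 h2 =>
    refine ⟨fun x hx => ?_, fun a ha => ?_⟩
    · simp only [Prog.vars, List.mem_append, not_or] at hx
      rw [h2.1 x hx.2, h1.1 x hx.1]
    · simp only [Prog.arrs, List.mem_append, not_or] at ha
      rw [h2.2 a ha.2, h1.2 a ha.1]
  | cond_true _ _ h1 =>
    refine ⟨fun x hx => h1.1 x ?_, fun a ha => h1.2 a ?_⟩
    · simp only [Prog.vars, List.mem_append, not_or] at hx; exact hx.1
    · simp only [Prog.arrs, List.mem_append, not_or] at ha; exact ha.1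
  | cond_false _ _ h1 =>
    refine ⟨fun x hx => h1.1 x ?_, fun a ha => h1.2 a ?_⟩
    · simp only [Prog.vars, List.mem_append, not_or] at hx; exact hx.2
    · simp only [Prog.arrs, List.mem_append, not_or] at ha; exact ha.2
  | loop_done _ => exact ⟨fun _ _ => rfl, fun _ _ => rfl⟩
  | loop_step _ _ _ h1 h2 =>
    exact ⟨fun x hx => (h2.1 x hx).trans (h1.1 x hx), fun a ha => (h2.2 a ha).trans (h1.2 a ha)⟩

/-! ### A weakest-precondition calculus with step counts. -/

/-- Started in the store `σ`, if this has only `B`-bit numbers, the program terminates within `S`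
steps of at most `B / b + 1` time units in a store `τ` of `B`-bit numbers with `Q τ S`. -/
def Wp (b B : ℕ) (p : Prog) (Q : Store → ℕ → Prop) (σ : Store) : Prop :=
  σ.Bdd B → ∃ τ T S, Exec b p σ T τ ∧ T ≤ S * (B / b + 1) ∧ τ.Bdd B ∧ Q τ S

namespace Wp

variable {b B : ℕ} {Q R : Store → ℕ → Prop} {σ : Store}

theorem skip (h : Q σ 1) : Wp b B Prog.skip Q σ :=
  fun hσ => ⟨σ, 1, 1, Exec.skip σ, by simp, hσ, h⟩

theorem assign {x : ℕ} {e : Term} (he : e.Small B σ)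
    (h : Q (σ.setVar x (e.val σ)) (e.nodes + 1)) : Wp b B (Prog.assign x e) Q σ := by
  intro hσ
  refine ⟨_, _, _, Exec.assign σ x e, ?_, ⟨fun y => ?_, hσ.2⟩, h⟩
  · have := e.cost_le (b := b) hσ he
    rw [add_mul, one_mul]
    generalize B / b = W at *
    omega
  · rw [Store.setVar_var]
    split_ifs
    · exact e.val_lt hσ he
    · exact hσ.1 y

theorem write {a : ℕ} {i e : Term} (hi : i.Small B σ) (he : e.Small B σ)
    (h : Q (σ.setCell a (i.val σ) (e.val σ)) (i.nodes + e.nodes + 1)) :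
    Wp b B (Prog.write a i e) Q σ := by
  intro hσ
  refine ⟨_, _, _, Exec.write σ a i e, ?_, ⟨hσ.1, fun y j => ?_⟩, h⟩
  · have := e.cost_le (b := b) hσ he
    have := i.cost_le (b := b) hσ hi
    simp only [add_mul, one_mul]
    generalize B / b = W at *
    omega
  · rw [Store.setCell_arr]
    split_ifs
    · exact e.val_lt hσ he
    · exact hσ.2 y j

theorem seq {p q : Prog} (h : Wp b B p (fun τ S => Wp b B q (fun ρ U => Q ρ (S + U)) τ) σ) :
    Wp b B (Prog.seq p q) Q σ := by
  intro hσ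
  obtain ⟨τ, T, S, h1, h2, h3, h4⟩ := h hσ
  obtain ⟨ρ, T', S', k1, k2, k3, k4⟩ := h4 h3
  exact ⟨ρ, _, _, Exec.seq h1 k1, by rw [add_mul]; omega, k3, k4⟩

theorem cond {c : Test} {p q : Prog} (hc : c.Small B σ)
    (h1 : c.holds σ → Wp b B p (fun τ S => Q τ (c.nodes + S)) σ)
    (h2 : ¬ c.holds σ → Wp b B q (fun τ S => Q τ (c.nodes + S)) σ) :
    Wp b B (Prog.cond c p q) Q σ := by
  intro hσ
  have h0 := c.cost_le (b := b) hσ hc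
  by_cases h : c.holds σ
  · obtain ⟨τ, T, S, k1, k2, k3, k4⟩ := h1 h hσ
    exact ⟨τ, _, _, Exec.cond_true h k1, by rw [add_mul]; omega, k3, k4⟩
  · obtain ⟨τ, T, S, k1, k2, k3, k4⟩ := h2 h hσ
    exact ⟨τ, _, _, Exec.cond_false h k1, by rw [add_mul]; omega, k3, k4⟩

theorem mono {p : Prog} (h : Wp b B p Q σ) (hQ : ∀ τ S, Q τ S → R τ S) : Wp b B p R σ := by
  intro hσ
  obtain ⟨τ, T, S, h1, h2, h3, h4⟩ := h hσ
  exact ⟨τ, T, S, h1, h2, h3, hQ _ _ h4⟩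

theorem frame {p : Prog} (h : Wp b B p Q σ) (hQ : ∀ τ S, p.Frame σ τ → Q τ S → R τ S) :
    Wp b B p R σ := by
  intro hσ
  obtain ⟨τ, T, S, h1, h2, h3, h4⟩ := h hσ
  exact ⟨τ, T, S, h1, h2, h3, hQ _ _ h1.frame h4⟩

/-- The rule for loops: `I a σ k` is an invariant, with auxiliary data `a`, after `k` steps,
and `f a` decreases. -/
theorem loop {α : Type*} {c : Test} {p : Prog} (I : α → Store → ℕ → Prop) (f : α → ℕ) (a₀ : α)
    (h0 : I a₀ σ 0)
    (hs : ∀ a τ k, p.Frame σ τ → I a τ k → c.Small B τ ∧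
      (c.holds τ → Wp b B p (fun ρ S => ∃ a', f a' < f a ∧ I a' ρ (k + c.nodes + S)) τ) ∧
      (¬ c.holds τ → Q τ (k + c.nodes))) :
    Wp b B (Prog.loop c p) Q σ := by
  -- Induction on a bound `N` of the variant `f a`; the frame relative to the store before the whole
  -- loop is carried along, so invariants need not repeat unchanged variables.
  suffices H : ∀ N a τ k, f a < N → p.Frame σ τ → I a τ k → τ.Bdd B →
      ∃ ρ T S, Exec b (Prog.loop c p) τ T ρ ∧ T ≤ S * (B / b + 1) ∧ ρ.Bdd B ∧ Q ρ (k + S) by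
    intro hσ
    obtain ⟨ρ, T, S, h1, h2, h3, h4⟩ := H _ a₀ σ 0 (Nat.lt_succ_self _)
      ⟨fun _ _ => rfl, fun _ _ => rfl⟩ h0 hσ
    exact ⟨ρ, T, S, h1, h2, h3, by simpa using h4⟩
  intro N
  induction N with
  | zero => intro a τ k h; omega
  | succ N ih =>
    intro a τ k hN hF hI hτ
    obtain ⟨hc, h1, h2⟩ := hs a τ k hF hI
    have hcost := c.cost_le (b := b) hτ hc
    by_cases h : c.holds τ
    · obtain ⟨ρ, T, S, k1, k2, k3, a', ha', k4⟩ := h1 h hτ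
      have hF' := k1.frame
      obtain ⟨ρ', T', S', l1, l2, l3, l4⟩ := ih a' ρ _ (by omega)
        ⟨fun x hx => (hF'.1 x hx).trans (hF.1 x hx), fun x hx => (hF'.2 x hx).trans (hF.2 x hx)⟩
        k4 k3
      refine ⟨ρ', _, c.nodes + S + S', Exec.loop_step h k1 l1, ?_, l3, ?_⟩
      · simp only [add_mul]; omega
      · rwa [← add_assoc, ← add_assoc]
    · exact ⟨τ, _, _, Exec.loop_done h, hcost, hτ, h2 h⟩

end Wp

end RAM

/-! ### Floating-point numbers and approximate sums of step functions -/

namespace StepFun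

/-- The value of a floating-point number, given by its mantissa and its exponent. -/
def fval (f : ℕ × ℕ) : ℕ := f.1 * 2 ^ f.2

/-- The mantissa has exactly `h + 1` bits. -/
def FNorm (h : ℕ) (f : ℕ × ℕ) : Prop := 2 ^ h ≤ f.1 ∧ f.1 < 2 ^ (h + 1)

/-- Zero, or a number with a mantissa of `h + 1` bits. -/
def FOk (h : ℕ) (f : ℕ × ℕ) : Prop := f = (0, 0) ∨ FNorm h f

/-- Addition of floating-point numbers, rounding down. -/
def flAdd (h : ℕ) (f g : ℕ × ℕ) : ℕ × ℕ :=
  let e := f.2 + (g.2 - f.2)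
  let M := f.1 / 2 ^ (e - f.2) + g.1 / 2 ^ (e - g.2)
  let t := M / 2 ^ (h + 1)
  (M / 2 ^ t, e + t)

theorem flAdd_comm (h : ℕ) (f g : ℕ × ℕ) : flAdd h f g = flAdd h g f := by
  have : f.2 + (g.2 - f.2) = g.2 + (f.2 - g.2) := by omega
  simp only [flAdd, this, add_comm (f.1 / _)]

/-- Aligning the smaller exponent and renormalising each lose at most one unit `2 ^ f.2`, while a
normalised `f` is at least `2 ^ h * 2 ^ f.2`; hence the relative error `2 / 2 ^ h`. If `f` is zero,
then `g` has exponent zero and is returned unchanged. -/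
theorem flAdd_aux {h : ℕ} {f g : ℕ × ℕ} (hf : FOk h f) (hg : FOk h g)
    (hfg : FNorm h f ∨ FNorm h g) (hle : g.2 ≤ f.2) :
    FNorm h (flAdd h f g) ∧ fval (flAdd h f g) ≤ fval f + fval g ∧
      2 ^ h * (fval f + fval g) ≤ 2 ^ h * fval (flAdd h f g) + 2 * (fval f + fval g) ∧
      (flAdd h f g).2 ≤ f.2 + 1 := by
  have hgm : g.1 < 2 ^ (h + 1) := by
    rcases hg with rfl | hg
    · simp
    · exact hg.2
  rcases hf with rfl | hf
  · have hn : FNorm h g := by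
      rcases hfg with hfg | hfg
      · exact absurd hfg.1 (by simp)
      · exact hfg
    have he : g.2 = 0 := by simpa using hle
    have : flAdd h (0, 0) g = g := by
      have h1 : g.1 / 2 ^ (h + 1) = 0 := Nat.div_eq_of_lt hgm
      ext <;> simp [flAdd, he, h1]
    rw [this]
    refine ⟨hn, by simp, by simp [fval], by simp [he]⟩
  · obtain ⟨d, hd⟩ := Nat.exists_eq_add_of_le hle
    have he : f.2 + (g.2 - f.2) = f.2 := by omega
    have hdd : f.2 - g.2 = d := by omega
    set M := f.1 + g.1 / 2 ^ d with hM
    have hfl : flAdd h f g = (M / 2 ^ (M / 2 ^ (h + 1)), f.2 + M / 2 ^ (h + 1)) := by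
      simp [flAdd, he, hdd, hM]
    have hgd : g.1 / 2 ^ d ≤ g.1 := Nat.div_le_self _ _
    have hM1 : 2 ^ h ≤ M := le_trans hf.1 (Nat.le_add_right _ _)
    have hp : 2 ^ (h + 1) = 2 * 2 ^ h := by ring
    have hM2 : M < 2 * 2 ^ (h + 1) := by have := hf.2; omega
    have hA1 : M * 2 ^ f.2 ≤ fval f + fval g := by
      have : g.1 / 2 ^ d * 2 ^ f.2 ≤ g.1 * 2 ^ g.2 := by
        rw [hd, pow_add, mul_comm (2 ^ g.2), ← mul_assoc]
        exact Nat.mul_le_mul_right _ (Nat.div_mul_le_self _ _)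
      simp only [fval, hM, add_mul]
      omega
    have hA2 : fval f + fval g ≤ M * 2 ^ f.2 + 2 ^ f.2 := by
      have h1 : g.1 ≤ g.1 / 2 ^ d * 2 ^ d + 2 ^ d := by
        have := Nat.div_add_mod g.1 (2 ^ d)
        have := Nat.mod_lt g.1 (Nat.two_pow_pos d)
        rw [mul_comm]
        omega
      have : g.1 * 2 ^ g.2 ≤ g.1 / 2 ^ d * 2 ^ f.2 + 2 ^ f.2 := by
        calc g.1 * 2 ^ g.2 ≤ (g.1 / 2 ^ d * 2 ^ d + 2 ^ d) * 2 ^ g.2 := Nat.mul_le_mul_right _ h1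
          _ = _ := by rw [hd, pow_add]; ring
      simp only [fval, hM, add_mul]
      omega
    have hA3 : 2 ^ h * 2 ^ f.2 ≤ fval f + fval g :=
      le_trans (Nat.mul_le_mul_right _ hf.1) (Nat.le_add_right _ _)
    have hE : ∀ x, fval f + fval g ≤ x + 2 * 2 ^ f.2 →
        2 ^ h * (fval f + fval g) ≤ 2 ^ h * x + 2 * (fval f + fval g) := by
      intro x hx
      calc 2 ^ h * (fval f + fval g) ≤ 2 ^ h * (x + 2 * 2 ^ f.2) := Nat.mul_le_mul_left _ hx
        _ = 2 ^ h * x + 2 * (2 ^ h * 2 ^ f.2) := by ring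
        _ ≤ _ := by omega
    rw [hfl]
    rcases lt_or_ge M (2 ^ (h + 1)) with ht | ht
    · rw [Nat.div_eq_of_lt ht]
      simp only [pow_zero, Nat.div_one, add_zero]
      exact ⟨⟨hM1, ht⟩, hA1, hE _ (by simp only [fval] at *; omega), by omega⟩
    · have ht1 : M / 2 ^ (h + 1) = 1 := by
        rw [Nat.div_eq_iff (Nat.two_pow_pos _)]
        omega
      rw [ht1]
      have h3 : M / 2 * 2 ≤ M := Nat.div_mul_le_self _ _
      have h4 : M ≤ M / 2 * 2 + 1 := by omega
      have h5 : fval (M / 2 ^ 1, f.2 + 1) = M / 2 * 2 * 2 ^ f.2 := by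
        rw [fval, pow_one, pow_succ, ← mul_assoc, mul_right_comm]
      refine ⟨⟨?_, ?_⟩, ?_, hE _ ?_, le_rfl⟩
      · simp only [pow_one]; omega
      · simp only [pow_one]; omega
      · rw [h5]
        exact le_trans (Nat.mul_le_mul_right _ h3) hA1
      · rw [h5]
        have h6 : M * 2 ^ f.2 ≤ M / 2 * 2 * 2 ^ f.2 + 2 ^ f.2 := by
          calc M * 2 ^ f.2 ≤ (M / 2 * 2 + 1) * 2 ^ f.2 := Nat.mul_le_mul_right _ h4
            _ = _ := by ring
        omega

theorem flAdd_spec {h : ℕ} {f g : ℕ × ℕ} (hf : FOk h f) (hg : FOk h g)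
    (hfg : FNorm h f ∨ FNorm h g) :
    FNorm h (flAdd h f g) ∧ fval (flAdd h f g) ≤ fval f + fval g ∧
      2 ^ h * (fval f + fval g) ≤ 2 ^ h * fval (flAdd h f g) + 2 * (fval f + fval g) ∧
      (flAdd h f g).2 ≤ max f.2 g.2 + 1 := by
  rcases le_total g.2 f.2 with hle | hle
  · obtain ⟨h1, h2, h3, h4⟩ := flAdd_aux hf hg hfg hle
    exact ⟨h1, h2, h3, by omega⟩
  · obtain ⟨h1, h2, h3, h4⟩ := flAdd_aux hg hf hfg.symm hle
    rw [flAdd_comm, add_comm (fval f)]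
    exact ⟨h1, h2, h3, by omega⟩

/-- A monotone code of floating-point numbers, with the last `s` bits dropped. -/
def key (h s : ℕ) (f : ℕ × ℕ) : ℕ := (f.2 * 2 ^ (h + 1) + f.1) / 2 ^ s

theorem fval_lt_of_exp_lt {h : ℕ} {f g : ℕ × ℕ} (hf : FNorm h f) (hg : FNorm h g)
    (he : f.2 < g.2) : fval f ≤ fval g := by
  calc f.1 * 2 ^ f.2 ≤ 2 ^ (h + 1) * 2 ^ f.2 := Nat.mul_le_mul_right _ hf.2.le
    _ = 2 ^ h * 2 ^ (f.2 + 1) := by ring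
    _ ≤ g.1 * 2 ^ g.2 := Nat.mul_le_mul hg.1 (Nat.pow_le_pow_right (by norm_num) he)

theorem fval_le_of_key_lt {h s : ℕ} {f g : ℕ × ℕ} (hf : FNorm h f) (hg : FNorm h g)
    (hk : key h s f < key h s g) : fval f ≤ fval g := by
  have h1 : f.2 * 2 ^ (h + 1) + f.1 < g.2 * 2 ^ (h + 1) + g.1 := by
    by_contra hc
    exact absurd (Nat.div_le_div_right (c := 2 ^ s) (not_lt.1 hc)) (not_le.2 hk)
  rcases lt_trichotomy f.2 g.2 with he | he | he
  · exact fval_lt_of_exp_lt hf hg he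
  · rw [he] at h1
    simp only [fval, he]
    exact Nat.mul_le_mul_right _ (by omega)
  · have := Nat.mul_le_mul_right (2 ^ (h + 1)) (Nat.succ_le_of_lt he)
    have := hg.2
    rw [Nat.succ_mul] at *
    omega

/-- With equal exponents the mantissas differ by at most `2 ^ s`, and a unit of the mantissa is
worth at most `fval f / 2 ^ h`. A larger exponent of `f` is impossible: the code jumps by at least
`2 ^ h` there, and `s ≤ h`. -/
theorem fval_le_of_key_le {h s : ℕ} (hs : s ≤ h) {f g : ℕ × ℕ} (hf : FNorm h f) (hg : FNorm h g)
    (hk : key h s f ≤ key h s g) : 2 ^ h * fval f ≤ 2 ^ h * fval g + 2 ^ s * fval f := by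
  have h1 : f.2 * 2 ^ (h + 1) + f.1 < g.2 * 2 ^ (h + 1) + g.1 + 2 ^ s := by
    have h2 := Nat.div_mul_le_self (g.2 * 2 ^ (h + 1) + g.1) (2 ^ s)
    have h3 := Nat.lt_div_mul_add (a := f.2 * 2 ^ (h + 1) + f.1) (Nat.two_pow_pos s)
    have h4 := Nat.mul_le_mul_right (2 ^ s) hk
    simp only [key] at h4
    omega
  have hsh : 2 ^ s ≤ 2 ^ h := Nat.pow_le_pow_right (by norm_num) hs
  rcases lt_trichotomy f.2 g.2 with he | he | he
  · exact le_trans (Nat.mul_le_mul_left _ (fval_lt_of_exp_lt hf hg he)) (Nat.le_add_right _ _)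
  · rw [he] at h1
    simp only [fval, he]
    have h5 : f.1 ≤ g.1 + 2 ^ s := by omega
    calc 2 ^ h * (f.1 * 2 ^ g.2) ≤ 2 ^ h * ((g.1 + 2 ^ s) * 2 ^ g.2) := by gcongr
      _ = 2 ^ h * (g.1 * 2 ^ g.2) + 2 ^ s * (2 ^ h * 2 ^ g.2) := by ring
      _ ≤ _ := by have := hf.1; gcongr
  · have := Nat.mul_le_mul_right (2 ^ (h + 1)) (Nat.succ_le_of_lt he)
    have := hg.2
    have := hf.1
    rw [Nat.succ_mul] at *
    omega

/-- This makes the initial key `0` a marker for the value zero: the first nonzero sum is always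
emitted. -/
theorem key_pos {h s : ℕ} (hs : s ≤ h) {f : ℕ × ℕ} (hf : FNorm h f) : 0 < key h s f := by
  refine Nat.div_pos ?_ (Nat.two_pow_pos s)
  have hsh : 2 ^ s ≤ 2 ^ h := Nat.pow_le_pow_right (by norm_num) hs
  have := hf.1
  omega

/-- The value at `c` of the step function with the breakpoints `l`, shifted by `w`, that starts
with the value `a`. -/
def lval (w c : ℕ) : ℕ → List (ℕ × ℕ × ℕ) → ℕ
  | a, [] => a
  | a, p :: l => if p.1 + w ≤ c then lval w c (fval p.2) l else a

/-- The breakpoints and the values ascend, starting from `c` and `a`. -/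
def Asc (h : ℕ) : ℕ → ℕ → List (ℕ × ℕ × ℕ) → Prop
  | _, _, [] => True
  | c, a, p :: l => c ≤ p.1 ∧ a ≤ fval p.2 ∧ FNorm h p.2 ∧ Asc h p.1 (fval p.2) l

theorem Asc.mono {h c c' a a' : ℕ} {l : List (ℕ × ℕ × ℕ)} (hl : Asc h c a l) (hc : c' ≤ c)
    (ha : a' ≤ a) : Asc h c' a' l := by
  cases l with
  | nil => trivial
  | cons p l => exact ⟨hc.trans hl.1, ha.trans hl.2.1, hl.2.2⟩

theorem Asc.norm {h c a : ℕ} {l : List (ℕ × ℕ × ℕ)} (hl : Asc h c a l) {p : ℕ × ℕ × ℕ}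
    (hp : p ∈ l) : FNorm h p.2 := by
  induction l generalizing c a with
  | nil => simp at hp
  | cons q l ih =>
    rcases List.mem_cons.1 hp with rfl | hp
    · exact hl.2.2.1
    · exact ih hl.2.2.2 hp

theorem Asc.le_lval {h c₀ a : ℕ} {l : List (ℕ × ℕ × ℕ)} (hl : Asc h c₀ a l) (w c : ℕ) :
    a ≤ lval w c a l := by
  induction l generalizing c₀ a with
  | nil => exact le_rfl
  | cons p l ih =>
    rw [lval]
    split_ifs
    · exact hl.2.1.trans (ih hl.2.2.2)
    · exact le_rfl

theorem Asc.lval_of_lt {h c₀ a : ℕ} {l : List (ℕ × ℕ × ℕ)} (hl : Asc h c₀ a l) {w c : ℕ}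
    (hc : c < c₀ + w) : lval w c a l = a := by
  cases l with
  | nil => rfl
  | cons p l =>
    rw [lval, if_neg]
    have := hl.1
    omega

/-- The time of the first breakpoint (after the capacity `C` if there is none). -/
def headTime (C w : ℕ) : List (ℕ × ℕ × ℕ) → ℕ
  | [] => C + 1 + w
  | p :: _ => p.1 + w

theorem lval_of_lt_headTime {C w c a : ℕ} {l : List (ℕ × ℕ × ℕ)} (hc : c < headTime C w l) :
    lval w c a l = a := by
  cases l with
  | nil => rfl
  | cons p l => rw [lval, if_neg]; simpa [headTime] using hc

/-! ### The sweep over two shifted step functions, as a relation. -/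

/-- The remaining breakpoints and the current values of two step functions. -/
structure Sweep where
  l₁ : List (ℕ × ℕ × ℕ)
  l₂ : List (ℕ × ℕ × ℕ)
  f₁ : ℕ × ℕ
  f₂ : ℕ × ℕ

namespace Sweep

variable {h s C w₁ w₂ : ℕ}

/-- The current sum of the values. -/
def sum (S : Sweep) : ℕ := fval S.f₁ + fval S.f₂

/-- The sum of the shifted step functions at `c`. -/
def total (w₁ w₂ : ℕ) (S : Sweep) (c : ℕ) : ℕ :=
  lval w₁ c (fval S.f₁) S.l₁ + lval w₂ c (fval S.f₂) S.l₂

/-- The time of the next event. -/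
def next (C w₁ w₂ : ℕ) (S : Sweep) : ℕ := min (headTime C w₁ S.l₁) (headTime C w₂ S.l₂)

/-- The remaining breakpoints ascend, and the values are correct floating-point numbers. -/
structure Ok (h : ℕ) (S : Sweep) : Prop where
  asc₁ : Asc h 0 (fval S.f₁) S.l₁
  asc₂ : Asc h 0 (fval S.f₂) S.l₂
  ok₁ : FOk h S.f₁
  ok₂ : FOk h S.f₂

/-- The step from one event to the next. -/
inductive Adv (C w₁ w₂ : ℕ) : Sweep → Sweep → Prop
  | left (p l₁ l₂ f₁ f₂) (h1 : p.1 + w₁ ≤ headTime C w₂ l₂) (h2 : p.1 + w₁ ≤ C) :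
      Adv C w₁ w₂ ⟨p :: l₁, l₂, f₁, f₂⟩ ⟨l₁, l₂, p.2, f₂⟩
  | right (p l₁ l₂ f₁ f₂) (h1 : p.1 + w₂ ≤ headTime C w₁ l₁) (h2 : p.1 + w₂ ≤ C) :
      Adv C w₁ w₂ ⟨l₁, p :: l₂, f₁, f₂⟩ ⟨l₁, l₂, f₁, p.2⟩

theorem headTime_of_asc {c a w : ℕ} {l : List (ℕ × ℕ × ℕ)} (hl : Asc h c a l) (hc : c + w ≤ C) :
    c + w ≤ headTime C w l := by
  cases l with
  | nil => simp only [headTime]; omega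
  | cons p l => simp only [headTime]; have := hl.1; omega

/-- Before the next event the total is the current sum; from the event on it is the total of the
advanced state. Simultaneous breakpoints are separate events at the same time, hence only `≤`
between successive event times. -/
theorem Adv.spec {S S' : Sweep} (hA : Adv C w₁ w₂ S S') (hS : S.Ok h) :
    S'.Ok h ∧ S.sum ≤ S'.sum ∧ (FNorm h S'.f₁ ∨ FNorm h S'.f₂) ∧ S.next C w₁ w₂ ≤ C ∧
      S.next C w₁ w₂ ≤ S'.next C w₁ w₂ ∧
      (∀ c < S.next C w₁ w₂, S.total w₁ w₂ c = S.sum) ∧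
      (∀ c, S.next C w₁ w₂ ≤ c → S.total w₁ w₂ c = S'.total w₁ w₂ c) := by
  have key : ∀ c < S.next C w₁ w₂, S.total w₁ w₂ c = S.sum := by
    intro c hc
    rw [next, lt_min_iff] at hc
    rw [total, lval_of_lt_headTime hc.1, lval_of_lt_headTime hc.2, sum]
  cases hA with
  | left p l₁ l₂ f₁ f₂ h1 h2 =>
    obtain ⟨a1, a2, a3, a4⟩ := hS
    have hn : next C w₁ w₂ ⟨p :: l₁, l₂, f₁, f₂⟩ = p.1 + w₁ :=
      min_eq_left h1
    rw [hn] at key ⊢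
    refine ⟨⟨a1.2.2.2.mono (Nat.zero_le _) le_rfl, a2, Or.inr a1.2.2.1, a4⟩, ?_,
      Or.inl a1.2.2.1, h2, ?_, key, ?_⟩
    · exact Nat.add_le_add_right a1.2.1 _
    · exact le_min (headTime_of_asc a1.2.2.2 h2) h1
    · intro c hc
      simp only [total, lval, if_pos hc]
  | right p l₁ l₂ f₁ f₂ h1 h2 =>
    obtain ⟨a1, a2, a3, a4⟩ := hS
    have hn : next C w₁ w₂ ⟨l₁, p :: l₂, f₁, f₂⟩ = p.1 + w₂ :=
      min_eq_right h1
    rw [hn] at key ⊢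
    refine ⟨⟨a1, a2.2.2.2.mono (Nat.zero_le _) le_rfl, a3, Or.inr a2.2.2.1⟩, ?_,
      Or.inr a2.2.2.1, h2, ?_, key, ?_⟩
    · exact Nat.add_le_add_left a2.2.1 _
    · exact le_min h1 (headTime_of_asc a2.2.2.2 h2)
    · intro c hc
      simp only [total, lval, if_pos hc]

/-- The rounded sum of the current values. -/
def fsum (h : ℕ) (S : Sweep) : ℕ × ℕ := flAdd h S.f₁ S.f₂

/-- `Merge h s C w₁ w₂ S q out`: the breakpoints of the approximate sum are `out`, if a
breakpoint is put only where the key rises above its previous value, which is `q` at first. -/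
inductive Merge (h s C w₁ w₂ : ℕ) : Sweep → ℕ → List (ℕ × ℕ × ℕ) → Prop
  | done (S q) (hC : C < S.next C w₁ w₂) : Merge h s C w₁ w₂ S q []
  | push (S S' q out) (hA : Adv C w₁ w₂ S S') (hq : q < key h s (S'.fsum h))
      (hM : Merge h s C w₁ w₂ S' (key h s (S'.fsum h)) out) :
      Merge h s C w₁ w₂ S q ((S.next C w₁ w₂, S'.fsum h) :: out)
  | pass (S S' q out) (hA : Adv C w₁ w₂ S S') (hq : key h s (S'.fsum h) ≤ q)
      (hM : Merge h s C w₁ w₂ S' q out) : Merge h s C w₁ w₂ S q out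

theorem Ok.sum_le_total {S : Sweep} (hS : S.Ok h) (c : ℕ) : S.sum ≤ S.total w₁ w₂ c :=
  Nat.add_le_add (hS.asc₁.le_lval _ _) (hS.asc₂.le_lval _ _)

/-- Here `g` is the last emitted value and `q` its key. Each rounded sum is computed afresh from the
two current values, so its error `2 / 2 ^ h` does not accumulate along the sweep; skipping events
whose key does not rise adds `2 ^ s / 2 ^ h`. The last conclusion says that the emitted keys are
strictly increasing integers above `q`, so there are fewer of them than any bound on the keys. -/
theorem Merge.spec (hs : s ≤ h) {S : Sweep} {q : ℕ} {out : List (ℕ × ℕ × ℕ)}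
    (hM : Merge h s C w₁ w₂ S q out) (hS : S.Ok h) (g : ℕ)
    (hg : (q = 0 ∧ g = 0) ∨ ∃ G, FNorm h G ∧ key h s G = q ∧ fval G = g)
    (hg1 : g ≤ S.sum) (hg2 : 2 ^ h * S.sum ≤ 2 ^ h * g + (2 ^ s + 2) * S.sum) :
    Asc h (S.next C w₁ w₂) g out ∧
      (∀ c ≤ C, lval 0 c g out ≤ S.total w₁ w₂ c ∧
        2 ^ h * S.total w₁ w₂ c ≤ 2 ^ h * lval 0 c g out + (2 ^ s + 2) * S.total w₁ w₂ c) ∧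
      (∀ p ∈ out, p.1 ≤ C ∧ fval p.2 ≤ S.total w₁ w₂ C) ∧
      (∀ K, q < K → (∀ p ∈ out, key h s p.2 < K) → q + out.length < K) := by
  induction hM generalizing g with
  | done S q hC =>
    refine ⟨trivial, fun c hc => ?_, by simp, by simp⟩
    rw [next, lt_min_iff] at hC
    rw [total, lval_of_lt_headTime (hc.trans_lt hC.1), lval_of_lt_headTime (hc.trans_lt hC.2)]
    exact ⟨hg1, hg2⟩
  | push S S' q out hA hq hM ih =>
    obtain ⟨h1, h2, h3, h4, h5, h6, h7⟩ := hA.spec hS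
    obtain ⟨k1, k2, k3, -⟩ := flAdd_spec h1.ok₁ h1.ok₂ h3
    obtain ⟨i1, i2, i3, i4⟩ := ih h1 (fval (S'.fsum h)) (Or.inr ⟨_, k1, rfl, rfl⟩) k2
      (k3.trans (Nat.add_le_add_left (Nat.mul_le_mul_right _ (Nat.le_add_left 2 _)) _))
    refine ⟨⟨le_rfl, ?_, k1, i1.mono h5 le_rfl⟩, fun c hc => ?_, fun p hp => ?_,
      fun K hK hK' => ?_⟩
    · rcases hg with ⟨-, rfl⟩ | ⟨G, hG1, rfl, rfl⟩
      · exact Nat.zero_le _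
      · exact fval_le_of_key_lt hG1 k1 hq
    · rw [lval, add_zero]
      split_ifs with hc'
      · rw [h7 c hc']
        exact i2 c hc
      · rw [h6 c (not_le.1 hc')]
        exact ⟨hg1, hg2⟩
    · rcases List.mem_cons.1 hp with rfl | hp
      · rw [h7 C h4]
        exact ⟨h4, k2.trans (h1.sum_le_total C)⟩
      · rw [h7 C h4]
        exact i3 p hp
    · have := i4 K (hK' _ (List.mem_cons_self)) (fun p hp => hK' p (List.mem_cons_of_mem _ hp))
      rw [List.length_cons]
      omega
  | pass S S' q out hA hq hM ih =>
    obtain ⟨h1, h2, h3, h4, h5, h6, h7⟩ := hA.spec hS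
    obtain ⟨k1, k2, k3, -⟩ := flAdd_spec h1.ok₁ h1.ok₂ h3
    -- The skipped value is within `2 ^ s / 2 ^ h` of `g` by the comparison of keys, and within `2 /
    -- 2 ^ h` of the exact sum by `flAdd_spec`. The case `q = 0` cannot occur, as keys are positive.
    have hg2' : 2 ^ h * S'.sum ≤ 2 ^ h * g + (2 ^ s + 2) * S'.sum := by
      rcases hg with ⟨rfl, -⟩ | ⟨G, hG1, rfl, rfl⟩
      · have := key_pos hs k1
        rw [fsum] at hq
        omega
      · have k4 := fval_le_of_key_le hs k1 hG1 hq
        have k5 := Nat.mul_le_mul_left (2 ^ s) k2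
        simp only [sum, add_mul (2 ^ s)] at *
        omega
    obtain ⟨i1, i2, i3, i4⟩ := ih h1 g hg (hg1.trans h2) hg2'
    refine ⟨i1.mono h5 le_rfl, fun c hc => ?_, fun p hp => ?_, i4⟩
    · rcases le_or_gt (S.next C w₁ w₂) c with hc' | hc'
      · rw [h7 c hc']
        exact i2 c hc
      · rw [h6 c hc', i1.lval_of_lt (by omega)]
        exact ⟨hg1, hg2⟩
    · rw [h7 C h4]
      exact i3 p hp

/-- Each event consumes a breakpoint. This bound serves for the memory used by a merge; the bound by
the number of keys comes separately. -/
theorem Merge.length_le {S : Sweep} {q : ℕ} {out : List (ℕ × ℕ × ℕ)}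
    (hM : Merge h s C w₁ w₂ S q out) : out.length ≤ S.l₁.length + S.l₂.length := by
  induction hM with
  | done => simp
  | push S S' q out hA hq hM ih =>
    cases hA <;> simp only [List.length_cons] at * <;> omega
  | pass S S' q out hA hq hM ih =>
    cases hA <;> simp only [List.length_cons] at * <;> omega

end Sweep

end StepFun

/-! ### Step functions in the memory, and the program for their approximate sums -/

namespace StepFun

open RAM Sweep

/-- The breakpoints `l` are stored in the arrays `3` (times), `4` (mantissas) and `5` (exponents)
from the address `x` on. -/
def PreAt (A : ℕ → ℕ → ℕ) : ℕ → List (ℕ × ℕ × ℕ) → Prop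
  | _, [] => True
  | x, p :: l => (A 3 x = p.1 ∧ A 4 x = p.2.1 ∧ A 5 x = p.2.2) ∧ PreAt A (x + 1) l

theorem PreAt.append {A : ℕ → ℕ → ℕ} {x : ℕ} {l : List (ℕ × ℕ × ℕ)} {p : ℕ × ℕ × ℕ}
    (hl : PreAt A x l)
    (hp : A 3 (x + l.length) = p.1 ∧ A 4 (x + l.length) = p.2.1 ∧ A 5 (x + l.length) = p.2.2) :
    PreAt A x (l ++ [p]) := by
  induction l generalizing x with
  | nil => exact ⟨hp, trivial⟩
  | cons q l ih =>
    refine ⟨hl.1, ih hl.2 ?_⟩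
    rwa [List.length_cons, add_comm l.length, ← add_assoc] at hp

/-- The arrays of breakpoints agree below the address `F`. -/
def Agree (F : ℕ) (A A' : ℕ → ℕ → ℕ) : Prop :=
  ∀ a, 3 ≤ a → a ≤ 5 → ∀ z < F, A' a z = A a z

theorem Agree.trans {F F' : ℕ} {A A' A'' : ℕ → ℕ → ℕ} (h : Agree F A A') (h' : Agree F' A' A'')
    (hF : F ≤ F') : Agree F A A'' :=
  fun a ha ha' z hz => (h' a ha ha' z (by omega)).trans (h a ha ha' z hz)

theorem PreAt.congr {A A' : ℕ → ℕ → ℕ} {x F : ℕ} {l : List (ℕ × ℕ × ℕ)} (hl : PreAt A x l)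
    (hF : x + l.length ≤ F) (h : Agree F A A') : PreAt A' x l := by
  induction l generalizing x with
  | nil => trivial
  | cons q l ih =>
    rw [List.length_cons] at hF
    refine ⟨?_, ih hl.2 (by omega)⟩
    rw [h 3 (by omega) (by omega) x (by omega), h 4 (by omega) (by omega) x (by omega),
      h 5 (by omega) (by omega) x (by omega)]
    exact hl.1

/-- The breakpoints `l` are stored from the address `x` on, with the sentinel `C + 1` at
the end. -/
def ListAt (C : ℕ) (A : ℕ → ℕ → ℕ) (x : ℕ) (l : List (ℕ × ℕ × ℕ)) : Prop :=
  PreAt A x l ∧ A 3 (x + l.length) = C + 1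

theorem ListAt.congr {C : ℕ} {A A' : ℕ → ℕ → ℕ} {x F : ℕ} {l : List (ℕ × ℕ × ℕ)}
    (hl : ListAt C A x l) (hF : x + l.length < F) (h : Agree F A A') :
    ListAt C A' x l :=
  ⟨hl.1.congr hF.le h, (h 3 (by omega) (by omega) _ hF).trans hl.2⟩

theorem ListAt.tail {C : ℕ} {A : ℕ → ℕ → ℕ} {x : ℕ} {p : ℕ × ℕ × ℕ} {l : List (ℕ × ℕ × ℕ)}
    (hl : ListAt C A x (p :: l)) : ListAt C A (x + 1) l := by
  refine ⟨hl.1.2, ?_⟩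
  have := hl.2
  rwa [List.length_cons, add_comm l.length, ← add_assoc] at this

theorem ListAt.head {C : ℕ} {A : ℕ → ℕ → ℕ} {x w : ℕ} {l : List (ℕ × ℕ × ℕ)}
    (hl : ListAt C A x l) : A 3 x + w = headTime C w l := by
  cases l with
  | nil => have := hl.2; simp only [List.length_nil, add_zero] at this; rw [this, headTime]
  | cons p l => rw [hl.1.1.1, headTime]

end StepFun

namespace RAM

open StepFun Sweep

infixr:60 " ;; " => RAM.Prog.seq

/-- Read the next breakpoint of the first list. -/
def advLeft : Prog :=
  .assign 25 (.cell 4 (.var 18)) ;; .assign 26 (.cell 5 (.var 18)) ;; .assign 24 (.var 22) ;;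
  .assign 18 (.add (.var 18) (.const 1)) ;; .assign 22 (.add (.cell 3 (.var 18)) (.var 20))

/-- Read the next breakpoint of the second list. -/
def advRight : Prog :=
  .assign 27 (.cell 4 (.var 19)) ;; .assign 28 (.cell 5 (.var 19)) ;; .assign 24 (.var 23) ;;
  .assign 19 (.add (.var 19) (.const 1)) ;; .assign 23 (.add (.cell 3 (.var 19)) (.var 21))

/-- Add the two current values, and compute the key of the sum. -/
def sumProg : Prog :=
  .assign 30 (.add (.var 26) (.sub (.var 28) (.var 26))) ;;
  .assign 29 (.add (.shr (.var 25) (.sub (.var 30) (.var 26)))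
    (.shr (.var 27) (.sub (.var 30) (.var 28)))) ;;
  .assign 31 (.shr (.var 29) (.add (.var 6) (.const 1))) ;;
  .assign 30 (.add (.var 30) (.var 31)) ;;
  .assign 29 (.shr (.var 29) (.var 31)) ;;
  .assign 34 (.shr (.add (.shl (.var 30) (.add (.var 6) (.const 1))) (.var 29)) (.var 17))

/-- Append a breakpoint to the output. -/
def pushProg : Prog :=
  .write 3 (.var 8) (.var 24) ;; .write 4 (.var 8) (.var 29) ;; .write 5 (.var 8) (.var 30) ;;
  .assign 8 (.add (.var 8) (.const 1)) ;; .assign 32 (.var 34)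

/-- One step of the sweep over the breakpoints of two lists. -/
def mergeBody : Prog :=
  .cond (.le (.var 22) (.var 23)) advLeft advRight ;; sumProg ;;
  .cond (.le (.var 34) (.var 32)) .skip pushProg

/-- Put the approximate sum of the step functions at the addresses in the variables `18` and `19`,
shifted by the variables `20` and `21`, at the first free address, and this address into the
variable `35`. -/
def mergeProg : Prog :=
  .assign 35 (.var 8) ;; .assign 25 (.const 0) ;; .assign 26 (.const 0) ;; .assign 27 (.const 0) ;;
  .assign 28 (.const 0) ;; .assign 32 (.const 0) ;;
  .assign 22 (.add (.cell 3 (.var 18)) (.var 20)) ;;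
  .assign 23 (.add (.cell 3 (.var 19)) (.var 21)) ;;
  .loop (.le (.sub (.var 22) (.sub (.var 22) (.var 23))) (.var 4)) mergeBody ;;
  .write 3 (.var 8) (.add (.var 4) (.const 1)) ;; .assign 8 (.add (.var 8) (.const 1))

variable {b B : ℕ} {σ : Store}

/-- Registers of the sweep: 18, 19 point into the lists, 20, 21 are the shifts, 22, 23 the shifted
times of the next breakpoints, 24 the time of the event, 25 to 28 the current values, 29, 30 their
rounded sum, 34 its key and 32 the last emitted key. Variable 6 is `h`, 17 the number of dropped
bits, 8 the first free address. -/
theorem wp_advLeft (h1 : σ.var 18 + 1 < 2 ^ B) (h2 : σ.arr 3 (σ.var 18 + 1) + σ.var 20 < 2 ^ B) :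
    Wp b B advLeft (fun τ S => S ≤ 20 ∧ τ.arr = σ.arr ∧ τ.var 25 = σ.arr 4 (σ.var 18) ∧
      τ.var 26 = σ.arr 5 (σ.var 18) ∧ τ.var 24 = σ.var 22 ∧ τ.var 18 = σ.var 18 + 1 ∧
      τ.var 22 = σ.arr 3 (σ.var 18 + 1) + σ.var 20) σ := by
  refine .seq (.assign ?_ (.seq (.assign ?_ (.seq (.assign ?_ (.seq (.assign ?_ (.assign ?_ ?_))))))))
  all_goals simp only [Term.Small, Term.val, Term.nodes, Store.setVar_var, Store.setVar_arr,
    Nat.reduceEqDiff, reduceIte, true_and, and_true, Nat.reduceAdd, Nat.reduceLeDiff]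
  all_goals omega

theorem wp_advRight (h1 : σ.var 19 + 1 < 2 ^ B) (h2 : σ.arr 3 (σ.var 19 + 1) + σ.var 21 < 2 ^ B) :
    Wp b B advRight (fun τ S => S ≤ 20 ∧ τ.arr = σ.arr ∧ τ.var 27 = σ.arr 4 (σ.var 19) ∧
      τ.var 28 = σ.arr 5 (σ.var 19) ∧ τ.var 24 = σ.var 23 ∧ τ.var 19 = σ.var 19 + 1 ∧
      τ.var 23 = σ.arr 3 (σ.var 19 + 1) + σ.var 21) σ := by
  refine .seq (.assign ?_ (.seq (.assign ?_ (.seq (.assign ?_ (.seq (.assign ?_ (.assign ?_ ?_))))))))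
  all_goals simp only [Term.Small, Term.val, Term.nodes, Store.setVar_var, Store.setVar_arr,
    Nat.reduceEqDiff, reduceIte, true_and, and_true, Nat.reduceAdd, Nat.reduceLeDiff]
  all_goals omega

/-- The largest intermediate number is the code before the last bits are dropped; its exponent is at
most `X + 1`, whence the hypothesis `hB`. -/
theorem wp_sumProg {h X : ℕ} {f g : ℕ × ℕ} (h6 : σ.var 6 = h) (h25 : σ.var 25 = f.1)
    (h26 : σ.var 26 = f.2) (h27 : σ.var 27 = g.1) (h28 : σ.var 28 = g.2)
    (hf1 : f.1 < 2 ^ (h + 1)) (hf2 : f.2 ≤ X) (hg1 : g.1 < 2 ^ (h + 1)) (hg2 : g.2 ≤ X)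
    (hB : (X + 3) * 2 ^ (h + 1) ≤ 2 ^ B) :
    Wp b B sumProg (fun τ S => S ≤ 60 ∧ τ.arr = σ.arr ∧ τ.var 29 = (flAdd h f g).1 ∧
      τ.var 30 = (flAdd h f g).2 ∧ τ.var 34 = key h (σ.var 17) (flAdd h f g)) σ := by
  have hh : h + 1 < 2 ^ (h + 1) := Nat.lt_two_pow_self
  have hX : X + 3 ≤ (X + 3) * 2 ^ (h + 1) := Nat.le_mul_of_pos_right _ (Nat.two_pow_pos _)
  have hh' : 2 ^ (h + 1) ≤ (X + 3) * 2 ^ (h + 1) := Nat.le_mul_of_pos_left _ (by omega)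
  set e := f.2 + (g.2 - f.2) with he
  set M := f.1 / 2 ^ (e - f.2) + g.1 / 2 ^ (e - g.2) with hM
  have hM1 : M < 2 * 2 ^ (h + 1) := by
    have := Nat.div_le_self f.1 (2 ^ (e - f.2))
    have := Nat.div_le_self g.1 (2 ^ (e - g.2))
    omega
  have hM2 : M / 2 ^ (h + 1) ≤ 1 := Nat.le_of_lt_succ (Nat.div_lt_of_lt_mul (by omega))
  have hM3 := Nat.div_le_self M (2 ^ (M / 2 ^ (h + 1)))
  have hE : (e + M / 2 ^ (h + 1)) * 2 ^ (h + 1) ≤ (X + 1) * 2 ^ (h + 1) :=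
    Nat.mul_le_mul_right _ (by omega)
  have hX3 : (X + 3) * 2 ^ (h + 1) = (X + 1) * 2 ^ (h + 1) + 2 * 2 ^ (h + 1) := by ring
  refine .seq (.assign ?_ (.seq (.assign ?_ (.seq (.assign ?_ (.seq (.assign ?_
    (.seq (.assign ?_ (.assign ?_ ?_))))))))))
  all_goals simp only [Term.Small, Term.val, Term.nodes, Store.setVar_var, Store.setVar_arr,
    Nat.reduceEqDiff, reduceIte, true_and, and_true, Nat.reduceAdd, Nat.reduceLeDiff, h25, h26,
    h27, h28, h6, ← he, ← hM, flAdd, key, and_self]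
  all_goals omega

theorem wp_pushProg (h8 : σ.var 8 + 1 < 2 ^ B) :
    Wp b B pushProg (fun τ S => S ≤ 20 ∧ τ.var 8 = σ.var 8 + 1 ∧ τ.var 32 = σ.var 34 ∧
      τ.arr 3 (σ.var 8) = σ.var 24 ∧ τ.arr 4 (σ.var 8) = σ.var 29 ∧
      τ.arr 5 (σ.var 8) = σ.var 30 ∧ ∀ a, ∀ z < σ.var 8, τ.arr a z = σ.arr a z) σ := by
  refine .seq (.write ?_ ?_ (.seq (.write ?_ ?_ (.seq (.write ?_ ?_ (.seq (.assign ?_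
    (.assign ?_ ?_))))))))
  all_goals simp only [Term.Small, Term.val, Term.nodes, Store.setVar_var, Store.setVar_arr,
    Store.setCell_var, Store.setCell_arr,
    Nat.reduceEqDiff, reduceIte, true_and, and_true, Nat.reduceAdd, Nat.reduceLeDiff,
    and_self]
  · omega
  · intro a z hz
    have : z ≠ σ.var 8 := by omega
    simp [this]

/-- The current state of the sweep is represented in the store; the lists are below `F`. -/
structure SweepAt (C w₁ w₂ h X F : ℕ) (S : Sweep) (σ : Store) : Prop where
  at₁ : ListAt C σ.arr (σ.var 18) S.l₁
  at₂ : ListAt C σ.arr (σ.var 19) S.l₂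
  lt₁ : σ.var 18 + S.l₁.length < F
  lt₂ : σ.var 19 + S.l₂.length < F
  head₁ : σ.var 22 = headTime C w₁ S.l₁
  head₂ : σ.var 23 = headTime C w₂ S.l₂
  man₁ : σ.var 25 = S.f₁.1
  exp₁ : σ.var 26 = S.f₁.2
  man₂ : σ.var 27 = S.f₂.1
  exp₂ : σ.var 28 = S.f₂.2
  bd₁ : ∀ p ∈ S.l₁, p.1 ≤ C ∧ p.2.1 < 2 ^ (h + 1) ∧ p.2.2 ≤ X
  bd₂ : ∀ p ∈ S.l₂, p.1 ≤ C ∧ p.2.1 < 2 ^ (h + 1) ∧ p.2.2 ≤ X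
  fbd₁ : S.f₁.1 < 2 ^ (h + 1) ∧ S.f₁.2 ≤ X
  fbd₂ : S.f₂.1 < 2 ^ (h + 1) ∧ S.f₂.2 ≤ X

/-- Both input lists lie below `F`, so output written from `F` on cannot disturb them. -/
theorem SweepAt.congr {C w₁ w₂ h X F : ℕ} {S : Sweep} {σ τ : Store}
    (hS : SweepAt C w₁ w₂ h X F S σ) (hv : ∀ x ∈ [18, 19, 22, 23, 25, 26, 27, 28], τ.var x = σ.var x)
    (ha : Agree F σ.arr τ.arr) : SweepAt C w₁ w₂ h X F S τ := by
  simp only [List.forall_mem_cons] at hv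
  obtain ⟨h18, h19, h22, h23, h25, h26, h27, h28, -⟩ := hv
  obtain ⟨a1, a2, a3, a4, a5, a6, a7, a8, a9, a10, a11, a12, a13, a14⟩ := hS
  rw [← h18] at a1 a3
  rw [← h19] at a2 a4
  exact ⟨a1.congr a3 ha, a2.congr a4 ha, a3, a4, h22.trans a5, h23.trans a6,
    h25.trans a7, h26.trans a8, h27.trans a9, h28.trans a10, a11, a12, a13, a14⟩

theorem headTime_le {C w : ℕ} {l : List (ℕ × ℕ × ℕ)} (hl : ∀ p ∈ l, p.1 ≤ C) :
    headTime C w l ≤ C + 1 + w := by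
  cases l with
  | nil => exact le_rfl
  | cons p l => have := hl p List.mem_cons_self; simp only [headTime]; omega

theorem wp_adv {C w₁ w₂ h X F : ℕ} {S : Sweep} (hS : SweepAt C w₁ w₂ h X F S σ)
    (hC : S.next C w₁ w₂ ≤ C) (h20 : σ.var 20 = w₁) (h21 : σ.var 21 = w₂)
    (hw₁ : C + 1 + w₁ < 2 ^ B) (hw₂ : C + 1 + w₂ < 2 ^ B) (hF : F ≤ 2 ^ B) :
    Wp b B (.cond (.le (.var 22) (.var 23)) advLeft advRight) (fun τ T => T ≤ 30 ∧
      τ.arr = σ.arr ∧ τ.var 24 = S.next C w₁ w₂ ∧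
      ∃ S', Adv C w₁ w₂ S S' ∧ SweepAt C w₁ w₂ h X F S' τ) σ := by
  obtain ⟨l₁, l₂, f₁, f₂⟩ := S
  have a5 := hS.head₁
  have a6 := hS.head₂
  refine .cond ⟨trivial, trivial⟩ (fun hle => ?_) (fun hle => ?_)
  · have hle' : headTime C w₁ l₁ ≤ headTime C w₂ l₂ := by rwa [← a5, ← a6]
    have hn : Sweep.next C w₁ w₂ ⟨l₁, l₂, f₁, f₂⟩ = headTime C w₁ l₁ := min_eq_left hle'
    rw [hn] at hC ⊢
    -- An exhausted list shows its sentinel, which lies beyond the capacity and is therefore never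
    -- an event.
    cases l₁ with
    | nil => simp only [headTime] at hC; omega
    | cons p l =>
      have hlt := hS.lt₁
      rw [List.length_cons] at hlt
      have hat := hS.at₁.tail
      have hb := List.forall_mem_cons.1 hS.bd₁
      have hh := hat.head (w := w₁)
      have hle2 := headTime_le (w := w₁) fun p hp => (hb.2 p hp).1
      refine Wp.frame (wp_advLeft (by omega) (by omega)) fun τ T hfr hτ => ?_
      obtain ⟨t1, t2, t3, t4, t5, t6, t7⟩ := hτ
      have hv : ∀ x, x ∉ advLeft.vars → τ.var x = σ.var x := hfr.1
      refine ⟨?_, t2, t5.trans a5, ⟨l, l₂, p.2, f₂⟩, .left _ _ _ _ _ hle' hC, ?_⟩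
      · simp only [Test.nodes, Term.nodes]; omega
      · exact ⟨by rw [t2, t6]; exact hat, by rw [t2, hv 19 (by decide)]; exact hS.at₂,
          by rw [t6]; simp only at *; omega, by rw [hv 19 (by decide)]; exact hS.lt₂,
          by rw [t7, h20]; exact hh, by rw [hv 23 (by decide)]; exact a6,
          t3.trans hS.at₁.1.1.2.1, t4.trans hS.at₁.1.1.2.2,
          by rw [hv 27 (by decide)]; exact hS.man₂, by rw [hv 28 (by decide)]; exact hS.exp₂,
          hb.2, hS.bd₂, hb.1.2, hS.fbd₂⟩
  · have hle' : headTime C w₂ l₂ ≤ headTime C w₁ l₁ := by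
      rw [← a5, ← a6]; exact (not_le.1 hle).le
    have hn : Sweep.next C w₁ w₂ ⟨l₁, l₂, f₁, f₂⟩ = headTime C w₂ l₂ := min_eq_right hle'
    rw [hn] at hC ⊢
    cases l₂ with
    | nil => simp only [headTime] at hC; omega
    | cons p l =>
      have hlt := hS.lt₂
      rw [List.length_cons] at hlt
      have hat := hS.at₂.tail
      have hb := List.forall_mem_cons.1 hS.bd₂
      have hh := hat.head (w := w₂)
      have hle2 := headTime_le (w := w₂) fun p hp => (hb.2 p hp).1
      refine Wp.frame (wp_advRight (by omega) (by omega)) fun τ T hfr hτ => ?_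
      obtain ⟨t1, t2, t3, t4, t5, t6, t7⟩ := hτ
      have hv : ∀ x, x ∉ advRight.vars → τ.var x = σ.var x := hfr.1
      refine ⟨?_, t2, t5.trans a6, ⟨l₁, l, f₁, p.2⟩, .right _ _ _ _ _ hle' hC, ?_⟩
      · simp only [Test.nodes, Term.nodes]; omega
      · exact ⟨by rw [t2, hv 18 (by decide)]; exact hS.at₁, by rw [t2, t6]; exact hat,
          by rw [hv 18 (by decide)]; exact hS.lt₁, by rw [t6]; simp only at *; omega,
          by rw [hv 22 (by decide)]; exact a5, by rw [t7, h21]; exact hh,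
          by rw [hv 25 (by decide)]; exact hS.man₁, by rw [hv 26 (by decide)]; exact hS.exp₁,
          t3.trans hS.at₂.1.1.2.1, t4.trans hS.at₂.1.1.2.2,
          hS.bd₁, hb.2, hS.fbd₁, hb.1.2⟩

theorem wp_mergeBody {C w₁ w₂ h s X F q : ℕ} {S : Sweep} (hS : SweepAt C w₁ w₂ h X F S σ)
    (hC : S.next C w₁ w₂ ≤ C) (h6 : σ.var 6 = h) (h17 : σ.var 17 = s)
    (h20 : σ.var 20 = w₁) (h21 : σ.var 21 = w₂) (h32 : σ.var 32 = q)
    (hw₁ : C + 1 + w₁ < 2 ^ B) (hw₂ : C + 1 + w₂ < 2 ^ B) (hF : F ≤ σ.var 8)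
    (hF' : σ.var 8 + 1 < 2 ^ B) (hB : (X + 3) * 2 ^ (h + 1) ≤ 2 ^ B) :
    Wp b B mergeBody (fun τ T => T ≤ 130 ∧ ∃ S', Adv C w₁ w₂ S S' ∧
      SweepAt C w₁ w₂ h X F S' τ ∧ (∀ a, ∀ z < σ.var 8, τ.arr a z = σ.arr a z) ∧
      ((key h s (S'.fsum h) ≤ q ∧ τ.var 32 = q ∧ τ.var 8 = σ.var 8) ∨
        (q < key h s (S'.fsum h) ∧ τ.var 32 = key h s (S'.fsum h) ∧ τ.var 8 = σ.var 8 + 1 ∧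
          τ.arr 3 (σ.var 8) = S.next C w₁ w₂ ∧ τ.arr 4 (σ.var 8) = (S'.fsum h).1 ∧
          τ.arr 5 (σ.var 8) = (S'.fsum h).2))) σ := by
  refine .seq (Wp.frame (wp_adv hS hC h20 h21 hw₁ hw₂ (by omega)) fun τ T hfr hτ => ?_)
  obtain ⟨t1, t2, t3, S', t4, t5⟩ := hτ
  have hv : ∀ x, x ∉ (advLeft.vars ++ advRight.vars) → τ.var x = σ.var x := hfr.1
  refine .seq (Wp.frame (wp_sumProg (h := h) (X := X) (f := S'.f₁) (g := S'.f₂)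
    ((hv 6 (by decide)).trans h6) t5.man₁ t5.exp₁
    t5.man₂ t5.exp₂ t5.fbd₁.1 t5.fbd₁.2 t5.fbd₂.1 t5.fbd₂.2 hB) fun ρ U hfr2 hρ => ?_)
  obtain ⟨r1, r2, r3, r4, r5⟩ := hρ
  have hv2 : ∀ x, x ∉ sumProg.vars → ρ.var x = τ.var x := hfr2.1
  have h8 : ρ.var 8 = σ.var 8 := (hv2 8 (by decide)).trans (hv 8 (by decide))
  have h32' : ρ.var 32 = q := (hv2 32 (by decide)).trans ((hv 32 (by decide)).trans h32)
  have h24 : ρ.var 24 = S.next C w₁ w₂ := (hv2 24 (by decide)).trans t3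
  have h17' : τ.var 17 = s := (hv 17 (by decide)).trans h17
  have hρS : SweepAt C w₁ w₂ h X F S' ρ := t5.congr
    (fun x hx => hv2 x (by revert x; decide)) (fun a _ _ z _ => by rw [r2])
  have har : ρ.arr = σ.arr := r2.trans t2
  rw [h17'] at r5
  refine .cond ⟨trivial, trivial⟩ (fun hle => .skip ?_) (fun hle => ?_)
  · simp only [Test.holds, Term.val, r5, h32'] at hle
    refine ⟨by simp only [Test.nodes, Term.nodes]; omega, S', t4, hρS, fun a z _ => by rw [har],
      Or.inl ⟨hle, h32', h8⟩⟩
  · simp only [Test.holds, Term.val, r5, h32', not_le] at hle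
    refine Wp.frame (wp_pushProg (by omega)) fun υ V hfr3 hυ => ?_
    obtain ⟨u1, u2, u3, u4, u5, u6, u7⟩ := hυ
    have hv3 : ∀ x, x ∉ pushProg.vars → υ.var x = ρ.var x := hfr3.1
    rw [h8] at *
    rw [har] at u7
    refine ⟨by simp only [Test.nodes, Term.nodes]; omega, S', t4,
      hρS.congr (fun x hx => hv3 x (by revert x; decide))
        (fun a _ _ z hz => by rw [har]; exact u7 a z (by omega)), u7,
      Or.inr ⟨hle, u3.trans r5, u2, u4.trans h24, u5.trans r3, u6.trans r4⟩⟩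

theorem Adv.length_eq {C w₁ w₂ : ℕ} {S S' : Sweep} (hA : Adv C w₁ w₂ S S') :
    S'.l₁.length + S'.l₂.length + 1 = S.l₁.length + S.l₂.length := by
  cases hA <;> simp only [List.length_cons] <;> omega

theorem wp_mergeProg {C w₁ w₂ h s X x y : ℕ} {l₁ l₂ : List (ℕ × ℕ × ℕ)} (h4 : σ.var 4 = C)
    (h6 : σ.var 6 = h) (h17 : σ.var 17 = s) (h18 : σ.var 18 = x) (h19 : σ.var 19 = y)
    (h20 : σ.var 20 = w₁) (h21 : σ.var 21 = w₂)
    (hl₁ : ListAt C σ.arr x l₁) (hl₂ : ListAt C σ.arr y l₂)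
    (hx : x + l₁.length < σ.var 8) (hy : y + l₂.length < σ.var 8)
    (hb₁ : ∀ p ∈ l₁, p.1 ≤ C ∧ p.2.1 < 2 ^ (h + 1) ∧ p.2.2 ≤ X)
    (hb₂ : ∀ p ∈ l₂, p.1 ≤ C ∧ p.2.1 < 2 ^ (h + 1) ∧ p.2.2 ≤ X)
    (hw₁ : C + 1 + w₁ < 2 ^ B) (hw₂ : C + 1 + w₂ < 2 ^ B)
    (hF : σ.var 8 + l₁.length + l₂.length + 1 < 2 ^ B) (hB : (X + 3) * 2 ^ (h + 1) ≤ 2 ^ B) :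
    Wp b B mergeProg (fun τ T => T ≤ 150 * (l₁.length + l₂.length + 1) ∧
      (∀ a, ∀ z < σ.var 8, τ.arr a z = σ.arr a z) ∧ τ.var 35 = σ.var 8 ∧
      ∃ out, Merge h s C w₁ w₂ ⟨l₁, l₂, (0, 0), (0, 0)⟩ 0 out ∧ ListAt C τ.arr (σ.var 8) out ∧
        τ.var 8 = σ.var 8 + out.length + 1) σ := by
  have hd₁ := hl₁.head (w := w₁)
  have hd₂ := hl₂.head (w := w₂)
  have hc₁ := headTime_le (w := w₁) fun p hp => (hb₁ p hp).1
  have hc₂ := headTime_le (w := w₂) fun p hp => (hb₂ p hp).1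
  set F := σ.var 8 with hF0
  refine .seq (.assign trivial (.seq (.assign ?_ (.seq (.assign ?_ (.seq (.assign ?_
    (.seq (.assign ?_ (.seq (.assign ?_ (.seq (.assign ?_ (.seq (.assign ?_ ?_)))))))))))))))
  any_goals simp only [Term.Small, Term.val, Store.setVar_var, Store.setVar_arr,
    Nat.reduceEqDiff, reduceIte, true_and, h18, h19, h20, h21, hd₁, hd₂]
  any_goals omega
  set σ₁ := ((((((((σ.setVar 35 (σ.var 8)).setVar 25 0).setVar 26 0).setVar 27 0).setVar 28
    0).setVar 32 0).setVar 22 (headTime C w₁ l₁)).setVar 23 (headTime C w₂ l₂)) with hσ₁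
  have e4 : σ₁.var 4 = C := by simp [hσ₁, h4]
  have e6 : σ₁.var 6 = h := by simp [hσ₁, h6]
  have e8 : σ₁.var 8 = F := by simp [hσ₁, hF0]
  have e17 : σ₁.var 17 = s := by simp [hσ₁, h17]
  have e20 : σ₁.var 20 = w₁ := by simp [hσ₁, h20]
  have e21 : σ₁.var 21 = w₂ := by simp [hσ₁, h21]
  have e32 : σ₁.var 32 = 0 := by simp [hσ₁]
  have e35 : σ₁.var 35 = F := by simp [hσ₁, hF0]
  have hin : SweepAt C w₁ w₂ h X F ⟨l₁, l₂, (0, 0), (0, 0)⟩ σ₁ := by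
    refine ⟨?_, ?_, ?_, ?_, ?_, ?_, ?_, ?_, ?_, ?_, hb₁, hb₂, ⟨?_, ?_⟩, ?_, ?_⟩ <;>
      simp [hσ₁, h18, h19, hl₁, hl₂, hx, hy]
  have ha : σ₁.arr = σ.arr := rfl
  -- The auxiliary data are the sweep state, the last key and the output so far. `Merge` unfolds
  -- from the front while the program appends at the back, so the last conjunct of the invariant
  -- turns a merge of the remainder into one from the start.
  refine .seq (.loop (α := Sweep × ℕ × List (ℕ × ℕ × ℕ)) (fun D τ k =>
    SweepAt C w₁ w₂ h X F D.1 τ ∧ τ.var 32 = D.2.1 ∧ PreAt τ.arr F D.2.2 ∧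
    τ.var 8 = F + D.2.2.length ∧
    D.2.2.length + (D.1.l₁.length + D.1.l₂.length) ≤ l₁.length + l₂.length ∧
    k + 140 * (D.1.l₁.length + D.1.l₂.length) ≤ 140 * (l₁.length + l₂.length) ∧
    (∀ a, ∀ z < F, τ.arr a z = σ.arr a z) ∧
    ∀ out, Merge h s C w₁ w₂ D.1 D.2.1 out →
      Merge h s C w₁ w₂ ⟨l₁, l₂, (0, 0), (0, 0)⟩ 0 (D.2.2 ++ out))
    (fun D => D.1.l₁.length + D.1.l₂.length)
    (⟨⟨l₁, l₂, (0, 0), (0, 0)⟩, 0, []⟩) ?_ ?_)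
  · exact ⟨hin, e32, trivial, e8, by simp, by simp, fun a z _ => by rw [ha], fun out h => h⟩
  · rintro ⟨S, q, pre⟩ τ k hfr ⟨i1, i2, i3, i4, i5, i6, i7, i8⟩
    have hv : ∀ x, x ∉ mergeBody.vars → τ.var x = σ₁.var x := hfr.1
    -- With truncated subtraction, `x - (x - y)` is the minimum of `x` and `y`.
    have hmin : (Test.le (.sub (.var 22) (.sub (.var 22) (.var 23))) (.var 4)).holds τ ↔
        S.next C w₁ w₂ ≤ C := by
      simp only [Test.holds, Term.val, i1.head₁, i1.head₂, hv 4 (by decide), e4, Sweep.next]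
      omega
    refine ⟨⟨⟨trivial, trivial, trivial⟩, trivial⟩, fun hle => ?_, fun hle => ?_⟩
    · rw [hmin] at hle
      dsimp only at *
      refine Wp.mono (wp_mergeBody i1 hle ((hv 6 (by decide)).trans e6)
        ((hv 17 (by decide)).trans e17) ((hv 20 (by decide)).trans e20)
        ((hv 21 (by decide)).trans e21) i2 hw₁ hw₂ (by omega) (by omega) hB) ?_
      rintro ρ T ⟨r1, S', hA, r2, r3, r4⟩
      have hlen := Adv.length_eq hA
      have hn : Test.nodes (.le (.sub (.var 22) (.sub (.var 22) (.var 23))) (.var 4)) = 7 := rfl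
      have r3' : ∀ a, ∀ z < F, ρ.arr a z = σ.arr a z := fun a z hz =>
        (r3 a z (by omega)).trans (i7 a z hz)
      have hpre : PreAt ρ.arr F pre := i3.congr le_rfl fun a _ _ z hz => r3 a z (by omega)
      rw [hn]
      rcases r4 with ⟨r5, r6, r7⟩ | ⟨r5, r6, r7, r8, r9, r10⟩
      · exact ⟨⟨S', q, pre⟩, by dsimp only; omega, r2, r6, hpre, r7.trans i4,
          by dsimp only; omega, by dsimp only; omega, r3',
          fun out hM => i8 out (.pass _ _ _ _ hA r5 hM)⟩
      · rw [i4] at r7 r8 r9 r10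
        refine ⟨⟨S', _, pre ++ [(S.next C w₁ w₂, S'.fsum h)]⟩, by dsimp only; omega, r2, r6,
          hpre.append ⟨r8, r9, r10⟩, ?_, ?_, by dsimp only; omega, r3', fun out hM => ?_⟩
        · simp only [r7, List.length_append, List.length_singleton]; omega
        · simp only [List.length_append, List.length_singleton]; omega
        · rw [List.append_assoc]
          exact i8 _ (.push _ _ _ _ hA r5 hM)
    · rw [hmin, not_le] at hle
      dsimp only at *
      have hM := i8 [] (.done _ _ hle)
      rw [List.append_nil] at hM
      refine .seq (.write trivial ?_ (.assign ?_ ?_))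
      · simp only [Term.Small, Term.val, true_and, hv 4 (by decide), e4]; omega
      · simp only [Term.Small, Term.val, true_and, Store.setCell_var, i4]; omega
      · refine ⟨?_, ?_, ?_, pre, hM, ⟨?_, ?_⟩, ?_⟩
        · simp only [Test.nodes, Term.nodes]; omega
        · intro a z hz
          have : z ≠ F + pre.length := by omega
          simp [Term.val, i4, this, i7 a z hz]
        · simp [hv 35 (by decide), e35]
        · refine i3.congr le_rfl fun a _ _ z hz => ?_
          have : z ≠ F + pre.length := by omega
          simp [Term.val, i4, this]
        · simp [Term.val, i4, hv 4 (by decide), e4]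
        · simp [Term.val, i4]

end RAM

/-! ### Relative errors, list lengths, and queues of shifted step functions. -/

namespace StepFun

open RAM Sweep

/-- A list of breakpoints of an ascending step function, with times at most `C` and exponents
below `X`. -/
structure Good (h C X : ℕ) (l : List (ℕ × ℕ × ℕ)) : Prop where
  asc : Asc h 0 0 l
  bd : ∀ p ∈ l, p.1 ≤ C ∧ p.2.2 < X

theorem Good.bounds {h C X : ℕ} {l : List (ℕ × ℕ × ℕ)} (hl : Good h C X l) :
    ∀ p ∈ l, p.1 ≤ C ∧ p.2.1 < 2 ^ (h + 1) ∧ p.2.2 ≤ X :=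
  fun p hp => ⟨(hl.bd p hp).1, (hl.asc.norm hp).2, (hl.bd p hp).2.le⟩

theorem Good.nil {h C X : ℕ} : Good h C X [] := ⟨trivial, by simp⟩

/-- The value at `c` of a shifted step function. -/
def qval (c : ℕ) (q : List (ℕ × ℕ × ℕ) × ℕ) : ℕ := lval q.2 c 0 q.1

/-- The sum of the values at `c` of shifted step functions. -/
def qtotal (c : ℕ) (qs : List (List (ℕ × ℕ × ℕ) × ℕ)) : ℕ := (qs.map (qval c)).sum

theorem qtotal_append (c : ℕ) (qs rs : List (List (ℕ × ℕ × ℕ) × ℕ)) :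
    qtotal c (qs ++ rs) = qtotal c qs + qtotal c rs := by simp [qtotal]

theorem qtotal_cons (c : ℕ) (q : List (ℕ × ℕ × ℕ) × ℕ) (qs : List (List (ℕ × ℕ × ℕ) × ℕ)) :
    qtotal c (q :: qs) = qval c q + qtotal c qs := by simp [qtotal]

/-- `g` is a lower bound of `f` with relative error at most `d / 2 ^ h`. -/
def Approx (h d g f : ℕ) : Prop := g ≤ f ∧ 2 ^ h * f ≤ 2 ^ h * g + d * f

theorem Approx.add {h d g f g' f' : ℕ} (H : Approx h d g f) (H' : Approx h d g' f') :
    Approx h d (g + g') (f + f') := by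
  obtain ⟨h1, h2⟩ := H
  obtain ⟨h3, h4⟩ := H'
  refine ⟨by omega, ?_⟩
  rw [mul_add, mul_add, mul_add]
  omega

theorem Approx.refl (h d f : ℕ) : Approx h d f f := ⟨le_rfl, Nat.le_add_right _ _⟩

/-- The first error is relative to `f ≤ e`, so it is at most the same fraction of `e`: errors add up
without cross terms. -/
theorem Approx.trans {h d d' g f e : ℕ} (H : Approx h d g f) (H' : Approx h d' f e) :
    Approx h (d + d') g e := by
  obtain ⟨h1, h2⟩ := H
  obtain ⟨h3, h4⟩ := H'
  refine ⟨h1.trans h3, ?_⟩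
  have := Nat.mul_le_mul_left d h3
  rw [add_mul]
  omega

/-- Normalised values below `2 ^ (h + X)` have exponents below `X`, so their codes are below `X * 2
^ (h + 1)`, and dropping `s` bits leaves `X * 2 ^ (h + 1 - s)` keys. -/
theorem Good.merge {h s C X : ℕ} {x y : List (ℕ × ℕ × ℕ) × ℕ} {out : List (ℕ × ℕ × ℕ)}
    (hs : s ≤ h) (hX : 0 < X) (hx : Good h C X x.1) (hy : Good h C X y.1)
    (hT : qval C x + qval C y < 2 ^ (h + X))
    (hM : Merge h s C x.2 y.2 ⟨x.1, y.1, (0, 0), (0, 0)⟩ 0 out) :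
    Good h C X out ∧ out.length ≤ X * 2 ^ (h + 1 - s) ∧
      ∀ c ≤ C, Approx h (2 ^ s + 2) (qval c (out, 0)) (qval c x + qval c y) := by
  have h0 : fval (0, 0) = 0 := rfl
  have hok : Sweep.Ok h ⟨x.1, y.1, (0, 0), (0, 0)⟩ :=
    ⟨by rw [h0]; exact hx.asc, by rw [h0]; exact hy.asc, Or.inl rfl, Or.inl rfl⟩
  obtain ⟨i1, i2, i3, i4⟩ := hM.spec hs hok 0 (Or.inl ⟨rfl, rfl⟩) (Nat.zero_le _)
    (by simp [Sweep.sum, h0])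
  have ht : ∀ c, Sweep.total x.2 y.2 ⟨x.1, y.1, (0, 0), (0, 0)⟩ c = qval c x + qval c y := by
    intro c; simp only [Sweep.total, h0, qval]
  simp only [ht] at i2 i3
  have hexp : ∀ p ∈ out, p.2.2 < X := by
    intro p hp
    have h1 := (i1.norm hp).1
    have h2 := (i3 p hp).2
    have h3 : 2 ^ (h + p.2.2) < 2 ^ (h + X) := by
      rw [pow_add]
      exact lt_of_le_of_lt (Nat.mul_le_mul_right _ h1) (lt_of_le_of_lt h2 hT)
    have := (Nat.pow_lt_pow_iff_right (by norm_num : 1 < 2)).1 h3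
    omega
  refine ⟨⟨i1.mono (Nat.zero_le _) le_rfl, fun p hp => ⟨(i3 p hp).1, hexp p hp⟩⟩, ?_, i2⟩
  have hpow : X * 2 ^ (h + 1) = X * 2 ^ (h + 1 - s) * 2 ^ s := by
    rw [mul_assoc, ← pow_add, Nat.sub_add_cancel (by omega)]
  have := i4 (X * 2 ^ (h + 1 - s)) (Nat.mul_pos hX (Nat.two_pow_pos _)) fun p hp => by
    refine Nat.div_lt_of_lt_mul ?_
    rw [mul_comm (2 ^ s), ← hpow]
    have h1 := (i1.norm hp).2
    have h2 := Nat.mul_le_mul_right (2 ^ (h + 1)) (Nat.succ_le_of_lt (hexp p hp))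
    rw [Nat.succ_mul] at h2
    omega
  omega

/-- The `i`-th entry of the queue (arrays `8` and `9`) is the step function `q.1` with
shift `q.2`. -/
def EntryAt (C F : ℕ) (A : ℕ → ℕ → ℕ) (i : ℕ) (q : List (ℕ × ℕ × ℕ) × ℕ) : Prop :=
  ListAt C A (A 8 i) q.1 ∧ A 8 i + q.1.length < F ∧ A 9 i = q.2

theorem EntryAt.congr {C F F' i : ℕ} {A A' : ℕ → ℕ → ℕ} {q : List (ℕ × ℕ × ℕ) × ℕ}
    (h : EntryAt C F A i q) (hA : Agree F A A') (h8 : A' 8 i = A 8 i) (h9 : A' 9 i = A 9 i)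
    (hF : F ≤ F') : EntryAt C F' A' i q := by
  rw [EntryAt, h8, h9]
  exact ⟨h.1.congr h.2.1 hA, lt_of_lt_of_le h.2.1 hF, h.2.2⟩

/-- The queue contains `qs` from index `i` on. -/
def QueueAt (C F : ℕ) (A : ℕ → ℕ → ℕ) : ℕ → List (List (ℕ × ℕ × ℕ) × ℕ) → Prop
  | _, [] => True
  | i, q :: qs => EntryAt C F A i q ∧ QueueAt C F A (i + 1) qs

theorem QueueAt.congr {C F F' i : ℕ} {A A' : ℕ → ℕ → ℕ} {qs : List (List (ℕ × ℕ × ℕ) × ℕ)}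
    (h : QueueAt C F A i qs) (hA : Agree F A A')
    (h89 : ∀ j, i ≤ j → j < i + qs.length → A' 8 j = A 8 j ∧ A' 9 j = A 9 j) (hF : F ≤ F') :
    QueueAt C F' A' i qs := by
  induction qs generalizing i with
  | nil => trivial
  | cons q qs ih =>
    rw [List.length_cons] at h89
    obtain ⟨h8, h9⟩ := h89 i le_rfl (by omega)
    exact ⟨h.1.congr hA h8 h9 hF, ih h.2 fun j hj hj' => h89 j (by omega) (by omega)⟩

theorem QueueAt.append {C F i : ℕ} {A : ℕ → ℕ → ℕ} {qs : List (List (ℕ × ℕ × ℕ) × ℕ)}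
    {q : List (ℕ × ℕ × ℕ) × ℕ} (h : QueueAt C F A i qs) (hq : EntryAt C F A (i + qs.length) q) :
    QueueAt C F A i (qs ++ [q]) := by
  induction qs generalizing i with
  | nil => exact ⟨hq, trivial⟩
  | cons r qs ih =>
    refine ⟨h.1, ih h.2 ?_⟩
    rwa [List.length_cons, add_comm qs.length, ← add_assoc] at hq

end StepFun

/-! ### One pass that adds the entries of a queue in pairs. -/

namespace RAM

open StepFun Sweep

variable {b B : ℕ} {σ : Store}

/-- Replace the next two entries of the queue by their approximate sum. -/
def pairProg : Prog :=
  .assign 18 (.cell 8 (.var 15)) ;; .assign 20 (.cell 9 (.var 15)) ;;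
  .assign 19 (.cell 8 (.add (.var 15) (.const 1))) ;;
  .assign 21 (.cell 9 (.add (.var 15) (.const 1))) ;; mergeProg ;;
  .write 8 (.var 16) (.var 35) ;; .write 9 (.var 16) (.const 0) ;;
  .assign 16 (.add (.var 16) (.const 1)) ;; .assign 15 (.add (.var 15) (.const 2))

/-- Sum up the entries of the queue in pairs. -/
def passProg : Prog :=
  .write 8 (.var 13) (.const 0) ;; .write 9 (.var 13) (.const 0) ;;
  .assign 15 (.const 0) ;; .assign 16 (.const 0) ;;
  .assign 17 (.sub (.var 7) (.shr (.var 14) (.const 1))) ;;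
  .loop (.le (.add (.var 15) (.const 1)) (.var 13)) pairProg ;;
  .assign 13 (.var 16) ;; .assign 14 (.add (.var 14) (.const 1))

/-- The numbers that do not change during the computation: the capacity `C`, the precision `h`,
the bound `X` on the exponents and the bound `w` on the shifts; the list at the address `0` is
empty. -/
structure Ctx (B C h X w : ℕ) (σ : Store) : Prop where
  var4 : σ.var 4 = C
  var6 : σ.var 6 = h
  empty : σ.arr 3 0 = C + 1
  free : 0 < σ.var 8
  posX : 0 < X
  bdX : (X + 3) * 2 ^ (h + 1) ≤ 2 ^ B
  bdC : C + 1 + w < 2 ^ B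

theorem Ctx.congr {C h X w : ℕ} {σ τ : Store} (hσ : Ctx B C h X w σ) (h4 : τ.var 4 = σ.var 4)
    (h6 : τ.var 6 = σ.var 6) (h8 : σ.var 8 ≤ τ.var 8) (hA : Agree (σ.var 8) σ.arr τ.arr) :
    Ctx B C h X w τ :=
  ⟨h4.trans hσ.var4, h6.trans hσ.var6,
    (hA 3 (by omega) (by omega) 0 hσ.free).trans hσ.empty,
    lt_of_lt_of_le hσ.free h8, hσ.posX, hσ.bdX, hσ.bdC⟩

theorem wp_pairProg {C h X w s L : ℕ} {x y : List (ℕ × ℕ × ℕ) × ℕ} (hc : Ctx B C h X w σ)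
    (h17 : σ.var 17 = s) (hs : s ≤ h) (hx : EntryAt C (σ.var 8) σ.arr (σ.var 15) x)
    (hy : EntryAt C (σ.var 8) σ.arr (σ.var 15 + 1) y) (hxg : Good h C X x.1)
    (hyg : Good h C X y.1) (hxl : x.1.length ≤ L) (hyl : y.1.length ≤ L) (hxw : x.2 ≤ w)
    (hyw : y.2 ≤ w) (hT : qval C x + qval C y < 2 ^ (h + X))
    (hF : σ.var 8 + 2 * L + 1 < 2 ^ B) (h15 : σ.var 15 + 2 < 2 ^ B)
    (h16 : σ.var 16 + 1 < 2 ^ B) :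
    Wp b B pairProg (fun τ T => T ≤ 200 * (2 * L + 1) ∧ σ.var 8 ≤ τ.var 8 ∧
      τ.var 8 ≤ σ.var 8 + (2 * L + 1) ∧ Agree (σ.var 8) σ.arr τ.arr ∧
      (∀ i, i ≠ σ.var 16 → τ.arr 8 i = σ.arr 8 i ∧ τ.arr 9 i = σ.arr 9 i) ∧
      τ.var 15 = σ.var 15 + 2 ∧ τ.var 16 = σ.var 16 + 1 ∧
      ∃ out, Good h C X out ∧ out.length ≤ X * 2 ^ (h + 1 - s) ∧
        (∀ c ≤ C, Approx h (2 ^ s + 2) (qval c (out, 0)) (qval c x + qval c y)) ∧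
        EntryAt C (τ.var 8) τ.arr (σ.var 16) (out, 0)) σ := by
  have hb := hc.bdC
  obtain ⟨x1, x2, x3⟩ := hx
  obtain ⟨y1, y2, y3⟩ := hy
  refine .seq (.assign ?_ (.seq (.assign ?_ (.seq (.assign ?_ (.seq (.assign ?_ (.seq ?_))))))))
  any_goals simp only [Term.Small, Term.val, Store.setVar_var, Store.setVar_arr,
    Nat.reduceEqDiff, reduceIte, true_and]
  any_goals omega
  refine Wp.frame (wp_mergeProg (C := C) (h := h) (s := s) (X := X)
    (x := σ.arr 8 (σ.var 15)) (y := σ.arr 8 (σ.var 15 + 1)) (l₁ := x.1) (l₂ := y.1)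
    (w₁ := x.2) (w₂ := y.2) ?_ ?_ ?_ ?_ ?_ ?_ ?_ x1 y1 ?_ ?_ hxg.bounds hyg.bounds ?_ ?_ ?_
    hc.bdX) fun τ T hfr hτ => ?_
  any_goals simp only [Store.setVar_var, Nat.reduceEqDiff, reduceIte]
  any_goals omega
  · exact hc.var4
  · exact hc.var6
  · obtain ⟨t1, t2, t3, out, t4, t5, t6⟩ := hτ
    obtain ⟨g1, g2, g3⟩ := Good.merge hs hc.posX hxg hyg hT t4
    have hlen := t4.length_le
    have hv := hfr.1
    have hv' := hfr.2
    simp only [Store.setVar_var, Store.setVar_arr, Nat.reduceEqDiff, reduceIte] at *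
    have h16' : τ.var 16 = σ.var 16 := by
      have := hv 16 (by decide); simpa using this
    have h15' : τ.var 15 = σ.var 15 := by
      have := hv 15 (by decide); simpa using this
    have h8' := hv' 8 (by decide)
    have h9' := hv' 9 (by decide)
    refine .seq (.write ?_ ?_ (.seq (.write ?_ ?_ (.seq (.assign ?_ (.assign ?_ ?_))))))
    any_goals simp only [Term.Small, Term.val, Store.setVar_var, Store.setVar_arr,
      Store.setCell_var, Nat.reduceEqDiff, reduceIte, true_and, Term.nodes]
    any_goals omega
    have hag : Agree (σ.var 8) σ.arr
        ((τ.setCell 8 (τ.var 16) (τ.var 35)).setCell 9 (τ.var 16) 0).arr := by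
      intro a ha ha' z hz
      have h8 : a ≠ 8 := by omega
      have h9 : a ≠ 9 := by omega
      simp [h8, h9, t2 a z hz]
    refine ⟨?_, by omega, by omega, hag, ?_, by omega, by omega, out, g1, g2, g3, ?_, ?_, ?_⟩
    · omega
    · intro i hi
      rw [← h16'] at hi
      simp [hi, h8', h9']
    · have e8 : ((τ.setCell 8 (τ.var 16) (τ.var 35)).setCell 9 (τ.var 16) 0).arr 8 (σ.var 16) =
          σ.var 8 := by simp [h16', t3]
      rw [e8]
      refine t5.congr (F := τ.var 8) (by omega) ?_
      intro a ha ha' z hz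
      have h8 : a ≠ 8 := by omega
      have h9 : a ≠ 9 := by omega
      simp [h8, h9]
    · simp [h16', t3]
      omega
    · simp [h16']

/-- All sums of one pass have the same relative error, so the total of the queue has it as well
(`Approx.add`). The first two writes append an empty list as a partner for the last entry of a queue
of odd length. -/
theorem wp_passProg {C h X w s L : ℕ} {qs : List (List (ℕ × ℕ × ℕ) × ℕ)} (hc : Ctx B C h X w σ)
    (h17 : σ.var 7 - σ.var 14 / 2 = s) (hs : s ≤ h) (hq : QueueAt C (σ.var 8) σ.arr 0 qs)
    (h13 : σ.var 13 = qs.length)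
    (hg : ∀ q ∈ qs, Good h C X q.1 ∧ q.1.length ≤ L ∧ q.2 ≤ w)
    (hT : qtotal C qs < 2 ^ (h + X))
    (hF : σ.var 8 + (qs.length + 1) / 2 * (2 * L + 1) + 1 < 2 ^ B)
    (hq' : qs.length + 3 < 2 ^ B) (h14 : σ.var 14 + 1 < 2 ^ B) :
    Wp b B passProg (fun τ T => T ≤ 210 * ((qs.length + 1) / 2 * (2 * L + 1)) + 50 ∧
      σ.var 8 ≤ τ.var 8 ∧ τ.var 8 ≤ σ.var 8 + (qs.length + 1) / 2 * (2 * L + 1) ∧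
      Agree (σ.var 8) σ.arr τ.arr ∧ τ.var 14 = σ.var 14 + 1 ∧
      ∃ rs, QueueAt C (τ.var 8) τ.arr 0 rs ∧ τ.var 13 = rs.length ∧
        rs.length = (qs.length + 1) / 2 ∧
        (∀ q ∈ rs, Good h C X q.1 ∧ q.1.length ≤ X * 2 ^ (h + 1 - s) ∧ q.2 = 0) ∧
        ∀ c ≤ C, Approx h (2 ^ s + 2) (qtotal c rs) (qtotal c qs)) σ := by
  refine .seq (.write ?_ ?_ (.seq (.write ?_ ?_ (.seq (.assign ?_ (.seq (.assign ?_ (.seq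
    (.assign ?_ (.seq ?_)))))))))) 
  any_goals simp only [Term.Small, Term.val, Store.setVar_var, Store.setCell_var, Nat.reduceEqDiff, reduceIte,
    true_and, pow_one, h17]
  any_goals omega
  set σ₁ := (((((σ.setCell 8 (σ.var 13) 0).setCell 9 (σ.var 13) 0).setVar 15 0).setVar 16
    0).setVar 17 s) with hσ₁
  have e4 : σ₁.var 4 = σ.var 4 := by simp [hσ₁]
  have e6 : σ₁.var 6 = σ.var 6 := by simp [hσ₁]
  have e8 : σ₁.var 8 = σ.var 8 := by simp [hσ₁]
  have e13 : σ₁.var 13 = qs.length := by simp [hσ₁, h13]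
  have e14 : σ₁.var 14 = σ.var 14 := by simp [hσ₁]
  have e15 : σ₁.var 15 = 0 := by simp [hσ₁]
  have e16 : σ₁.var 16 = 0 := by simp [hσ₁]
  have e17 : σ₁.var 17 = s := by simp [hσ₁]
  have f8 : ∀ i, σ₁.arr 8 i = if i = qs.length then 0 else σ.arr 8 i := by
    intro i; simp [hσ₁, h13]
  have f9 : ∀ i, σ₁.arr 9 i = if i = qs.length then 0 else σ.arr 9 i := by
    intro i; simp [hσ₁, h13]
  have hag : Agree (σ.var 8) σ.arr σ₁.arr := by
    intro a ha ha' z hz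
    have h8 : a ≠ 8 := by omega
    have h9 : a ≠ 9 := by omega
    simp [hσ₁, h8, h9]
  clear_value σ₁
  -- The data are the unread entries and the sums. The pass works in place: the write index
  -- `D.2.length` never overtakes the read index `2 * D.2.length`, and never reaches the padding
  -- entry. In `d` the exact total of the entries already read is kept.
  refine .loop (α := List (List (ℕ × ℕ × ℕ) × ℕ) × List (List (ℕ × ℕ × ℕ) × ℕ))
    (fun D τ k => Ctx B C h X w τ ∧ τ.var 15 = 2 * D.2.length ∧ τ.var 16 = D.2.length ∧
      (D.1.length + 2 * D.2.length = qs.length ∨ D.1 = [] ∧ 2 * D.2.length = qs.length + 1) ∧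
      QueueAt C (τ.var 8) τ.arr 0 D.2 ∧ QueueAt C (τ.var 8) τ.arr (2 * D.2.length) D.1 ∧
      τ.arr 8 qs.length = 0 ∧ τ.arr 9 qs.length = 0 ∧
      (∀ q ∈ D.1, Good h C X q.1 ∧ q.1.length ≤ L ∧ q.2 ≤ w) ∧
      (∀ q ∈ D.2, Good h C X q.1 ∧ q.1.length ≤ X * 2 ^ (h + 1 - s) ∧ q.2 = 0) ∧
      (∀ c ≤ C, ∃ d, qtotal c qs = d + qtotal c D.1 ∧ Approx h (2 ^ s + 2) (qtotal c D.2) d) ∧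
      σ.var 8 ≤ τ.var 8 ∧ τ.var 8 ≤ σ.var 8 + D.2.length * (2 * L + 1) ∧
      k ≤ 206 * (D.2.length * (2 * L + 1)) ∧ Agree (σ.var 8) σ.arr τ.arr)
    (fun D => D.1.length) (qs, []) ?_ ?_
  · refine ⟨hc.congr e4 e6 e8.ge hag, e15, e16, Or.inl rfl, trivial, ?_, by simp [f8],
      by simp [f9], hg, by simp, fun c _ => ⟨0, by simp, by simp [qtotal, Approx]⟩, e8.ge,
      by simp [e8], by simp, hag⟩
    refine hq.congr hag (fun j _ hj => ?_) e8.ge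
    have : j ≠ qs.length := by omega
    simp [f8, f9, this]
  · rintro ⟨rem, out⟩ τ k hfr ⟨i1, i2, i3, i4, i5, i6, i7, i8, i9, i10, i11, i12, i13, i14, i15⟩
    dsimp only at *
    have hv : ∀ x, x ∉ pairProg.vars → τ.var x = σ₁.var x := hfr.1
    have h13' : τ.var 13 = qs.length := (hv 13 (by decide)).trans e13
    have hw : C + 1 + w < 2 ^ B := i1.bdC
    refine ⟨⟨⟨trivial, ?_, ?_⟩, trivial⟩, fun hle => ?_, fun hle => ?_⟩
    · simp only [Term.Small]; omega
    · simp only [Term.val]; omega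
    · simp only [Test.holds, Term.val, h13', i2] at hle
      obtain ⟨x, rem', rfl⟩ : ∃ x rem', rem = x :: rem' := by
        cases rem with
        | nil => simp only [List.length_nil] at i4; omega
        | cons x rem' => exact ⟨x, rem', rfl⟩
      rw [List.length_cons] at i4
      simp only [reduceCtorEq, false_and, or_false] at i4
      have hout : out.length + 1 ≤ (qs.length + 1) / 2 := by omega
      have hmul : (out.length + 1) * (2 * L + 1) ≤ (qs.length + 1) / 2 * (2 * L + 1) :=
        Nat.mul_le_mul_right _ hout
      have hsm := Nat.add_one_mul out.length (2 * L + 1)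
      obtain ⟨y, r, y1, y2, y3, y4, y5, y6, y7, y8⟩ : ∃ y r,
          EntryAt C (τ.var 8) τ.arr (2 * out.length + 1) y ∧
          (Good h C X y.1 ∧ y.1.length ≤ L ∧ y.2 ≤ w) ∧
          (∀ c, qtotal c rem' = qval c y + qtotal c r) ∧
          (r.length + 2 * (out.length + 1) = qs.length ∨
            r = [] ∧ 2 * (out.length + 1) = qs.length + 1) ∧
          QueueAt C (τ.var 8) τ.arr (2 * (out.length + 1)) r ∧
          (∀ q ∈ r, Good h C X q.1 ∧ q.1.length ≤ L ∧ q.2 ≤ w) ∧ r.length ≤ rem'.length ∧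
          r.length + 2 * (out.length + 1) ≤ qs.length + 1 := by
        -- If `x` has no partner left, the padding entry takes this role.
        cases rem' with
        | nil =>
          have hl : 2 * out.length + 1 = qs.length := by simp only [List.length_nil] at i4; omega
          refine ⟨([], 0), [], ?_, ⟨Good.nil, Nat.zero_le _, Nat.zero_le _⟩, fun c => rfl,
            Or.inr ⟨rfl, by omega⟩, trivial, by simp, le_rfl, by simp; omega⟩
          rw [hl, EntryAt, i7, i8]
          exact ⟨⟨trivial, i1.empty⟩, i1.free, rfl⟩
        | cons y r =>
          rw [List.length_cons] at i4
          exact ⟨y, r, i6.2.1, i9 y (by simp), fun c => qtotal_cons _ _ _, Or.inl (by omega),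
            i6.2.2, fun q hq => i9 q (by simp [hq]), by simp, by omega⟩
      have hx := i9 x List.mem_cons_self
      have hTT : qval C x + qval C y < 2 ^ (h + X) := by
        obtain ⟨d, hd, -⟩ := i11 C le_rfl
        rw [qtotal_cons, y3] at hd
        omega
      refine Wp.frame (wp_pairProg (x := x) (y := y) (L := L) i1 ((hv 17 (by decide)).trans e17) hs
        (by rw [i2]; exact i6.1) (by rw [i2]; exact y1) hx.1 y2.1 hx.2.1 y2.2.1 hx.2.2 y2.2.2 hTT
        (by omega) (by omega) (by omega)) fun ρ T hfr' hρ => ?_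
      obtain ⟨p1, p2, p3, p4, p5, p6, p7, o, p8, p9, p10, p11⟩ := hρ
      rw [i3] at p5 p7 p11
      have hv' : ∀ x, x ∉ pairProg.vars → ρ.var x = τ.var x := hfr'.1
      have hlen : (out ++ [(o, 0)]).length = out.length + 1 := by simp
      refine ⟨(r, out ++ [(o, 0)]), by dsimp only; rw [List.length_cons]; omega, ?_⟩
      dsimp only
      rw [hlen]
      refine ⟨i1.congr (hv' 4 (by decide)) (hv' 6 (by decide)) p2 p4, by omega, p7, y4, ?_, ?_,
        ?_, ?_, y6, ?_, fun c hc' => ?_, by omega, by omega, ?_, i15.trans p4 i12⟩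
      · refine (i5.congr p4 (fun j _ hj => p5 j ?_) p2).append ?_
        · omega
        · rwa [zero_add]
      · exact y5.congr p4 (fun j hj _ => p5 j (by omega)) p2
      · rw [(p5 _ (by omega)).1, i7]
      · rw [(p5 _ (by omega)).2, i8]
      · intro q hq
        rcases List.mem_append.1 hq with hq | hq
        · exact i10 q hq
        · rw [List.mem_singleton.1 hq]
          exact ⟨p8, p9, rfl⟩
      · obtain ⟨d, hd, hd'⟩ := i11 c hc'
        refine ⟨d + (qval c x + qval c y), ?_, ?_⟩
        · rw [hd, qtotal_cons, y3]; omega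
        · rw [qtotal_append]
          have : qtotal c [(o, 0)] = qval c (o, 0) := by simp [qtotal]
          rw [this]
          exact hd'.add (p10 c hc')
      · simp only [Test.nodes, Term.nodes]
        omega
    · simp only [Test.holds, Term.val, h13', i2] at hle
      have hrem : rem = [] := by
        rcases i4 with i4 | i4
        · exact List.length_eq_zero_iff.1 (by omega)
        · exact i4.1
      subst hrem
      have hol : out.length = (qs.length + 1) / 2 := by
        simp only [List.length_nil, zero_add, true_and] at i4
        omega
      rw [hol] at i13 i14
      have h14' : τ.var 14 = σ.var 14 := (hv 14 (by decide)).trans e14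
      refine .seq (.assign trivial (.assign ?_ ?_))
      · simp only [Term.Small, Term.val, Store.setVar_var, Nat.reduceEqDiff, reduceIte, true_and,
          h14']
        omega
      · simp only [Term.val, Store.setVar_var, Store.setVar_arr, Nat.reduceEqDiff, reduceIte,
          Term.nodes, Test.nodes, h14']
        refine ⟨by omega, i12, i13, i15, trivial, out, i5, i3, hol, i10, fun c hc' => ?_⟩
        obtain ⟨d, hd, hd'⟩ := i11 c hc'
        rw [hd]
        simpa [qtotal] using hd'

end RAM

/-! ### Summing a whole queue, with precision rising from pass to pass. -/

namespace RAM

open StepFun Sweep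

variable {b B : ℕ} {σ : Store}

/-- Sum up the entries of the queue. -/
def reduceProg : Prog := .loop (.le (.const 2) (.var 13)) passProg

/-- A potential for the cost of summing up `e + 1` step functions, from the `k`-th round on. -/
def potential (G k e : ℕ) : ℕ := (3 + k % 2) * e * (G * 2 ^ (k / 2))

/-- Halving `e` outweighs the growth of `2 ^ (k / 2)`, which doubles only every second round. The
factors 3 and 4 for even and odd `k` absorb this irregularity: `e + 4 * (e / 2) ≤ 3 * e` and `e + 6
* (e / 2) ≤ 4 * e`. -/
theorem potential_step (G k e : ℕ) :
    e * (G * 2 ^ (k / 2)) + potential G (k + 1) (e / 2) ≤ potential G k e := by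
  have he : 2 * (e / 2) ≤ e := Nat.mul_div_le e 2
  simp only [potential]
  rcases Nat.even_or_odd' k with ⟨j, rfl | rfl⟩
  · have h1 : (2 * j + 1) % 2 = 1 := by omega
    have h2 : (2 * j + 1) / 2 = j := by omega
    have h3 : 2 * j % 2 = 0 := by omega
    have h4 : 2 * j / 2 = j := by omega
    rw [h1, h2, h3, h4, ← add_mul]
    exact Nat.mul_le_mul_right _ (by omega)
  · have h1 : (2 * j + 1) % 2 = 1 := by omega
    have h2 : (2 * j + 1) / 2 = j := by omega
    have h3 : (2 * j + 1 + 1) % 2 = 0 := by omega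
    have h4 : (2 * j + 1 + 1) / 2 = j + 1 := by omega
    rw [h1, h2, h3, h4]
    calc _ = (e + 3 * (2 * (e / 2))) * (G * 2 ^ j) := by rw [pow_succ]; ring
      _ ≤ _ := Nat.mul_le_mul_right _ (by omega)

/-- The right-hand side is the error budget from round `k` on: with `p = 2 ^ (s - k / 2)` it is `8 *
p` for even and `6 * p` for odd `k`. A round uses `p + 2`, and `2 ≤ p` as some bits are still
dropped. -/
theorem error_step {s k : ℕ} (hk : k / 2 < s) :
    2 ^ (s - k / 2) + 2 + 2 * ((4 - (k + 1) % 2) * 2 ^ (s - (k + 1) / 2)) ≤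
      2 * ((4 - k % 2) * 2 ^ (s - k / 2)) := by
  have hpw : 2 ≤ 2 ^ (s - k / 2) := by
    calc 2 = 2 ^ 1 := rfl
      _ ≤ _ := Nat.pow_le_pow_right (by norm_num) (by omega)
  rcases Nat.even_or_odd' k with ⟨j, rfl | rfl⟩
  · have h1 : (2 * j + 1) % 2 = 1 := by omega
    have h2 : (2 * j + 1) / 2 = j := by omega
    have h3 : 2 * j % 2 = 0 := by omega
    have h4 : 2 * j / 2 = j := by omega
    rw [h4] at hpw
    rw [h1, h2, h3, h4]
    omega
  · have h1 : (2 * j + 1) % 2 = 1 := by omega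
    have h2 : (2 * j + 1) / 2 = j := by omega
    have h3 : (2 * j + 1 + 1) % 2 = 0 := by omega
    have h4 : (2 * j + 1 + 1) / 2 = j + 1 := by omega
    rw [h2] at hpw hk
    rw [h1, h2, h3, h4]
    have h5 : 2 ^ (s - j) = 2 * 2 ^ (s - (j + 1)) := by
      rw [← pow_succ']; congr 1; omega
    rw [h5] at hpw ⊢
    omega

/-- With `d + 1` entries, both the memory and the steps are paid by `potential`, and the errors by
the budget of `error_step`, which starts at `8 * 2 ^ s`. The hypotheses `hl` and `hw` are needed for
`d = 0`, when no pass is made and the only entry is itself the result. -/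
theorem wp_reduceProg {C h X w s d Λ : ℕ} {qs : List (List (ℕ × ℕ × ℕ) × ℕ)}
    (hc : Ctx B C h X w σ) (h7 : σ.var 7 = s) (h14 : σ.var 14 = 0) (hs : s ≤ h)
    (hΛ : Λ = X * 2 ^ (h + 1 - s)) (hq : QueueAt C (σ.var 8) σ.arr 0 qs)
    (h13 : σ.var 13 = qs.length) (hd : qs.length = d + 1) (hds : d < 2 ^ s)
    (hg : ∀ q ∈ qs, Good h C X q.1 ∧ q.1.length ≤ Λ ∧ q.2 ≤ w)
    (hl : ∀ q ∈ qs, q.1.length ≤ Λ * d + 1) (hw : ∀ q ∈ qs.head?, q.2 = 0)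
    (hT : qtotal C qs < 2 ^ (h + X))
    (hF : σ.var 8 + potential (2 * Λ + 1) 0 d + 1 < 2 ^ B) (hq' : d + 4 < 2 ^ B) :
    Wp b B reduceProg (fun τ T => T ≤ 264 * potential (2 * Λ + 1) 0 d + 4 ∧
      σ.var 8 ≤ τ.var 8 ∧ τ.var 8 ≤ σ.var 8 + potential (2 * Λ + 1) 0 d ∧
      Agree (σ.var 8) σ.arr τ.arr ∧
      ∃ l, EntryAt C (τ.var 8) τ.arr 0 (l, 0) ∧ Good h C X l ∧ l.length ≤ Λ * d + 1 ∧
        ∀ c ≤ C, Approx h (8 * 2 ^ s) (qval c (l, 0)) (qtotal c qs)) σ := by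
  have hbX : s + 1 < 2 ^ B := by
    have h1 : h + 1 < 2 ^ (h + 1) := Nat.lt_two_pow_self
    have h2 : 2 ^ (h + 1) ≤ (X + 3) * 2 ^ (h + 1) := Nat.le_mul_of_pos_left _ (by omega)
    have := hc.bdX
    omega
  refine .loop (α := ℕ × List (List (ℕ × ℕ × ℕ) × ℕ)) (fun D τ k => Ctx B C h X w τ ∧
    τ.var 14 = D.1 ∧ QueueAt C (τ.var 8) τ.arr 0 D.2 ∧ τ.var 13 = D.2.length ∧
    0 < D.2.length ∧ (D.2.length - 1) * 2 ^ D.1 ≤ d ∧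
    (∀ q ∈ D.2, Good h C X q.1 ∧ q.1.length ≤ Λ * 2 ^ (D.1 / 2) ∧ q.2 ≤ w) ∧
    (∀ q ∈ D.2, q.1.length ≤ Λ * d + 1) ∧ (∀ q ∈ D.2.head?, q.2 = 0) ∧
    (∃ E, E + 2 * ((4 - D.1 % 2) * 2 ^ (s - D.1 / 2)) ≤ 8 * 2 ^ s ∧
      ∀ c ≤ C, Approx h E (qtotal c D.2) (qtotal c qs)) ∧
    k + 264 * potential (2 * Λ + 1) D.1 (D.2.length - 1) ≤ 264 * potential (2 * Λ + 1) 0 d ∧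
    σ.var 8 ≤ τ.var 8 ∧
    τ.var 8 + potential (2 * Λ + 1) D.1 (D.2.length - 1) ≤
      σ.var 8 + potential (2 * Λ + 1) 0 d ∧ Agree (σ.var 8) σ.arr τ.arr)
    (fun D => D.2.length) (0, qs) ?_ ?_
  · refine ⟨hc, h14, hq, h13, by dsimp only; omega, by simp [hd], ?_, hl, hw, ⟨0, by
      rw [Nat.zero_mod, Nat.zero_div, Nat.sub_zero, Nat.sub_zero]; omega, ?_⟩, ?_, le_rfl,
      ?_, fun _ _ _ _ _ => rfl⟩
    · simpa using hg
    · exact fun c _ => Approx.refl _ _ _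
    · simp [hd]
    · simp [hd]
  · rintro ⟨k, q⟩ τ N hfr ⟨i1, i2, i3, i4, i5, i6, i7, i8, i9, ⟨E, i10, i11⟩, i12, i13, i14, i15⟩
    dsimp only at *
    have hv : ∀ x, x ∉ passProg.vars → τ.var x = σ.var x := hfr.1
    refine ⟨⟨by simp only [Term.Small]; omega, trivial⟩, fun hle => ?_, fun hle => ?_⟩
    · simp only [Test.holds, Term.val, i4] at hle
      obtain ⟨e, he⟩ : ∃ e, q.length = e + 1 := ⟨q.length - 1, by omega⟩
      have he1 : q.length - 1 = e := by omega
      rw [he1] at i6 i12 i14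
      have he0 : 1 ≤ e := by omega
      have hkd : 2 ^ k ≤ d := le_trans (Nat.le_mul_of_pos_left _ he0) i6
      -- While two entries remain, `2 ^ k ≤ d < 2 ^ s`; so the precision never runs out.
      have hks : k < s := (Nat.pow_lt_pow_iff_right (by norm_num : 1 < 2)).1 (by omega)
      have hk2 : k / 2 ≤ k := Nat.div_le_self _ _
      have hed : e ≤ d := le_trans (Nat.le_mul_of_pos_right _ (Nat.two_pow_pos _)) i6
      -- The length bound invariant in round `k` is exactly the number of keys with `s - k / 2`
      -- dropped bits.
      have hLk : Λ * 2 ^ (k / 2) = X * 2 ^ (h + 1 - (s - k / 2)) := by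
        rw [hΛ, mul_assoc, ← pow_add]; congr 2; omega
      have hcnt : (q.length + 1) / 2 ≤ e := by omega
      have hG : 2 * (Λ * 2 ^ (k / 2)) + 1 ≤ (2 * Λ + 1) * 2 ^ (k / 2) := by
        have := Nat.two_pow_pos (k / 2)
        rw [add_mul, mul_assoc]; omega
      have hmul : (q.length + 1) / 2 * (2 * (Λ * 2 ^ (k / 2)) + 1) ≤
          e * ((2 * Λ + 1) * 2 ^ (k / 2)) := Nat.mul_le_mul hcnt hG
      have hpos : 1 ≤ e * ((2 * Λ + 1) * 2 ^ (k / 2)) :=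
        Nat.mul_pos he0 (Nat.mul_pos (by omega) (Nat.two_pow_pos _))
      have hstep := potential_step (2 * Λ + 1) k e
      refine Wp.frame (wp_passProg (s := s - k / 2) (L := Λ * 2 ^ (k / 2)) i1
        (by rw [hv 7 (by decide), h7, i2]) (by omega) i3 i4 i7
        (lt_of_le_of_lt (i11 C le_rfl).1 hT) (by omega) (by omega) (by omega)) ?_
      rintro ρ T hfr' ⟨t1, t2, t3, t4, t5, r, t6, t7, t8, t9, t10⟩
      have hr : r.length - 1 = e / 2 := by omega
      refine ⟨(k + 1, r), by dsimp only; omega, i1.congr ?_ ?_ t2 t4, by dsimp only; omega, t6,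
        t7, by dsimp only; omega,
        ?_, fun x hx => ?_, fun x hx => ?_, fun x hx => ?_, ⟨2 ^ (s - k / 2) + 2 + E, ?_, ?_⟩, ?_,
        by omega, ?_, i15.trans t4 i13⟩
      · exact hfr'.1 4 (by decide)
      · exact hfr'.1 6 (by decide)
      · dsimp only
        rw [hr, pow_succ]
        calc e / 2 * (2 ^ k * 2) = e / 2 * 2 * 2 ^ k := by ring
          _ ≤ e * 2 ^ k := Nat.mul_le_mul_right _ (Nat.div_mul_le_self _ _)
          _ ≤ d := i6
      · obtain ⟨x1, x2, x3⟩ := t9 x hx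
        refine ⟨x1, ?_, by omega⟩
        rw [← hLk] at x2
        exact x2.trans (Nat.mul_le_mul_left _ (Nat.pow_le_pow_right (by norm_num)
          (Nat.div_le_div_right (Nat.le_succ k))))
      · obtain ⟨x1, x2, x3⟩ := t9 x hx
        rw [← hLk] at x2
        have h1 : 2 ^ (k / 2) ≤ d := (Nat.pow_le_pow_right (by norm_num) hk2).trans hkd
        exact (x2.trans (Nat.mul_le_mul_left _ h1)).trans (Nat.le_succ _)
      · exact (t9 x (List.mem_of_mem_head? hx)).2.2
      · have := error_step (s := s) (k := k) (by omega)
        dsimp only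
        omega
      · exact fun c hc' => (t10 c hc').trans (i11 c hc')
      · simp only [hr, Test.nodes, Term.nodes]
        omega
      · simp only [hr]
        omega
    · simp only [Test.holds, Term.val, i4] at hle
      obtain ⟨⟨l, w'⟩, rfl⟩ : ∃ x, q = [x] := List.length_eq_one_iff.1 (by omega)
      have hw' : w' = 0 := i9 (l, w') (by simp)
      subst hw'
      refine ⟨?_, i13, ?_, i15, l, i3.1, (i7 _ (List.mem_singleton_self _)).1,
        i8 _ (List.mem_singleton_self _), fun c hc' => ?_⟩
      · simp only [Test.nodes, Term.nodes]
        omega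
      · omega
      · obtain ⟨h1, h2⟩ := i11 c hc'
        have : qtotal c [(l, 0)] = qval c (l, 0) := by simp [qtotal]
        rw [this] at h1 h2
        exact ⟨h1, h2.trans (Nat.add_le_add_left (Nat.mul_le_mul_right _ (by omega)) _)⟩

end RAM

/-! ### The recursion for the path counts, and a bound on them. -/

namespace WeightedDAG

variable {n m : ℕ}

/-- There is an arc from `x` to `y`. -/
def Arc (G : WeightedDAG n m) (x y : Fin n) : Prop := ∃ a, G.src a = x ∧ G.dst a = y

theorem wellFounded_arc (G : WeightedDAG n m) : WellFounded G.Arc := by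
  have : IsTrans (Fin n) (Relation.TransGen G.Arc) := ⟨fun _ _ _ => Relation.TransGen.trans⟩
  have : Std.Irrefl (Relation.TransGen G.Arc) := ⟨G.acyclic⟩
  have h := Finite.wellFounded_of_trans_of_irrefl (Relation.TransGen G.Arc)
  exact Subrelation.wf (fun h => Relation.TransGen.single h) h

theorem isPath_append_singleton (G : WeightedDAG n m) (u v : Fin n) (p : List (Fin m))
    (a : Fin m) : G.IsPath u (p ++ [a]) v ↔ G.IsPath u p (G.src a) ∧ G.dst a = v := by
  induction p generalizing u with
  | nil => simp only [List.nil_append, IsPath]; rw [eq_comm]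
  | cons b p ih => simp only [List.cons_append, IsPath, ih, and_assoc]

/-- The paths from `s` to `v` of weight at most `c`. -/
def paths (G : WeightedDAG n m) (s v : Fin n) (c : ℕ) : Set (List (Fin m)) :=
  {p | G.IsPath s p v ∧ G.pathWeight p ≤ c}

/-- A path is empty or splits off its last arc; this matches the order in which step functions are
computed, from tails to heads. -/
theorem paths_eq (G : WeightedDAG n m) (s v : Fin n) (c : ℕ) :
    G.paths s v c = (if v = s then {[]} else ∅) ∪
      ⋃ a ∈ Finset.univ.filter fun a => G.dst a = v ∧ G.weight a ≤ c,
        (fun p => p ++ [a]) '' G.paths s (G.src a) (c - G.weight a) := by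
  ext p
  simp only [Set.mem_union, Set.mem_iUnion, Finset.mem_filter, Finset.mem_univ, true_and,
    Set.mem_image, exists_prop]
  induction p using List.reverseRecOn with
  | nil =>
    constructor
    · rintro ⟨h, -⟩
      left
      rw [IsPath] at h
      simp [h]
    · rintro (h | ⟨a, -, p, -, h⟩)
      · split_ifs at h with hv
        · exact ⟨hv.symm, by simp [pathWeight]⟩
        · exact h.elim
      · simp at h
  | append_singleton p a _ =>
    have hw : G.pathWeight (p ++ [a]) = G.pathWeight p + G.weight a := by simp [pathWeight]
    constructor
    · rintro ⟨h, h'⟩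
      rw [isPath_append_singleton] at h
      rw [hw] at h'
      exact Or.inr ⟨a, ⟨h.2, by omega⟩, p, ⟨h.1, by omega⟩, rfl⟩
    · rintro (h | ⟨a', ⟨h1, h2⟩, p', ⟨h3, h4⟩, h⟩)
      · split_ifs at h
        · simp at h
        · exact h.elim
      · obtain ⟨rfl, h5⟩ := List.append_inj' h rfl
        obtain rfl : a' = a := by simpa using h5
        refine ⟨(isPath_append_singleton ..).2 ⟨h3, h1⟩, ?_⟩
        rw [hw]
        omega

theorem paths_finite (G : WeightedDAG n m) (s v : Fin n) (c : ℕ) : (G.paths s v c).Finite := by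
  induction v using G.wellFounded_arc.induction generalizing c with
  | _ v ih =>
    rw [paths_eq]
    refine Set.Finite.union (by split_ifs <;> simp) (Set.Finite.biUnion (Finset.finite_toSet _) ?_)
    intro a ha
    simp only [Finset.coe_filter, Finset.mem_univ, true_and, Set.mem_ofPred_eq] at ha
    exact (ih _ ⟨a, rfl, ha.1⟩ _).image _

/-- The union in `paths_eq` is disjoint, since a nonempty path determines its last arc, and
appending a fixed arc is injective. -/
theorem pathCount_eq (G : WeightedDAG n m) (s v : Fin n) (c : ℕ) :
    G.pathCount s v c = (if v = s then 1 else 0) + ∑ a, if G.dst a = v then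
      if G.weight a ≤ c then G.pathCount s (G.src a) (c - G.weight a) else 0 else 0 := by
  have h0 : ∀ v c, G.pathCount s v c = (G.paths_finite s v c).toFinset.card := fun v c =>
    Set.ncard_eq_toFinset_card _ (G.paths_finite s v c)
  simp only [h0]
  have h1 : (G.paths_finite s v c).toFinset = (if v = s then {[]} else ∅) ∪
      (Finset.univ.filter fun a => G.dst a = v ∧ G.weight a ≤ c).biUnion fun a =>
        (G.paths_finite s (G.src a) (c - G.weight a)).toFinset.image fun p => p ++ [a] := by
    ext p
    have := Set.ext_iff.1 (G.paths_eq s v c) p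
    rw [Set.Finite.mem_toFinset, this]
    split_ifs <;> simp
  have hinj : ∀ a : Fin m, Function.Injective fun p : List (Fin m) => p ++ [a] :=
    fun a => List.append_left_injective _
  rw [h1, Finset.card_union_of_disjoint, Finset.card_biUnion]
  · congr 1
    · split_ifs <;> simp
    · rw [Finset.sum_filter]
      refine Finset.sum_congr rfl fun a _ => ?_
      rw [Finset.card_image_of_injective _ (hinj a), ← ite_and]
  · intro a _ b _ hab
    rw [Function.onFun, Finset.disjoint_left]
    intro p hp hp'
    obtain ⟨q, -, rfl⟩ := Finset.mem_image.1 hp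
    obtain ⟨q', -, h⟩ := Finset.mem_image.1 hp'
    have := (List.append_inj' h rfl).2
    exact hab (by simpa using this.symm)
  · rw [Finset.disjoint_left]
    intro p hp hp'
    obtain ⟨a, -, hp'⟩ := Finset.mem_biUnion.1 hp'
    obtain ⟨q, -, rfl⟩ := Finset.mem_image.1 hp'
    split_ifs at hp <;> simp at hp

/-- The number of arcs into `v`. -/
def indeg (G : WeightedDAG n m) (v : Fin n) : ℕ := (Finset.univ.filter fun a => G.dst a = v).card

theorem sum_indeg (G : WeightedDAG n m) : ∑ v, G.indeg v = m := by
  have := Finset.card_eq_sum_card_fiberwise (f := G.dst) (s := Finset.univ) (t := Finset.univ)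
    (fun _ _ => Finset.mem_univ _)
  simp only [Finset.card_univ, Fintype.card_fin] at this
  exact this.symm

open Classical in
-- Induction along the arcs for the product over the ancestors of `v` only: by acyclicity the
-- ancestors of a tail omit `v`, so each of the `indeg v` arcs, and the empty path, contributes at
-- most the product over the other ancestors.
theorem pathCount_le_prod (G : WeightedDAG n m) (s v : Fin n) (c : ℕ) :
    G.pathCount s v c ≤ ∏ u, (1 + G.indeg u) := by
  suffices H : G.pathCount s v c ≤
      ∏ u ∈ Finset.univ.filter (fun u => Relation.ReflTransGen G.Arc u v), (1 + G.indeg u) from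
    H.trans (Finset.prod_le_prod_of_subset_of_one_le' (Finset.filter_subset _ _)
      fun u _ _ => Nat.le_add_right _ _)
  induction v using G.wellFounded_arc.induction generalizing c with
  | _ v ih =>
    set A := Finset.univ.filter fun u => Relation.ReflTransGen G.Arc u v with hA
    set Q := ∏ u ∈ A.erase v, (1 + G.indeg u) with hQ
    have hvA : v ∈ A := by simp [hA, Relation.ReflTransGen.refl]
    rw [← Finset.mul_prod_erase A _ hvA, ← hQ]
    have hQ1 : 1 ≤ Q := Finset.prod_pos fun u _ => Nat.add_pos_left one_pos _
    have hle : ∀ a, G.dst a = v → ∀ c, G.pathCount s (G.src a) c ≤ Q := by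
      intro a ha c
      refine (ih (G.src a) ⟨a, rfl, ha⟩ c).trans
        (Finset.prod_le_prod_of_subset_of_one_le' ?_ fun u _ _ => Nat.le_add_right _ _)
      intro u hu
      simp only [Finset.mem_filter, Finset.mem_univ, true_and] at hu
      have ht : Relation.TransGen G.Arc u v := Relation.TransGen.tail' hu ⟨a, rfl, ha⟩
      refine Finset.mem_erase.2 ⟨?_, by simpa [hA] using ht.to_reflTransGen⟩
      rintro rfl
      exact G.acyclic _ ht
    rw [pathCount_eq, add_mul, one_mul]
    refine Nat.add_le_add (by split_ifs <;> omega) ?_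
    rw [← Finset.sum_filter]
    calc _ ≤ ∑ a ∈ Finset.univ.filter (fun a => G.dst a = v), Q := by
          refine Finset.sum_le_sum fun a ha => ?_
          split_ifs
          · exact hle a (Finset.mem_filter.1 ha).2 _
          · exact Nat.zero_le _
      _ = _ := by rw [Finset.sum_const, smul_eq_mul, indeg]

end WeightedDAG

namespace StepFun

theorem lval_of_lt {w c : ℕ} (h : c < w) (a : ℕ) (l : List (ℕ × ℕ × ℕ)) : lval w c a l = a := by
  cases l with
  | nil => rfl
  | cons p l => rw [lval, if_neg (by omega)]

theorem lval_shift {w c : ℕ} (h : w ≤ c) (a : ℕ) (l : List (ℕ × ℕ × ℕ)) :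
    lval w c a l = lval 0 (c - w) a l := by
  induction l generalizing a with
  | nil => rfl
  | cons p l ih =>
    have : p.1 + w ≤ c ↔ p.1 + 0 ≤ c - w := by omega
    simp only [lval, ih, this]

theorem Approx.mono {h d d' g f : ℕ} (H : Approx h d g f) (hd : d ≤ d') : Approx h d' g f :=
  ⟨H.1, H.2.trans (Nat.add_le_add_left (Nat.mul_le_mul_right _ hd) _)⟩

theorem Good.unit {h C X : ℕ} (hX : 0 < X) : Good h C X [(0, 2 ^ h, 0)] := by
  refine ⟨⟨le_rfl, Nat.zero_le _, ⟨le_rfl, Nat.pow_lt_pow_right (by norm_num) (by simp)⟩, trivial⟩,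
    ?_⟩
  simp [hX]

end StepFun

/-! ### The step function of one vertex. -/

namespace RAM

open StepFun Sweep

variable {b B n m : ℕ} {σ : Store}

/-- Put the arc `11` into the queue if its head is the vertex `10`. -/
def enqueueProg : Prog :=
  .cond (.eq (.cell 1 (.var 11)) (.var 10))
    (.write 8 (.var 13) (.cell 7 (.cell 0 (.var 11))) ;;
      .write 9 (.var 13) (.cell 2 (.var 11)) ;; .assign 13 (.add (.var 13) (.const 1)))
    .skip ;;
  .assign 11 (.add (.var 11) (.const 1))

/-- Start the queue of the vertex `10`. -/
def startProg : Prog :=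
  .cond (.eq (.var 10) (.var 2)) (.write 8 (.const 0) (.const 1)) (.write 8 (.const 0) (.const 0)) ;;
  .write 9 (.const 0) (.const 0) ;; .assign 13 (.const 1) ;; .assign 11 (.const 0)

/-- Put the arcs into the vertex `10` into the queue. -/
def queueProg : Prog :=
  startProg ;; .loop (.le (.add (.var 11) (.const 1)) (.var 1)) enqueueProg

/-- Compress the sum of the queue, and assign it to the vertex `10`. -/
def storeProg : Prog :=
  .assign 17 (.var 7) ;; .assign 18 (.cell 8 (.const 0)) ;; .assign 19 (.const 0) ;;
  .assign 20 (.const 0) ;; .assign 21 (.const 0) ;; mergeProg ;;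
  .write 7 (.var 10) (.var 35) ;; .write 6 (.var 10) (.const 1)

/-- Compute the step function of the vertex `10`. -/
def vertexProg : Prog :=
  queueProg ;; .assign 14 (.const 0) ;; reduceProg ;; storeProg

/-- The memory holds the instance, the numbers that do not change, and the step functions that
are constant with the values zero and one. -/
structure Mem (B : ℕ) (G : WeightedDAG n m) (S : Fin n) (C h X s : ℕ) (σ : Store) : Prop
    extends Ctx B C h X G.maxWeight σ where
  var0 : σ.var 0 = n
  var1 : σ.var 1 = m
  var2 : σ.var 2 = S
  var7 : σ.var 7 = s
  src : ∀ a : Fin m, σ.arr 0 a = G.src a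
  dst : ∀ a : Fin m, σ.arr 1 a = G.dst a
  weight : ∀ a : Fin m, σ.arr 2 a = G.weight a
  unit : ListAt C σ.arr 1 [(0, 2 ^ h, 0)]
  free3 : 3 ≤ σ.var 8
  s_le : s ≤ h
  s_pos : 0 < s
  m_lt : m < 2 ^ s
  m_lt' : m + 5 < 2 ^ B
  count_lt : ∀ v c, G.pathCount S v c < 2 ^ X

theorem Mem.congr {G : WeightedDAG n m} {S : Fin n} {C h X s : ℕ} {σ τ : Store}
    (hσ : Mem B G S C h X s σ) (hv : ∀ x ∈ [0, 1, 2, 4, 6, 7], τ.var x = σ.var x)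
    (ha : ∀ a ∈ [0, 1, 2], τ.arr a = σ.arr a) (h8 : σ.var 8 ≤ τ.var 8)
    (hA : Agree (σ.var 8) σ.arr τ.arr) : Mem B G S C h X s τ := by
  simp only [List.forall_mem_cons] at hv ha
  obtain ⟨v0, v1, v2, v4, v6, v7, -⟩ := hv
  obtain ⟨a0, a1, a2, -⟩ := ha
  have := hσ.free3
  refine ⟨hσ.toCtx.congr v4 v6 h8 hA, v0.trans hσ.var0, v1.trans hσ.var1, v2.trans hσ.var2,
    v7.trans hσ.var7, ?_, ?_, ?_, hσ.unit.congr (F := σ.var 8) ?_ hA, by omega, hσ.s_le,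
    hσ.s_pos, hσ.m_lt, hσ.m_lt', hσ.count_lt⟩
  · rw [a0]; exact hσ.src
  · rw [a1]; exact hσ.dst
  · rw [a2]; exact hσ.weight
  · simp only [List.length_singleton]; omega

/-- The step function of the vertex `v` is stored, with relative error at most `d / 2 ^ h`. -/
def VertexAt (G : WeightedDAG n m) (S : Fin n) (C h X s d : ℕ) (σ : Store) (v : Fin n) : Prop :=
  ∃ l, ListAt C σ.arr (σ.arr 7 v) l ∧ σ.arr 7 v + l.length < σ.var 8 ∧ Good h C X l ∧
    l.length ≤ X * 2 ^ (h + 1 - s) ∧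
    ∀ c ≤ C, Approx h d (qval c (l, 0)) (2 ^ h * G.pathCount S v c)

theorem VertexAt.congr {G : WeightedDAG n m} {S : Fin n} {C h X s d d' : ℕ} {σ τ : Store}
    {v : Fin n} (hσ : VertexAt G S C h X s d σ v) (h7 : τ.arr 7 v = σ.arr 7 v)
    (h8 : σ.var 8 ≤ τ.var 8) (hA : Agree (σ.var 8) σ.arr τ.arr) (hd : d ≤ d') :
    VertexAt G S C h X s d' τ v := by
  obtain ⟨l, h1, h2, h3, h4, h5⟩ := hσ
  exact ⟨l, by rw [h7]; exact h1.congr h2 hA, by rw [h7]; omega, h3, h4,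
    fun c hc => (h5 c hc).mono hd⟩

/-- The number of paths counted for the `i`-th arc, if this is an arc into `v`. -/
noncomputable def arcTerm (G : WeightedDAG n m) (S v : Fin n) (c i : ℕ) : ℕ :=
  if hi : i < m then (if G.dst ⟨i, hi⟩ = v then (if G.weight ⟨i, hi⟩ ≤ c then
    G.pathCount S (G.src ⟨i, hi⟩) (c - G.weight ⟨i, hi⟩) else 0) else 0) else 0

/-- `1` if the `i`-th arc is an arc into `v`. -/
def arcInto (G : WeightedDAG n m) (v : Fin n) (i : ℕ) : ℕ :=
  if hi : i < m then (if G.dst ⟨i, hi⟩ = v then 1 else 0) else 0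

theorem sum_arcTerm (G : WeightedDAG n m) (S v : Fin n) (c : ℕ) :
    (if v = S then 1 else 0) + ∑ i ∈ Finset.range m, arcTerm G S v c i = G.pathCount S v c := by
  rw [WeightedDAG.pathCount_eq, ← Fin.sum_univ_eq_sum_range]
  congr 1
  refine Finset.sum_congr rfl fun a _ => ?_
  simp [arcTerm]

theorem sum_arcInto (G : WeightedDAG n m) (v : Fin n) :
    ∑ i ∈ Finset.range m, arcInto G v i = G.indeg v := by
  rw [← Fin.sum_univ_eq_sum_range, WeightedDAG.indeg, Finset.card_filter]
  refine Finset.sum_congr rfl fun a _ => ?_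
  simp [arcInto]

theorem indeg_le (G : WeightedDAG n m) (v : Fin n) : G.indeg v ≤ m := by
  have := Finset.card_filter_le (Finset.univ : Finset (Fin m)) fun a => G.dst a = v
  simpa [WeightedDAG.indeg] using this

/-- The first entry stands for the empty path: the constant `2 ^ h` if `v` is the source, otherwise
zero. Each arc into `v` enters the list of its tail by address, with its weight as shift; nothing is
copied and no error arises. -/
theorem wp_queueProg {G : WeightedDAG n m} {S v : Fin n} {C h X s d : ℕ}
    (hM : Mem B G S C h X s σ) (h10 : σ.var 10 = v)
    (hp : ∀ a, G.dst a = v → VertexAt G S C h X s d σ (G.src a)) :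
    Wp b B queueProg (fun τ T => T ≤ 50 * m + 50 ∧
      ∃ qs, QueueAt C (σ.var 8) τ.arr 0 qs ∧ τ.var 13 = qs.length ∧ qs.length = G.indeg v + 1 ∧
        (∀ q ∈ qs, Good h C X q.1 ∧ q.1.length ≤ X * 2 ^ (h + 1 - s) ∧ q.2 ≤ G.maxWeight) ∧
        (∀ q ∈ qs, q.1.length ≤ X * 2 ^ (h + 1 - s) * G.indeg v + 1) ∧
        (∀ q ∈ qs.head?, q.2 = 0) ∧
        ∀ c ≤ C, Approx h d (qtotal c qs) (2 ^ h * G.pathCount S v c)) σ := by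
  have hm := hM.m_lt'
  have hX := hM.posX
  have hΛ : 1 ≤ X * 2 ^ (h + 1 - s) := Nat.mul_pos hX (Nat.two_pow_pos _)
  refine .seq (Wp.frame (Q := fun τ T => T ≤ 25 ∧ τ.var 13 = 1 ∧ τ.var 11 = 0 ∧
    τ.arr 8 0 = (if v = S then 1 else 0) ∧ τ.arr 9 0 = 0) ?_ fun τ T hfr hτ => ?_)
  · have hvS : σ.var 10 = σ.var 2 ↔ v = S := by
      rw [h10, hM.var2]; exact Fin.val_inj
    refine .seq (.cond ⟨trivial, trivial⟩ (fun hle => .write ?_ ?_ ?_)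
      (fun hle => .write ?_ ?_ ?_))
    any_goals simp only [Term.Small]
    any_goals omega
    all_goals
      simp only [Test.holds, Term.val, hvS] at hle
      refine .seq (.write ?_ ?_ (.seq (.assign ?_ (.assign ?_ ?_))))
      any_goals simp only [Term.Small]
      any_goals omega
      simp [Term.val, Term.nodes, Test.nodes, hle]
  · obtain ⟨t1, t2, t3, t4, t5⟩ := hτ
    have hv : ∀ x, x ∉ startProg.vars → τ.var x = σ.var x := hfr.1
    have ha : ∀ a, a ∉ startProg.arrs → τ.arr a = σ.arr a := hfr.2
    have hag : Agree (σ.var 8) σ.arr τ.arr := by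
      intro a h3 h5 z _
      rw [ha a (by simp [startProg, Prog.arrs]; omega)]
    refine .loop (α := ℕ × List (List (ℕ × ℕ × ℕ) × ℕ)) (fun D ρ k => D.1 ≤ m ∧
      ρ.var 11 = D.1 ∧ ρ.var 13 = D.2.length ∧
      D.2.length = 1 + ∑ i ∈ Finset.range D.1, arcInto G v i ∧
      QueueAt C (σ.var 8) ρ.arr 0 D.2 ∧
      (∀ q ∈ D.2, Good h C X q.1 ∧ q.1.length ≤ X * 2 ^ (h + 1 - s) ∧ q.2 ≤ G.maxWeight) ∧
      (D.2.length = 1 → ∀ q ∈ D.2, q.1.length ≤ 1) ∧ (∀ q ∈ D.2.head?, q.2 = 0) ∧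
      (∀ c ≤ C, Approx h d (qtotal c D.2)
        (2 ^ h * ((if v = S then 1 else 0) + ∑ i ∈ Finset.range D.1, arcTerm G S v c i))) ∧
      k ≤ 50 * D.1)
      (fun D => m - D.1) (0, [(if v = S then [(0, 2 ^ h, 0)] else [], 0)]) ?_ ?_
    · have hfree := hM.free3
      refine ⟨Nat.zero_le _, t3, t2, by simp, ⟨⟨?_, ?_, t5⟩, trivial⟩, ?_, ?_, by simp,
        fun c _ => ?_, by simp⟩
      · rw [t4]
        split_ifs
        · exact hM.unit.congr (F := σ.var 8) (by simp; omega) hag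
        · exact ⟨trivial, (hag 3 (by omega) (by omega) 0 (by omega)).trans hM.empty⟩
      · rw [t4]
        split_ifs
        · simp only [List.length_singleton]; omega
        · simp only [List.length_nil]; omega
      · intro q hq
        rw [List.mem_singleton.1 hq]
        dsimp only
        split_ifs
        · exact ⟨Good.unit hX, by simpa using hΛ, Nat.zero_le _⟩
        · exact ⟨Good.nil, Nat.zero_le _, Nat.zero_le _⟩
      · intro _ q hq
        rw [List.mem_singleton.1 hq]
        dsimp only
        split_ifs <;> simp
      · have : qtotal c [(if v = S then [(0, 2 ^ h, 0)] else [], 0)] =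
            2 ^ h * ((if v = S then 1 else 0) + 0) := by
          split_ifs <;> simp [qtotal, qval, lval, fval]
        dsimp only
        rw [this, Finset.sum_range_zero]
        exact Approx.refl _ _ _
    · rintro ⟨i, qs⟩ ρ k hfr2 ⟨i1, i2, i3, i4, i5, i6, i7, i8, i9, i10⟩
      dsimp only at *
      have hv2 : ∀ x, x ∉ enqueueProg.vars → ρ.var x = τ.var x := hfr2.1
      have ha2 : ∀ a, a ∉ enqueueProg.arrs → ρ.arr a = τ.arr a := hfr2.2
      have hr1 : ρ.var 1 = m := (hv2 1 (by decide)).trans ((hv 1 (by decide)).trans hM.var1)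
      have hr10 : ρ.var 10 = v := (hv2 10 (by decide)).trans ((hv 10 (by decide)).trans h10)
      have hr0 : ρ.arr 0 = σ.arr 0 := (ha2 0 (by decide)).trans (ha 0 (by decide))
      have hr1' : ρ.arr 1 = σ.arr 1 := (ha2 1 (by decide)).trans (ha 1 (by decide))
      have hr2 : ρ.arr 2 = σ.arr 2 := (ha2 2 (by decide)).trans (ha 2 (by decide))
      have hr7 : ρ.arr 7 = σ.arr 7 := (ha2 7 (by decide)).trans (ha 7 (by decide))
      have hag2 : Agree (σ.var 8) σ.arr ρ.arr := by
        intro a h3 h5 z _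
        rw [ha2 a (by simp [enqueueProg, Prog.arrs]; omega),
          ha a (by simp [startProg, Prog.arrs]; omega)]
      refine ⟨⟨⟨trivial, ?_, ?_⟩, trivial⟩, fun hle => ?_, fun hle => ?_⟩
      · simp only [Term.Small]; omega
      · simp only [Term.val]; omega
      · simp only [Test.holds, Term.val, i2, hr1] at hle
        have hi : i < m := hle
        have hcount : qs.length ≤ 1 + i := by
          rw [i4]
          have : ∑ i ∈ Finset.range i, arcInto G v i ≤ ∑ i ∈ Finset.range i, 1 := by
            refine Finset.sum_le_sum fun j _ => ?_
            rw [arcInto]; split_ifs <;> omega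
          simpa using this
        have hdst : (ρ.arr 1 (ρ.var 11) = ρ.var 10) ↔ G.dst ⟨i, hi⟩ = v := by
          rw [hr10, i2, hr1']
          have := hM.dst ⟨i, hi⟩
          simp only at this
          rw [this]
          exact Fin.val_inj
        have hterm : ∀ c, arcTerm G S v c i = if G.dst ⟨i, hi⟩ = v then
            (if G.weight ⟨i, hi⟩ ≤ c then
              G.pathCount S (G.src ⟨i, hi⟩) (c - G.weight ⟨i, hi⟩) else 0) else 0 := by
          intro c; rw [arcTerm, dif_pos hi]
        have hinto : arcInto G v i = if G.dst ⟨i, hi⟩ = v then 1 else 0 := by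
          rw [arcInto, dif_pos hi]
        refine .seq (.cond ⟨trivial, trivial⟩ (fun hd => ?_) (fun hd => .skip ?_))
        · simp only [Test.holds, Term.val, hdst] at hd
          rw [if_pos hd] at hinto
          refine .seq (.write ?_ ?_ (.seq (.write ?_ ?_ (.assign ?_ (.assign ?_ ?_)))))
          any_goals simp only [Term.Small, Term.val, Store.setCell_var, Store.setVar_var,
            Nat.reduceEqDiff, reduceIte, true_and]
          any_goals omega
          have hsrc : σ.arr 0 i = G.src ⟨i, hi⟩ := hM.src ⟨i, hi⟩
          have hwt : σ.arr 2 i = G.weight ⟨i, hi⟩ := hM.weight ⟨i, hi⟩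
          obtain ⟨l, l1, l2, l3, l4, l5⟩ := hp ⟨i, hi⟩ hd
          have hwm : G.weight ⟨i, hi⟩ ≤ G.maxWeight :=
            Finset.le_sup (f := G.weight) (Finset.mem_univ _)
          have hlen : (qs ++ [(l, G.weight ⟨i, hi⟩)]).length = qs.length + 1 := by simp
          refine ⟨(i + 1, qs ++ [(l, G.weight ⟨i, hi⟩)]), by dsimp only; omega, ?_⟩
          simp only [Store.setVar_arr, i2, i3, hlen]
          refine ⟨hi, trivial, trivial, ?_, ?_, ?_, ?_, ?_, ?_, ?_⟩
          · rw [Finset.sum_range_succ, hinto]; omega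
          · have hag3 : Agree (σ.var 8) ρ.arr ((ρ.setCell 8 qs.length (ρ.arr 7 (ρ.arr 0 i))).setCell
                9 qs.length ((ρ.setCell 8 qs.length (ρ.arr 7 (ρ.arr 0 i))).arr 2 i)).arr := by
              intro a h3 h5 z _
              have h8 : a ≠ 8 := by omega
              have h9 : a ≠ 9 := by omega
              simp [h8, h9]
            refine (i5.congr hag3 (fun j _ hj => ?_) le_rfl).append ?_
            · have : j ≠ qs.length := by omega
              simp [this]
            · have hag4 : Agree (σ.var 8) σ.arr _ := hag2.trans hag3 le_rfl
              refine ⟨?_, ?_, ?_⟩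
              · convert l1.congr l2 hag4 using 1
                simp [hr0, hr7, hsrc]
              · simp [hr0, hr7, hsrc, l2]
              · simp [hr2, hwt]
          · intro q hq
            rcases List.mem_append.1 hq with hq | hq
            · exact i6 q hq
            · rw [List.mem_singleton.1 hq]
              exact ⟨l3, l4, hwm⟩
          · intro h1; omega
          · intro q hq
            refine i8 q ?_
            cases qs with
            | nil => simp only [List.length_nil] at i4; omega
            | cons x qs => simpa using hq
          · intro c hc
            rw [Finset.sum_range_succ, ← add_assoc, mul_add, qtotal_append]
            refine (i9 c hc).add ?_
            have hq1 : qtotal c [(l, G.weight ⟨i, hi⟩)] = lval (G.weight ⟨i, hi⟩) c 0 l := by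
              simp [qtotal, qval]
            rw [hq1, hterm, if_pos hd]
            split_ifs with hw
            · rw [lval_shift hw]
              exact l5 _ (by omega)
            · rw [lval_of_lt (by omega)]
              exact Approx.refl _ _ _
          · simp only [Test.nodes, Term.nodes]; omega
        · simp only [Test.holds, Term.val, hdst] at hd
          rw [if_neg hd] at hinto
          refine .assign ?_ ⟨(i + 1, qs), by dsimp only; omega, ?_⟩
          · simp only [Term.Small, Term.val, true_and]; omega
          simp only [Term.val, Store.setVar_var, Store.setVar_arr, i2, Nat.reduceEqDiff,
            reduceIte]
          refine ⟨hi, trivial, i3, ?_, i5, i6, i7, i8, fun c hc => ?_, ?_⟩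
          · rw [Finset.sum_range_succ, hinto]; omega
          · rw [Finset.sum_range_succ, hterm, if_neg hd]
            exact i9 c hc
          · simp only [Test.nodes, Term.nodes]; omega
      · simp only [Test.holds, Term.val, i2, hr1] at hle
        obtain rfl : i = m := by omega
        rw [sum_arcInto] at i4
        refine ⟨by simp only [Test.nodes, Term.nodes]; omega, qs, i5, i3, by omega, i6, ?_, i8,
          fun c hc => ?_⟩
        · intro q hq
          rcases Nat.eq_zero_or_pos (G.indeg v) with h0 | h0
          · exact (i7 (by omega) q hq).trans (Nat.le_add_left _ _)
          · exact ((i6 q hq).2.1.trans (Nat.le_mul_of_pos_right _ h0)).trans (Nat.le_add_right _ _)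
        · rw [← sum_arcTerm]
          exact i9 c hc

/-- Merging with the empty list serves as compression: it restores the length bound for `s` dropped
bits, which was given up when the precision was raised. -/
theorem wp_storeProg {G : WeightedDAG n m} {S v : Fin n} {C h X s : ℕ}
    {l : List (ℕ × ℕ × ℕ)} (hM : Mem B G S C h X s σ) (h10 : σ.var 10 = v)
    (hl : EntryAt C (σ.var 8) σ.arr 0 (l, 0)) (hlg : Good h C X l)
    (hT : qval C (l, 0) < 2 ^ (h + X)) (hF : σ.var 8 + l.length + 1 < 2 ^ B) :
    Wp b B storeProg (fun τ T => T ≤ 150 * (l.length + 1) + 50 ∧ σ.var 8 ≤ τ.var 8 ∧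
      τ.var 8 ≤ σ.var 8 + (l.length + 1) ∧ Agree (σ.var 8) σ.arr τ.arr ∧
      (∀ i, i ≠ (v : ℕ) → τ.arr 7 i = σ.arr 7 i) ∧ (∀ i, i ≠ (v : ℕ) → τ.arr 6 i = σ.arr 6 i) ∧
      τ.arr 6 v = 1 ∧
      ∃ out, ListAt C τ.arr (τ.arr 7 v) out ∧ τ.arr 7 v + out.length < τ.var 8 ∧ Good h C X out ∧
        out.length ≤ X * 2 ^ (h + 1 - s) ∧
        ∀ c ≤ C, Approx h (2 ^ s + 2) (qval c (out, 0)) (qval c (l, 0))) σ := by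
  have hb := hM.bdC
  have hm := hM.m_lt'
  obtain ⟨x1, x2, x3⟩ := hl
  dsimp only at x1 x2 x3
  refine .seq (.assign ?_ (.seq (.assign ?_ (.seq (.assign ?_ (.seq (.assign ?_ (.seq
    (.assign ?_ (.seq ?_))))))))))
  any_goals simp only [Term.Small, Term.val, Store.setVar_arr]
  any_goals omega
  refine Wp.frame (wp_mergeProg (C := C) (h := h) (s := s) (X := X)
    (x := σ.arr 8 0) (y := 0) (l₁ := l) (l₂ := [])
    (w₁ := 0) (w₂ := 0) ?_ ?_ ?_ ?_ ?_ ?_ ?_ x1 ⟨trivial, ?_⟩ ?_ ?_ hlg.bounds (by simp) ?_ ?_ ?_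
    hM.bdX) fun τ T hfr hτ => ?_
  any_goals simp only [Store.setVar_var, Nat.reduceEqDiff, reduceIte, List.length_nil, add_zero]
  any_goals omega
  · exact hM.var4
  · exact hM.var6
  · exact hM.var7
  · exact hM.empty
  · obtain ⟨t1, t2, t3, out, t4, t5, t6⟩ := hτ
    have hnil : ∀ c, qval c ([], 0) = 0 := fun c => rfl
    obtain ⟨g1, g2, g3⟩ := Good.merge (x := (l, 0)) (y := ([], 0)) hM.s_le hM.posX hlg Good.nil
      (by rw [hnil]; exact hT) t4
    have hlen := t4.length_le
    have hv := hfr.1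
    have hv' := hfr.2
    simp only [Store.setVar_var, Store.setVar_arr, Nat.reduceEqDiff, reduceIte, List.length_nil,
      add_zero, hnil] at *
    have h10' : τ.var 10 = v := by
      have := hv 10 (by decide); simpa [h10] using this
    have h7' := hv' 7 (by decide)
    have h6' := hv' 6 (by decide)
    refine .seq (.write ?_ ?_ (.write ?_ ?_ ?_))
    any_goals simp only [Term.Small, Term.val, Store.setCell_var, Term.nodes]
    any_goals omega
    have hag : ∀ F, Agree F τ.arr
        ((τ.setCell 7 (τ.var 10) (τ.var 35)).setCell 6 (τ.var 10) 1).arr := by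
      intro F a ha ha' z hz
      have h8 : a ≠ 7 := by omega
      have h9 : a ≠ 6 := by omega
      simp [h8, h9]
    have hag' : Agree (σ.var 8) σ.arr τ.arr := fun a _ _ z hz => t2 a z hz
    have e7 : ((τ.setCell 7 (τ.var 10) (τ.var 35)).setCell 6 (τ.var 10) 1).arr 7 v =
          σ.var 8 := by simp [h10', t3]
    rw [e7]
    refine ⟨by omega, by omega, by omega, hag'.trans (hag _) le_rfl, ?_, ?_, ?_, out,
      t5.congr (F := τ.var 8) (by omega) (hag _), by omega, g1, g2, g3⟩
    · intro i hi
      simp [h10', hi, h7']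
    · intro i hi
      simp [h10', hi, h6']
    · simp [h10']

/-- The new error is `8 * 2 ^ s` from the summation and `2 ^ s + 2` from the compression, together
at most `10 * 2 ^ s`. The number `U` bounds the memory, and up to a factor and the scan of the arcs
also the steps. -/
theorem wp_vertexProg {G : WeightedDAG n m} {S v : Fin n} {C h X s d Λ U : ℕ}
    (hM : Mem B G S C h X s σ) (h10 : σ.var 10 = v) (hΛ : Λ = X * 2 ^ (h + 1 - s))
    (hU : U = potential (2 * Λ + 1) 0 (G.indeg v) + Λ * G.indeg v + 2)
    (hp : ∀ a, G.dst a = v → VertexAt G S C h X s d σ (G.src a))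
    (hF : σ.var 8 + U + 1 < 2 ^ B) :
    Wp b B vertexProg (fun τ T => T ≤ 264 * U + 50 * m + 200 ∧ Mem B G S C h X s τ ∧
      σ.var 8 ≤ τ.var 8 ∧ τ.var 8 ≤ σ.var 8 + U ∧ Agree (σ.var 8) σ.arr τ.arr ∧
      (∀ i, i ≠ (v : ℕ) → τ.arr 7 i = σ.arr 7 i) ∧ (∀ i, i ≠ (v : ℕ) → τ.arr 6 i = σ.arr 6 i) ∧
      τ.arr 6 v = 1 ∧ VertexAt G S C h X s (d + 10 * 2 ^ s) τ v) σ := by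
  refine Wp.frame (R := _) (Q := fun τ T => T ≤ 264 * U + 50 * m + 200 ∧
      σ.var 8 ≤ τ.var 8 ∧ τ.var 8 ≤ σ.var 8 + U ∧ Agree (σ.var 8) σ.arr τ.arr ∧
      (∀ i, i ≠ (v : ℕ) → τ.arr 7 i = σ.arr 7 i) ∧ (∀ i, i ≠ (v : ℕ) → τ.arr 6 i = σ.arr 6 i) ∧
      τ.arr 6 v = 1 ∧ VertexAt G S C h X s (d + 10 * 2 ^ s) τ v) ?_ ?_
  · have hind := indeg_le G v
    have hm := hM.m_lt
    have hm' := hM.m_lt'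
    refine .seq (Wp.frame (wp_queueProg hM h10 hp) fun τ T hfr hτ => ?_)
    obtain ⟨t1, qs, t2, t3, t4, t5, t6, t7, t8⟩ := hτ
    have hv : ∀ x, x ∉ queueProg.vars → τ.var x = σ.var x := hfr.1
    have ha : ∀ a, a ∉ queueProg.arrs → τ.arr a = σ.arr a := hfr.2
    have hag : Agree (σ.var 8) σ.arr τ.arr := by
      intro a h3 h5 z _
      rw [ha a (by simp [queueProg, startProg, enqueueProg, Prog.arrs]; omega)]
    have h8 : τ.var 8 = σ.var 8 := hv 8 (by decide)
    have hMτ : Mem B G S C h X s τ := hM.congr (fun x hx => hv x (by revert x; decide))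
      (fun x hx => ha x (by revert x; decide)) h8.ge hag
    have hTot : qtotal C qs < 2 ^ (h + X) := by
      refine lt_of_le_of_lt (t8 C le_rfl).1 ?_
      rw [pow_add]
      exact Nat.mul_lt_mul_of_pos_left (hM.count_lt v C) (Nat.two_pow_pos h)
    rw [← hΛ] at t5 t6
    refine .seq (.assign ?_ (.seq (Wp.frame (wp_reduceProg (d := G.indeg v) (qs := qs)
      (hMτ.toCtx.congr rfl rfl le_rfl fun _ _ _ _ _ => rfl) hMτ.var7 rfl hM.s_le hΛ
      (by rw [← h8] at t2; exact t2) t3 t4 (by omega) t5 t6 t7 hTot ?_ (by omega))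
      fun ρ T' hfr2 hρ => ?_)))
    · simp only [Term.Small]; omega
    · simp only [Store.setVar_var, Nat.reduceEqDiff, reduceIte]; omega
    obtain ⟨r1, r2, r3, r4, l, r5, r6, r7, r8⟩ := hρ
    have hv2 : ∀ x, x ∉ 14 :: reduceProg.vars → ρ.var x = τ.var x := by
      intro x hx
      rw [List.mem_cons, not_or] at hx
      rw [hfr2.1 x hx.2, Store.setVar_var, if_neg hx.1]
    have ha2 : ∀ a, a ∉ reduceProg.arrs → ρ.arr a = τ.arr a := hfr2.2
    simp only [Store.setVar_var, Store.setVar_arr, Nat.reduceEqDiff, reduceIte] at r2 r3 r4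
    rw [h8] at r2 r3 r4
    have hMρ : Mem B G S C h X s ρ := hMτ.congr (fun x hx => hv2 x (by revert x; decide))
      (fun x hx => ha2 x (by revert x; decide)) (by omega) (by rw [h8]; exact r4)
    have h10' : ρ.var 10 = v := (hv2 10 (by decide)).trans ((hv 10 (by decide)).trans h10)
    refine Wp.mono (wp_storeProg hMρ h10' r5 r6
      (lt_of_le_of_lt ((r8 C le_rfl).1) hTot) (by omega)) ?_
    rintro υ T'' ⟨u1, u2, u3, u4, u5, u6, u7, out, u8, u9, u10, u11, u12⟩
    have e7 : ρ.arr 7 = σ.arr 7 := (ha2 7 (by decide)).trans (ha 7 (by decide))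
    have e6 : ρ.arr 6 = σ.arr 6 := (ha2 6 (by decide)).trans (ha 6 (by decide))
    rw [e7] at u5
    rw [e6] at u6
    refine ⟨?_, by omega, by omega, (hag.trans r4 le_rfl).trans u4 r2, u5, u6, u7, out, u8, u9,
      u10, u11, fun c hc => ?_⟩
    · simp only [Term.nodes]
      omega
    · refine (((u12 c hc).trans (r8 c hc)).trans (t8 c hc)).mono ?_
      have : 2 ≤ 2 ^ s := by
        calc 2 = 2 ^ 1 := rfl
          _ ≤ _ := Nat.pow_le_pow_right (by norm_num) hM.s_pos
      omega
  · rintro τ T hfr ⟨t1, t2, t3, t4, t5⟩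
    exact ⟨t1, hM.congr (fun x hx => hfr.1 x (by revert x; decide))
      (fun x hx => hfr.2 x (by revert x; decide)) t2 t4, t2, t3, t4, t5⟩

end RAM

/-! ### Processing the vertices in a topological order found on the fly. -/

namespace RAM

open StepFun Sweep

variable {b B n m : ℕ} {σ : Store}

/-- Check the arc `11`: if its head is the vertex `10`, its tail has to be done. -/
def scanStep : Prog :=
  .cond (.eq (.cell 1 (.var 11)) (.var 10))
    (.cond (.eq (.cell 6 (.cell 0 (.var 11))) (.const 0)) (.assign 12 (.const 0)) .skip) .skip ;;
  .assign 11 (.add (.var 11) (.const 1))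

/-- Set the variable `12` to `1` if the tails of all arcs into the vertex `10` are done. -/
def scanProg : Prog :=
  .assign 12 (.const 1) ;; .assign 11 (.const 0) ;;
  .loop (.le (.add (.var 11) (.const 1)) (.var 1)) scanStep

/-- Compute the step function of the vertex `10` if this is possible and not done yet, and
go to the next vertex. -/
def vertexStep : Prog :=
  .cond (.eq (.cell 6 (.var 10)) (.const 0))
    (scanProg ;; .cond (.eq (.var 12) (.const 1)) vertexProg .skip) .skip ;;
  .assign 10 (.add (.var 10) (.const 1))

/-- A round over all vertices. -/
def roundProg : Prog :=
  .assign 10 (.const 0) ;; .loop (.le (.add (.var 10) (.const 1)) (.var 0)) vertexStep ;;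
  .assign 9 (.add (.var 9) (.const 1))

/-- Compute the step functions of all vertices. -/
def allProg : Prog :=
  .assign 9 (.const 0) ;; .loop (.le (.add (.var 9) (.const 1)) (.var 0)) roundProg

theorem wp_scanProg {G : WeightedDAG n m} {v : Fin n} {D : Finset (Fin n)} (h1 : σ.var 1 = m)
    (h10 : σ.var 10 = v) (hsrc : ∀ a : Fin m, σ.arr 0 a = G.src a)
    (hdst : ∀ a : Fin m, σ.arr 1 a = G.dst a)
    (hD : ∀ u : Fin n, σ.arr 6 u = 0 ↔ u ∉ D) (hm : m + 5 < 2 ^ B) :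
    Wp b B scanProg (fun τ T => T ≤ 30 * m + 10 ∧
      (τ.var 12 = 1 ↔ ∀ a, G.dst a = v → G.src a ∈ D)) σ := by
  refine .seq (.assign ?_ (.seq (.assign ?_ ?_)))
  any_goals simp only [Term.Small]
  any_goals omega
  refine .loop (α := ℕ) (fun i τ k => i ≤ m ∧ τ.var 11 = i ∧ k ≤ 30 * i ∧
      (τ.var 12 = 1 ↔ ∀ a : Fin m, (a : ℕ) < i → G.dst a = v → G.src a ∈ D))
    (fun i => m - i) 0 ?_ ?_
  · simp [Term.val]
  · rintro i τ k hfr ⟨i1, i2, i3, i4⟩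
    have hv := hfr.1
    have ha := hfr.2
    simp only [Store.setVar_arr] at ha
    have e1 : τ.var 1 = m := by rw [hv 1 (by decide)]; simpa using h1
    have e10 : τ.var 10 = v := by rw [hv 10 (by decide)]; simpa using h10
    refine ⟨⟨⟨trivial, ?_, ?_⟩, trivial⟩, fun hle => ?_, fun hle => ?_⟩
    · simp only [Term.Small]; omega
    · simp only [Term.val]; omega
    · simp only [Test.holds, Term.val, i2, e1] at hle
      have hi : i < m := hle
      have hd : τ.arr 1 (τ.var 11) = τ.var 10 ↔ G.dst ⟨i, hi⟩ = v := by
        rw [e10, i2, ha 1 (by decide)]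
        have := hdst ⟨i, hi⟩
        simp only at this
        rw [this]
        exact Fin.val_inj
      have hs : τ.arr 6 (τ.arr 0 (τ.var 11)) = 0 ↔ G.src ⟨i, hi⟩ ∉ D := by
        rw [i2, ha 6 (by decide), ha 0 (by decide)]
        have := hsrc ⟨i, hi⟩
        simp only at this
        rw [this]
        exact hD _
      have hsplit : (∀ a : Fin m, (a : ℕ) < i + 1 → G.dst a = v → G.src a ∈ D) ↔
          (∀ a : Fin m, (a : ℕ) < i → G.dst a = v → G.src a ∈ D) ∧
            (G.dst ⟨i, hi⟩ = v → G.src ⟨i, hi⟩ ∈ D) := by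
        constructor
        · exact fun H => ⟨fun a ha => H a (by omega), H ⟨i, hi⟩ (Nat.lt_succ_self i)⟩
        · rintro ⟨H1, H2⟩ a ha
          rcases Nat.lt_succ_iff_lt_or_eq.1 ha with h | h
          · exact H1 a h
          · obtain rfl : a = ⟨i, hi⟩ := Fin.ext h
            exact H2
      refine .seq (.cond ⟨trivial, trivial⟩ (fun h => .cond ⟨trivial, ?_⟩ (fun h' => .assign ?_ ?_)
        (fun h' => .skip ?_)) (fun h => .skip ?_))
      any_goals simp only [Term.Small]
      any_goals omega
      all_goals
        simp only [Test.holds, Term.val, hd] at h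
        try simp only [Test.holds, Term.val, hs] at h'
        refine .assign ?_ ⟨i + 1, by omega, by omega, ?_⟩
        · simp only [Term.Small, Term.val, Store.setVar_var, Nat.reduceEqDiff, reduceIte, i2,
            true_and]
          omega
        · simp only [Term.val, Store.setVar_var, Nat.reduceEqDiff, reduceIte, i2, true_and,
            Test.nodes, Term.nodes, hsplit]
          refine ⟨by omega, ?_⟩
          simp_all
    · simp only [Test.holds, Term.val, i2, e1] at hle
      obtain rfl : i = m := by omega
      refine ⟨by simp only [Test.nodes, Term.nodes]; omega, i4.trans ?_⟩
      exact ⟨fun H a => H a a.2, fun H a _ => H a⟩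

/-- The bound on the cost of a vertex. -/
def vertexCost (G : WeightedDAG n m) (Λ : ℕ) (v : Fin n) : ℕ :=
  potential (2 * Λ + 1) 0 (G.indeg v) + Λ * G.indeg v + 2

/-- The vertices in `D` are done. -/
structure State (B : ℕ) (G : WeightedDAG n m) (S : Fin n) (C h X s : ℕ) (D : Finset (Fin n))
    (σ : Store) : Prop where
  mem : Mem B G S C h X s σ
  flag : ∀ u : Fin n, σ.arr 6 u = 0 ↔ u ∉ D
  vertex : ∀ u ∈ D, VertexAt G S C h X s (D.card * (10 * 2 ^ s)) σ u
  free_le : σ.var 8 ≤ 3 + ∑ u ∈ D, vertexCost G (X * 2 ^ (h + 1 - s)) u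
  lt : 3 + ∑ u, vertexCost G (X * 2 ^ (h + 1 - s)) u + n + 1 < 2 ^ B

/-- The bound on the cost of the vertices in `D`. -/
def doneCost (G : WeightedDAG n m) (Λ : ℕ) (D : Finset (Fin n)) : ℕ :=
  264 * ∑ u ∈ D, vertexCost G Λ u + D.card * (50 * m + 200)

theorem State.congr {G : WeightedDAG n m} {S : Fin n} {C h X s : ℕ} {D : Finset (Fin n)}
    {σ τ : Store} (hσ : State B G S C h X s D σ)
    (hv : ∀ x ∈ [0, 1, 2, 4, 6, 7, 8], τ.var x = σ.var x) (ha : τ.arr = σ.arr) :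
    State B G S C h X s D τ := by
  have h8 : τ.var 8 = σ.var 8 := hv 8 (by decide)
  have hag : Agree (σ.var 8) σ.arr τ.arr := fun _ _ _ _ _ => by rw [ha]
  exact ⟨hσ.mem.congr (fun x hx => hv x (by revert x; decide)) (fun a _ => by rw [ha]) h8.ge hag,
    by rw [ha]; exact hσ.flag,
    fun u hu => (hσ.vertex u hu).congr (by rw [ha]) h8.ge hag le_rfl, by rw [h8]; exact hσ.free_le,
    hσ.lt⟩

/-- Amortised: the work of computing a vertex is charged to the growth of `doneCost`, and only the
scan of the arcs is left as a cost of the visit. A new vertex raises the error bound of all done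
vertices to the new cardinality. -/
theorem wp_vertexStep {G : WeightedDAG n m} {S v : Fin n} {C h X s : ℕ} {D : Finset (Fin n)}
    (hS : State B G S C h X s D σ) (h10 : σ.var 10 = v) :
    Wp b B vertexStep (fun τ T => τ.var 10 = v + 1 ∧ ∃ D', D ⊆ D' ∧
      ((∀ a, G.dst a = v → G.src a ∈ D) → v ∈ D') ∧ State B G S C h X s D' τ ∧
      T + doneCost G (X * 2 ^ (h + 1 - s)) D ≤
        doneCost G (X * 2 ^ (h + 1 - s)) D' + (30 * m + 40)) σ := by
  have hm := hS.mem.m_lt'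
  have hlt := hS.lt
  have hvn := v.2
  -- The final increment, shared by the three outcomes: computed, not ready, already done.
  have hend : ∀ (τ : Store) (T : ℕ) (D' : Finset (Fin n)), τ.var 10 = v → D ⊆ D' →
      ((∀ a, G.dst a = v → G.src a ∈ D) → v ∈ D') → State B G S C h X s D' τ →
      T + doneCost G (X * 2 ^ (h + 1 - s)) D ≤
        doneCost G (X * 2 ^ (h + 1 - s)) D' + (30 * m + 35) →
      Wp b B (.assign 10 (.add (.var 10) (.const 1))) (fun ρ U => ρ.var 10 = v + 1 ∧ ∃ D', D ⊆ D' ∧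
      ((∀ a, G.dst a = v → G.src a ∈ D) → v ∈ D') ∧ State B G S C h X s D' ρ ∧
      T + U + doneCost G (X * 2 ^ (h + 1 - s)) D ≤
        doneCost G (X * 2 ^ (h + 1 - s)) D' + (30 * m + 40)) τ := by
    intro τ T D' e10 k1 k2 k3 k4
    refine .assign ?_ ⟨?_, D', k1, k2, k3.congr (fun x hx => ?_) rfl, ?_⟩
    · simp only [Term.Small, Term.val, true_and]; omega
    · simp [Term.val, e10]
    · rw [Store.setVar_var, if_neg]
      rintro rfl
      revert hx
      decide
    · simp only [Term.nodes]; omega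
  have hflag : σ.arr 6 (σ.var 10) = 0 ↔ v ∉ D := by rw [h10]; exact hS.flag v
  refine .seq (.cond ⟨trivial, by simp only [Term.Small]; omega⟩ (fun hvD => ?_)
    (fun hvD => .skip ?_))
  · simp only [Test.holds, Term.val, hflag] at hvD
    refine .seq (Wp.frame (wp_scanProg (G := G) hS.mem.var1 h10 hS.mem.src hS.mem.dst hS.flag hm)
      fun τ T hfr hτ => ?_)
    obtain ⟨t1, t2⟩ := hτ
    have hv : ∀ x, x ∉ scanProg.vars → τ.var x = σ.var x := hfr.1
    have ha : τ.arr = σ.arr := funext fun a => hfr.2 a (by simp [scanProg, scanStep, Prog.arrs])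
    have hSτ : State B G S C h X s D τ := hS.congr (fun x hx => hv x (by revert x; decide)) ha
    have e10 : τ.var 10 = v := (hv 10 (by decide)).trans h10
    refine .cond ⟨trivial, by simp only [Term.Small]; omega⟩ (fun hr => ?_) (fun hr => .skip ?_)
    · simp only [Test.holds, Term.val, t2] at hr
      have hsum : ∑ u ∈ insert v D, vertexCost G (X * 2 ^ (h + 1 - s)) u =
          vertexCost G (X * 2 ^ (h + 1 - s)) v + ∑ u ∈ D, vertexCost G (X * 2 ^ (h + 1 - s)) u :=
        Finset.sum_insert hvD
      have hsum' : ∑ u ∈ insert v D, vertexCost G (X * 2 ^ (h + 1 - s)) u ≤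
          ∑ u, vertexCost G (X * 2 ^ (h + 1 - s)) u :=
        Finset.sum_le_sum_of_subset (Finset.subset_univ _)
      have hfree := hSτ.free_le
      refine Wp.frame (wp_vertexProg hSτ.mem e10 rfl rfl (fun a had => hSτ.vertex _ (hr a had))
        ?_) fun ρ U hfr2 hρ => ?_
      · rw [← vertexCost]; omega
      · obtain ⟨r1, r2, r3, r4, r5, r6, r7, r8, r9⟩ := hρ
        rw [← vertexCost] at r1 r4
        refine hend ρ _ (insert v D) ((hfr2.1 10 (by decide)).trans e10) (Finset.subset_insert _ _)
          (fun _ => Finset.mem_insert_self _ _) ⟨r2, fun u => ?_, fun u hu => ?_, by omega, hlt⟩ ?_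
        · by_cases huv : u = v
          · subst huv
            simp [r8]
          · rw [r7 u (fun h => huv (Fin.ext h)), hSτ.flag u]
            simp [huv]
        · rw [Finset.card_insert_of_notMem hvD]
          by_cases huv : u = v
          · subst huv
            rw [add_mul, one_mul]
            exact r9
          · exact (hSτ.vertex u (Finset.mem_of_mem_insert_of_ne hu huv)).congr
              (r6 u fun h => huv (Fin.ext h)) r3 r5 (Nat.mul_le_mul_right _ (Nat.le_succ _))
        · simp only [Test.nodes, Term.nodes, doneCost, hsum, Finset.card_insert_of_notMem hvD,
            add_mul, mul_add]
          omega
    · simp only [Test.holds, Term.val, t2] at hr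
      refine hend τ _ D e10 subset_rfl (fun h0 => absurd h0 hr) hSτ ?_
      simp only [Test.nodes, Term.nodes]
      omega
  · simp only [Test.holds, Term.val, hflag, not_not] at hvD
    refine hend σ _ D h10 subset_rfl (fun _ => hvD) hS ?_
    simp only [Test.nodes, Term.nodes]
    omega

/-- Each of the `n` rounds completes at least one more vertex unless all are done. The scans cost
`O(n ^ 2 * (m + 1))` steps, which is within the bound, so no sorting is needed. -/
theorem wp_allProg {G : WeightedDAG n m} {S : Fin n} {C h X s : ℕ}
    (hS : State B G S C h X s ∅ σ) :
    Wp b B allProg (fun τ T => State B G S C h X s Finset.univ τ ∧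
      T ≤ doneCost G (X * 2 ^ (h + 1 - s)) Finset.univ + n * (n * (30 * m + 50) + 30) + 10) σ := by
  have hlt := hS.lt
  refine .seq (.assign ?_ ?_)
  · simp only [Term.Small]; omega
  refine .loop (α := ℕ × Finset (Fin n)) (fun D τ k => τ.var 9 = D.1 ∧ D.1 ≤ D.2.card ∧
      State B G S C h X s D.2 τ ∧
      k ≤ doneCost G (X * 2 ^ (h + 1 - s)) D.2 + D.1 * (n * (30 * m + 50) + 30))
    (fun D => n - D.1) (0, ∅) ?_ ?_
  · refine ⟨rfl, Nat.zero_le _, hS.congr (fun x hx => ?_) rfl, Nat.zero_le _⟩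
    rw [Store.setVar_var, if_neg]
    rintro rfl
    revert hx
    decide
  · rintro ⟨r, D⟩ τ k - ⟨i1, i2, i3, i4⟩
    dsimp only at *
    have hcard := D.card_le_univ
    rw [Fintype.card_fin] at hcard
    refine ⟨⟨⟨trivial, ?_, ?_⟩, trivial⟩, fun hle => ?_, fun hle => ?_⟩
    · simp only [Term.Small]; omega
    · simp only [Term.val]; omega
    · simp only [Test.holds, Term.val, i1, i3.mem.var0] at hle
      refine .seq (.assign ?_ (.seq ?_))
      · simp only [Term.Small]; omega
      refine .loop (α := ℕ × Finset (Fin n)) (fun D' ρ j => ρ.var 10 = D'.1 ∧ D'.1 ≤ n ∧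
        ρ.var 9 = r ∧ D ⊆ D'.2 ∧
        (∀ v : Fin n, (v : ℕ) < D'.1 → (∀ a, G.dst a = v → G.src a ∈ D) → v ∈ D'.2) ∧
        State B G S C h X s D'.2 ρ ∧ j + doneCost G (X * 2 ^ (h + 1 - s)) D ≤
          doneCost G (X * 2 ^ (h + 1 - s)) D'.2 + D'.1 * (30 * m + 50)) (fun D' => n - D'.1)
        (0, D) ?_ ?_
      · refine ⟨rfl, Nat.zero_le _, i1, subset_rfl, fun v hv => absurd hv (Nat.not_lt_zero _),
          i3.congr (fun x hx => ?_) rfl, by simp⟩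
        rw [Store.setVar_var, if_neg]
        rintro rfl
        revert hx
        decide
      · rintro ⟨i, D'⟩ ρ j - ⟨j1, j2, j3, j4, j5, j6, j7⟩
        dsimp only at *
        refine ⟨⟨⟨trivial, ?_, ?_⟩, trivial⟩, fun hle' => ?_, fun hle' => ?_⟩
        · simp only [Term.Small]; omega
        · simp only [Term.val]; omega
        · simp only [Test.holds, Term.val, j1, j6.mem.var0] at hle'
          have hi : i < n := hle'
          refine Wp.frame (wp_vertexStep (v := ⟨i, hi⟩) j6 j1) fun υ T hfr hυ => ?_
          obtain ⟨u1, D'', u2, u3, u4, u5⟩ := hυ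
          refine ⟨(i + 1, D''), by dsimp only; omega, u1, hi, (hfr.1 9 (by decide)).trans j3,
            j4.trans u2, fun v hv hva => ?_, u4, ?_⟩
          · rcases Nat.lt_succ_iff_lt_or_eq.1 hv with h | h
            · exact u2 (j5 v h hva)
            · obtain rfl : v = ⟨i, hi⟩ := Fin.ext h
              exact u3 fun a ha => j4 (hva a ha)
          · simp only [Test.nodes, Term.nodes, add_mul, one_mul]
            omega
        · simp only [Test.holds, Term.val, j1, j6.mem.var0] at hle'
          obtain rfl : i = n := by omega
          have hprog : r + 1 ≤ D'.card := by
            by_cases hDu : D = Finset.univ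
            · subst hDu
              rw [Finset.univ_subset_iff.1 j4, Finset.card_univ, Fintype.card_fin]
              omega
            · have hne : ((Dᶜ : Finset (Fin i)) : Set (Fin i)).Nonempty := by
                rw [Finset.coe_nonempty, Finset.nonempty_iff_ne_empty, Ne,
                  Finset.compl_eq_empty_iff]
                exact hDu
              -- A minimal undone vertex has all its tails in `D`, so this round has computed it.
              obtain ⟨v, hv, hmin⟩ := G.wellFounded_arc.has_min _ hne
              simp only [Finset.coe_compl, Set.mem_compl_iff, Finset.mem_coe] at hv hmin
              have hvD : v ∈ D' := j5 v v.2 fun a ha => by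
                by_contra hc
                exact hmin _ hc ⟨a, rfl, ha⟩
              have : D ⊂ D' := (Finset.ssubset_iff_of_subset j4).2 ⟨v, hvD, hv⟩
              have := Finset.card_lt_card this
              omega
          refine .assign ?_ ⟨(r + 1, D'), by dsimp only; omega, ?_, hprog,
            j6.congr (fun x hx => ?_) rfl, ?_⟩
          · simp only [Term.Small, Term.val, true_and]; omega
          · simp [Term.val, j3]
          · rw [Store.setVar_var, if_neg]
            rintro rfl
            revert hx
            decide
          · simp only [Test.nodes, Term.nodes, add_mul, one_mul]
            omega
    · simp only [Test.holds, Term.val, i1, i3.mem.var0] at hle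
      have hDu : D = Finset.univ := by
        rw [← Finset.card_eq_iff_eq_univ, Fintype.card_fin]
        omega
      subst hDu
      refine ⟨i3, ?_⟩
      have hrn : r = n := by
        rw [Finset.card_univ, Fintype.card_fin] at i2
        omega
      subst hrn
      simp only [Test.nodes, Term.nodes]
      omega

end RAM

/-! ### Initialisation and output. -/

namespace RAM

open StepFun Sweep

variable {b B n m : ℕ} {σ : Store}

/-- Put the binary length of the variable `x` into the variable `14`. -/
def sizeProg (x : ℕ) : Prog :=
  .assign 14 (.const 0) ;;
  .loop (.le (.shl (.const 1) (.var 14)) (.var x)) (.assign 14 (.add (.var 14) (.const 1)))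

/-- Compute the precision, and set up the step functions that are constant with the values zero
and one. -/
def initProg : Prog :=
  sizeProg 1 ;; .assign 7 (.add (.var 14) (.const 1)) ;;
  sizeProg 0 ;; .assign 6 (.add (.var 14) (.add (.var 7) (.const 4))) ;;
  sizeProg 5 ;; .assign 6 (.add (.var 6) (.var 14)) ;;
  .write 3 (.const 0) (.add (.var 4) (.const 1)) ;;
  .write 3 (.const 2) (.add (.var 4) (.const 1)) ;;
  .write 4 (.const 1) (.shl (.const 1) (.var 6)) ;; .assign 8 (.const 3)

/-- Read the next value of the step function of the target. -/
def outStep : Prog :=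
  .assign 25 (.cell 4 (.var 18)) ;; .assign 26 (.cell 5 (.var 18)) ;;
  .assign 18 (.add (.var 18) (.const 1))

/-- Output the value at the capacity of the step function of the target. -/
def outProg : Prog :=
  .assign 18 (.cell 7 (.var 3)) ;; .assign 25 (.const 0) ;; .assign 26 (.const 0) ;;
  .loop (.le (.cell 3 (.var 18)) (.var 4)) outStep ;;
  .assign 1 (.sub (.var 26) (.var 6)) ;;
  .assign 0 (.shr (.add (.var 25) (.sub (.shl (.const 1) (.sub (.var 6) (.var 26))) (.const 1)))
    (.sub (.var 6) (.var 26)))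

/-- The program that approximately counts paths. -/
def countProg : Prog := initProg ;; allProg ;; outProg

theorem wp_sizeProg {x : ℕ} (hx : x ≠ 14) (hB : Nat.size (σ.var x) + 1 < B) :
    Wp b B (sizeProg x) (fun τ T => T ≤ 10 * Nat.size (σ.var x) + 10 ∧
      τ.var 14 = Nat.size (σ.var x) ∧ τ.arr = σ.arr ∧ ∀ y, y ≠ 14 → τ.var y = σ.var y) σ := by
  have hB' : B < 2 ^ B := Nat.lt_two_pow_self
  refine Wp.frame (Q := fun τ T => T ≤ 10 * Nat.size (σ.var x) + 10 ∧
    τ.var 14 = Nat.size (σ.var x)) ?_ fun τ T hfr hτ => ⟨hτ.1, hτ.2, funext fun a => hfr.2 a (by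
      simp [sizeProg, Prog.arrs]), fun y hy => hfr.1 y (by simp [sizeProg, Prog.vars, hy])⟩
  refine .seq (.assign ?_ ?_)
  · simp only [Term.Small]; omega
  refine .loop (α := ℕ) (fun k τ j => τ.var 14 = k ∧ k ≤ Nat.size (σ.var x) ∧ j ≤ 10 * k)
    (fun k => Nat.size (σ.var x) - k) 0 ?_ ?_
  · simp [Term.val]
  · rintro k τ j hfr ⟨i1, i2, i3⟩
    have hxx : τ.var x = σ.var x := by
      rw [hfr.1 x (by simp [Prog.vars, hx]), Store.setVar_var, if_neg hx]
    have hiff : (Test.le (.shl (.const 1) (.var 14)) (.var x)).holds τ ↔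
        k < Nat.size (σ.var x) := by
      simp only [Test.holds, Term.val, i1, hxx, one_mul]
      exact Nat.lt_size.symm
    refine ⟨⟨⟨?_, trivial, ?_⟩, trivial⟩, fun hle => ?_, fun hle => ?_⟩
    · simp only [Term.Small]; omega
    · simp only [Term.val, i1, one_mul]
      exact Nat.pow_lt_pow_right (by norm_num) (by omega)
    · rw [hiff] at hle
      refine .assign ?_ ⟨k + 1, by omega, ?_, hle, ?_⟩
      · simp only [Term.Small, Term.val, true_and]; omega
      · simp [Term.val, i1]
      · simp only [Test.nodes, Term.nodes]; omega
    · rw [hiff] at hle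
      refine ⟨?_, by omega⟩
      simp only [Test.nodes, Term.nodes]; omega

/-- Address 0 holds the sentinel of the empty list, addresses 1 and 2 hold the constant `2 ^ h` with
its sentinel; so 3 is the first free address. The choice of `s` gives `m < 2 ^ s`, and `h` exceeds
`s` by the logarithm of the required accuracy. -/
theorem wp_initProg {G : WeightedDAG n m} {S : Fin n} {t : Fin n} {C E h X s : ℕ}
    (hs : s = Nat.size m + 1) (hh : h = Nat.size n + Nat.size E + 4 + s) (hX : 0 < X)
    (hbX : (X + 3) * 2 ^ (h + 1) ≤ 2 ^ B) (hbC : C + 1 + G.maxWeight < 2 ^ B)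
    (hm : m + 5 < 2 ^ B) (hN : ∀ v c, G.pathCount S v c < 2 ^ X)
    (hlt : 3 + ∑ u, vertexCost G (X * 2 ^ (h + 1 - s)) u + n + 1 < 2 ^ B) :
    Wp b B initProg (fun τ T => T ≤ 10 * (Nat.size n + Nat.size m + Nat.size E) + 100 ∧
      State B G S C h X s ∅ τ ∧ τ.var 3 = t) (G.input S t C E) := by
  have hB : h + 1 < B := by
    refine (Nat.pow_lt_pow_iff_right (by norm_num : 1 < 2)).1 (lt_of_lt_of_le ?_ hbX)
    have := Nat.two_pow_pos (h + 1)
    rw [add_mul]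
    omega
  have hB' : B < 2 ^ B := Nat.lt_two_pow_self
  set σ := G.input S t C E with hσ
  have v0 : σ.var 0 = n := rfl
  have v1 : σ.var 1 = m := rfl
  have v2 : σ.var 2 = S := rfl
  have v3 : σ.var 3 = t := rfl
  have v4 : σ.var 4 = C := rfl
  have v5 : σ.var 5 = E := rfl
  have a0 : ∀ a : Fin m, σ.arr 0 a = G.src a := fun a => dif_pos a.2
  have a1 : ∀ a : Fin m, σ.arr 1 a = G.dst a := fun a => dif_pos a.2
  have a2 : ∀ a : Fin m, σ.arr 2 a = G.weight a := fun a => dif_pos a.2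
  have a3 : ∀ i, σ.arr 3 i = 0 := fun _ => rfl
  have a5 : ∀ i, σ.arr 5 i = 0 := fun _ => rfl
  have a6 : ∀ i, σ.arr 6 i = 0 := fun _ => rfl
  clear_value σ
  refine .seq (.mono (wp_sizeProg (by norm_num) (by rw [v1]; omega)) ?_)
  rintro σ₁ T₁ ⟨p1, p2, p3, p4⟩
  refine .seq (.assign ?_ (.seq (.mono (wp_sizeProg (by norm_num) ?_) ?_)))
  · simp only [Term.Small, Term.val, p2, v1, true_and]; omega
  · simp [p4, v0]; omega
  rintro σ₂ T₂ ⟨q1, q2, q3, q4⟩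
  have b0 : (σ₁.setVar 7 (Term.val σ₁ (.add (.var 14) (.const 1)))).var 0 = n := by simp [p4, v0]
  have b7 : σ₂.var 7 = s := by rw [q4 7 (by norm_num)]; simp [Term.val, p2, v1, hs]
  rw [b0] at q1 q2
  refine .seq (.assign ?_ (.seq (.mono (wp_sizeProg (by norm_num) ?_) ?_)))
  · simp only [Term.Small, Term.val, q2, b7, true_and]; omega
  · simp [q4, p4, v5]; omega
  rintro σ₃ T₃ ⟨r1, r2, r3, r4⟩
  have c5 : (σ₂.setVar 6 (Term.val σ₂ (.add (.var 14) (.add (.var 7) (.const 4))))).var 5 = E := by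
    simp [q4, p4, v5]
  rw [c5] at r1 r2
  have d : ∀ x, x ≠ 14 → x ≠ 6 → x ≠ 7 → σ₃.var x = σ.var x := by
    intro x h1 h2 h3
    rw [r4 x h1, Store.setVar_var, if_neg h2, q4 x h1, Store.setVar_var, if_neg h3, p4 x h1]
  have c7 : σ₃.var 7 = s := by rw [r4 7 (by norm_num)]; simpa using b7
  have c6 : σ₃.var 6 = Nat.size n + (s + 4) := by
    rw [r4 6 (by norm_num)]; simp [Term.val, q2, b7]
  have ar : σ₃.arr = σ.arr := by rw [r3, Store.setVar_arr, q3, Store.setVar_arr, p3]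
  have c4 : σ₃.var 4 = C := (d 4 (by norm_num) (by norm_num) (by norm_num)).trans v4
  have hsum : Nat.size n + (s + 4) + Nat.size E = h := by omega
  refine .seq (.assign ?_ (.seq (.write ?_ ?_ (.seq (.write ?_ ?_ (.seq (.write ?_ ?_
    (.assign ?_ ?_))))))))
  any_goals simp only [Term.Small, Term.val, Store.setVar_var, Store.setCell_var, c6, r2,
    c4, Nat.reduceEqDiff, reduceIte, true_and, hsum, one_mul]
  any_goals omega
  · exact ⟨by omega, Nat.pow_lt_pow_right (by norm_num) (by omega)⟩
  · refine ⟨?_, ⟨⟨⟨?_, ?_, ?_, ?_, hX, hbX, hbC⟩, ?_, ?_, ?_, ?_, ?_, ?_, ?_, ⟨⟨⟨?_, ?_, ?_⟩, trivial⟩,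
      ?_⟩, ?_, by omega, by omega, ?_, hm, hN⟩, ?_, by simp, ?_, hlt⟩, ?_⟩
    · rw [v1] at p1
      simp only [Term.nodes]; omega
    · simp [d, v4]
    · simp
    · simp
    · simp
    · simp [d, v0]
    · simp [d, v1]
    · simp [d, v2]
    · simp [c7]
    · intro a; simp [ar, a0]
    · intro a; simp [ar, a1]
    · intro a; simp [ar, a2]
    · simp [ar, a3]
    · simp
    · simp [ar, a5]
    · simp
    · simp
    · have : m < 2 ^ Nat.size m := Nat.lt_size_self m
      rw [hs, pow_succ]; omega
    · intro u; simp [ar, a6]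
    · simp
    · simp [d, v3]

/-- The scaling is undone by dividing by `2 ^ h` and rounding up: as `N` is an integer this stays
below `N`, and it loses nothing. One of the two truncated differences is zero, so either the
mantissa is shifted or the exponent reduced. -/
theorem ceil_shift {h N : ℕ} {f : ℕ × ℕ} (hf : fval f ≤ 2 ^ h * N) :
    (f.1 + (2 ^ (h - f.2) - 1)) / 2 ^ (h - f.2) * 2 ^ (f.2 - h) ≤ N ∧
      fval f ≤ 2 ^ h * ((f.1 + (2 ^ (h - f.2) - 1)) / 2 ^ (h - f.2) * 2 ^ (f.2 - h)) := by
  rcases le_total f.2 h with he | he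
  · obtain ⟨d, rfl⟩ := Nat.exists_eq_add_of_le he
    have h1 : f.2 + d - f.2 = d := by omega
    have h2 : f.2 - (f.2 + d) = 0 := by omega
    have hd := Nat.two_pow_pos d
    rw [h1, h2, pow_zero, mul_one]
    have hle : f.1 ≤ 2 ^ d * N := by
      rw [fval, pow_add, mul_assoc, mul_comm] at hf
      exact Nat.le_of_mul_le_mul_left hf (Nat.two_pow_pos _)
    constructor
    · refine Nat.le_of_lt_succ (Nat.div_lt_of_lt_mul ?_)
      rw [Nat.mul_succ]
      omega
    · have h3 := Nat.lt_mul_div_succ (f.1 + (2 ^ d - 1)) hd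
      rw [mul_add, mul_one] at h3
      calc fval f = 2 ^ f.2 * f.1 := mul_comm _ _
        _ ≤ 2 ^ f.2 * (2 ^ d * ((f.1 + (2 ^ d - 1)) / 2 ^ d)) :=
          Nat.mul_le_mul_left _ (by omega)
        _ = _ := by rw [pow_add]; ring
  · obtain ⟨d, hd⟩ := Nat.exists_eq_add_of_le he
    have h1 : h - f.2 = 0 := by omega
    have h2 : f.2 - h = d := by omega
    have h3 : fval f = 2 ^ h * (f.1 * 2 ^ d) := by rw [fval, hd, pow_add]; ring
    rw [h1, h2]
    simp only [pow_zero, Nat.sub_self, add_zero, Nat.div_one]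
    rw [h3] at hf ⊢
    exact ⟨Nat.le_of_mul_le_mul_left hf (Nat.two_pow_pos h), le_rfl⟩

theorem wp_outProg {G : WeightedDAG n m} {S t : Fin n} {C h X s : ℕ}
    (hS : State B G S C h X s Finset.univ σ) (h3 : σ.var 3 = t) :
    Wp b B outProg (fun τ T => T ≤ 20 * (X * 2 ^ (h + 1 - s)) + 40 ∧
      τ.output ≤ G.pathCount S t C ∧
      2 ^ h * G.pathCount S t C ≤ 2 ^ h * τ.output + n * (10 * 2 ^ s) * G.pathCount S t C) σ := by
  obtain ⟨l, l1, l2, l3, l4, l5⟩ := hS.vertex t (Finset.mem_univ _)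
  have hbX := hS.mem.bdX
  have hm := hS.mem.m_lt'
  have hlt := hS.lt
  have hfree := hS.free_le
  have hh : 4 * 2 ^ (h + 1) ≤ 2 ^ B :=
    le_trans (Nat.mul_le_mul_right _ (by have := hS.mem.posX; omega)) hbX
  refine .seq (.assign trivial (.seq (.assign ?_ (.seq (.assign ?_ (.seq ?_))))))
  any_goals simp only [Term.Small]
  any_goals omega
  refine .loop (α := (ℕ × ℕ) × List (ℕ × ℕ × ℕ)) (fun D τ k => τ.var 25 = D.1.1 ∧
    τ.var 26 = D.1.2 ∧ D.1.1 < 2 ^ (h + 1) ∧ ListAt C τ.arr (τ.var 18) D.2 ∧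
    τ.var 18 + D.2.length < σ.var 8 ∧ (∀ p ∈ D.2, p.2.1 < 2 ^ (h + 1)) ∧
    lval 0 C (fval D.1) D.2 = qval C (l, 0) ∧ k + 20 * D.2.length ≤ 20 * l.length)
    (fun D => D.2.length) ((0, 0), l) ?_ ?_
  · refine ⟨rfl, rfl, by simp, ?_, ?_, fun p hp => (l3.asc.norm hp).2, by simp [qval, fval], by simp⟩
    · simpa [Term.val, h3] using l1
    · simpa [Term.val, h3] using l2
  · rintro ⟨f, q⟩ τ k hfr ⟨i1, i2, i3, i4, i5, i6, i7, i8⟩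
    dsimp only at *
    have hv := hfr.1
    have e4 : τ.var 4 = C := by rw [hv 4 (by decide)]; simpa using hS.mem.var4
    have e6 : τ.var 6 = h := by rw [hv 6 (by decide)]; simpa using hS.mem.var6
    have hhead := i4.head (w := 0)
    rw [add_zero] at hhead
    refine ⟨⟨trivial, trivial⟩, fun hle => ?_, fun hle => ?_⟩
    · simp only [Test.holds, Term.val, e4, hhead] at hle
      cases q with
      | nil => simp only [headTime] at hle; omega
      | cons p q =>
        rw [List.length_cons] at i5 i8
        have htail := i4.tail
        refine .seq (.assign trivial (.seq (.assign trivial (.assign ?_ ⟨(p.2, q), ?_⟩))))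
        · simp only [Term.Small, Term.val, Store.setVar_var, Nat.reduceEqDiff, reduceIte, true_and]
          omega
        · simp only [Term.val, Store.setVar_var, Store.setVar_arr, Nat.reduceEqDiff, reduceIte,
            List.length_cons, Test.nodes, Term.nodes]
          rw [lval, if_pos (show p.1 + 0 ≤ C from hle)] at i7
          exact ⟨by omega, i4.1.1.2.1, i4.1.1.2.2, i6 p List.mem_cons_self, htail, by omega,
            fun x hx => i6 x (List.mem_cons_of_mem _ hx), i7, by omega⟩
    · simp only [Test.holds, Term.val, e4, hhead, not_le] at hle
      rw [lval_of_lt_headTime hle] at i7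
      have hap := l5 C le_rfl
      rw [← i7, Finset.card_univ, Fintype.card_fin] at hap
      obtain ⟨c1, c2⟩ := ceil_shift hap.1
      have hpw : 2 ^ (h - f.2) ≤ 2 ^ (h + 1) := Nat.pow_le_pow_right (by norm_num) (by omega)
      refine .seq (.assign ⟨trivial, trivial⟩ (.assign ?_ ?_))
      · simp only [Term.Small, Term.val, Store.setVar_var, Nat.reduceEqDiff, reduceIte, true_and,
          i1, i2, e6, one_mul, and_true]
        omega
      · have hout : Store.output ((τ.setVar 1 (Term.val τ (.sub (.var 26) (.var 6)))).setVar 0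
            (Term.val (τ.setVar 1 (Term.val τ (.sub (.var 26) (.var 6))))
              (.shr (.add (.var 25) (.sub (.shl (.const 1) (.sub (.var 6) (.var 26))) (.const 1)))
                (.sub (.var 6) (.var 26))))) =
            (f.1 + (2 ^ (h - f.2) - 1)) / 2 ^ (h - f.2) * 2 ^ (f.2 - h) := by
          simp [Store.output, Term.val, i1, i2, e6]
        rw [hout]
        refine ⟨?_, c1, ?_⟩
        · simp only [Test.nodes, Term.nodes]
          omega
        · have hpos := Nat.two_pow_pos h
          obtain ⟨-, g2⟩ := hap
          refine Nat.le_of_mul_le_mul_left (g2.trans ?_) hpos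
          rw [mul_add]
          refine Nat.add_le_add (Nat.mul_le_mul_left _ c2) (le_of_eq ?_)
          ring

end RAM

/-! ### Estimates for the binary length of the path counts. -/

namespace WeightedDAG

variable {n m : ℕ}

/-- The binary length of a bound on all numbers of paths. -/
def countLength (G : WeightedDAG n m) : ℕ := Nat.size (∏ u, (1 + G.indeg u))

theorem pathCount_lt (G : WeightedDAG n m) (s v : Fin n) (c : ℕ) :
    G.pathCount s v c < 2 ^ G.countLength :=
  lt_of_le_of_lt (G.pathCount_le_prod s v c) (Nat.lt_size_self _)

theorem prod_indeg_pos (G : WeightedDAG n m) : 0 < ∏ u, (1 + G.indeg u) :=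
  Finset.prod_pos fun _ _ => Nat.add_pos_left one_pos _

theorem countLength_pos (G : WeightedDAG n m) : 0 < G.countLength :=
  Nat.size_pos.2 G.prod_indeg_pos

/-- A crude bound from `1 + d ≤ 2 ^ d`, sufficient for the sizes of the numbers; the running time
needs `countLength_le_mul`. -/
theorem countLength_le (G : WeightedDAG n m) : G.countLength ≤ m + 1 := by
  refine Nat.size_le.2 ?_
  calc ∏ u, (1 + G.indeg u) ≤ ∏ u, 2 ^ G.indeg u :=
        Finset.prod_le_prod' fun u _ => by
          have : G.indeg u < 2 ^ G.indeg u := Nat.lt_two_pow_self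
          omega
    _ = 2 ^ m := by rw [Finset.prod_pow_eq_pow_sum, sum_indeg]
    _ < 2 ^ (m + 1) := Nat.pow_lt_pow_right (by norm_num) (Nat.lt_succ_self m)

/-- Concavity: the logarithm lies below its tangent at `1 + m / n`, and the linear terms cancel, as
the indegrees have mean `m / n`. -/
theorem log_prod_le (G : WeightedDAG n m) (hn : 0 < n) :
    Real.log (∏ u, (1 + G.indeg u) : ℕ) ≤ n * Real.log (1 + (m : ℝ) / n) := by
  have hn' : (0 : ℝ) < n := by exact_mod_cast hn
  set a : ℝ := (m : ℝ) / n with ha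
  have ha0 : 0 ≤ a := by positivity
  push_cast
  rw [Real.log_prod (fun u _ => by positivity)]
  have key : ∀ u, Real.log (1 + (G.indeg u : ℝ)) ≤
      Real.log (1 + a) + ((G.indeg u : ℝ) - a) / (1 + a) := by
    intro u
    have h1 : 0 < (1 + (G.indeg u : ℝ)) / (1 + a) := by positivity
    have h2 := Real.log_le_sub_one_of_pos h1
    rw [Real.log_div (by positivity) (by positivity)] at h2
    have h3 : (1 + (G.indeg u : ℝ)) / (1 + a) - 1 = ((G.indeg u : ℝ) - a) / (1 + a) := by
      field_simp
      ring
    linarith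
  refine (Finset.sum_le_sum fun u _ => key u).trans (le_of_eq ?_)
  have hsum : ∑ u, (G.indeg u : ℝ) = m := by exact_mod_cast G.sum_indeg
  rw [Finset.sum_add_distrib, ← Finset.sum_div, Finset.sum_sub_distrib, hsum]
  simp only [Finset.sum_const, Finset.card_univ, Fintype.card_fin, nsmul_eq_mul]
  rw [ha, mul_div_cancel₀ _ hn'.ne']
  simp

/-- At `a = 0` the convention `Real.logb 2 0 = 0` makes the maximum `1`, which covers graphs without
arcs. -/
theorem logb_one_add_le {a : ℝ} (ha : 0 ≤ a) :
    Real.logb 2 (1 + a) ≤ 2 * max 1 (Real.logb 2 a) := by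
  rcases le_total a 1 with h | h
  · have : Real.logb 2 (1 + a) ≤ Real.logb 2 2 :=
      Real.logb_le_logb_of_le (by norm_num) (by positivity) (by linarith)
    rw [Real.logb_self_eq_one (by norm_num)] at this
    linarith [le_max_left 1 (Real.logb 2 a)]
  · have : Real.logb 2 (1 + a) ≤ Real.logb 2 (2 * a) :=
      Real.logb_le_logb_of_le (by norm_num) (by positivity) (by linarith)
    rw [Real.logb_mul (by norm_num) (by positivity), Real.logb_self_eq_one (by norm_num)] at this
    linarith [le_max_left 1 (Real.logb 2 a), le_max_right 1 (Real.logb 2 a)]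

end WeightedDAG

theorem Nat.size_le_logb_add_one {x : ℕ} (hx : 0 < x) : (Nat.size x : ℝ) ≤ Real.logb 2 x + 1 := by
  have h1 : 0 < Nat.size x := Nat.size_pos.2 hx
  have h2 : 2 ^ (Nat.size x - 1) ≤ x := Nat.lt_size.1 (by omega)
  have h3 : ((Nat.size x - 1 : ℕ) : ℝ) ≤ Real.logb 2 x := by
    rw [Real.le_logb_iff_rpow_le (by norm_num) (by exact_mod_cast hx), Real.rpow_natCast]
    exact_mod_cast h2
  rw [Nat.cast_sub h1] at h3
  push_cast at h3
  linarith

theorem Nat.two_pow_size_le {x : ℕ} (hx : 0 < x) : 2 ^ Nat.size x ≤ 2 * x := by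
  have h1 : 0 < Nat.size x := Nat.size_pos.2 hx
  have h2 : 2 ^ (Nat.size x - 1) ≤ x := Nat.lt_size.1 (by omega)
  calc 2 ^ Nat.size x = 2 * 2 ^ (Nat.size x - 1) := by rw [← pow_succ']; congr 1; omega
    _ ≤ _ := Nat.mul_le_mul_left _ h2

theorem Nat.size_le_self (x : ℕ) : Nat.size x ≤ x := Nat.size_le.2 Nat.lt_two_pow_self

namespace WeightedDAG

variable {n m : ℕ}

theorem countLength_le_mul (G : WeightedDAG n m) (hn : 0 < n) :
    (G.countLength : ℝ) ≤ 3 * (n * max 1 (Real.logb 2 ((m : ℝ) / n))) := by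
  have h1 := Nat.size_le_logb_add_one G.prod_indeg_pos
  have h2 := G.log_prod_le hn
  have h3 := logb_one_add_le (a := (m : ℝ) / n) (by positivity)
  have hlog : (0 : ℝ) < Real.log 2 := Real.log_pos (by norm_num)
  have h4 : Real.logb 2 (∏ u, (1 + G.indeg u) : ℕ) ≤ n * Real.logb 2 (1 + (m : ℝ) / n) := by
    rw [Real.logb, Real.logb, ← mul_div_assoc]
    exact div_le_div_of_nonneg_right h2 hlog.le
  have hn' : (1 : ℝ) ≤ n := by exact_mod_cast hn
  have h5 := mul_le_mul_of_nonneg_left h3 (by positivity : (0 : ℝ) ≤ n)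
  have h6 : (1 : ℝ) ≤ n * max 1 (Real.logb 2 ((m : ℝ) / n)) :=
    one_le_mul_of_one_le_of_one_le hn' (le_max_left _ _)
  rw [countLength]
  linarith

end WeightedDAG

/-! ### Assembling the running time, the word count and the error. -/

namespace RAM

open StepFun Sweep

variable {n m : ℕ}

theorem sum_vertexCost (G : WeightedDAG n m) (Λ : ℕ) :
    ∑ u, vertexCost G Λ u = m * (7 * Λ + 3) + 2 * n := by
  have h : ∀ u, vertexCost G Λ u = G.indeg u * (7 * Λ + 3) + 2 := by
    intro u
    simp [vertexCost, potential]
    ring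
  simp only [h, Finset.sum_add_distrib, ← Finset.sum_mul, G.sum_indeg]
  simp [mul_comm]

/-- The choice of `B` covers the largest codes, about `X * 2 ^ h`, and all addresses, about `m * Λ`.
Each is a constant times at most three factors `2 ^ b`, from `n`, `m` and `X ≤ m + 1`, and one
factor `2 ^ Nat.size E`. -/
theorem countProg_exec (G : WeightedDAG n m) (S t : Fin n) (C E : ℕ) {b h s X Λ B : ℕ}
    (hb : b = G.wordLength C) (hs : s = Nat.size m + 1)
    (hh : h = Nat.size n + Nat.size E + 4 + s) (hX : X = G.countLength)
    (hΛ : Λ = X * 2 ^ (Nat.size n + Nat.size E + 5)) (hB : B = 3 * b + Nat.size E + 12) :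
    ∃ T τ U, Exec b countProg (G.input S t C E) T τ ∧ T ≤ U * (B / b + 1) ∧
      U ≤ 10 * (Nat.size n + Nat.size m + Nat.size E) + 264 * (m * (7 * Λ + 3) + 2 * n) +
        n * (50 * m + 200) + n * (n * (30 * m + 50) + 30) + 20 * Λ + 150 ∧
      τ.output ≤ G.pathCount S t C ∧
      2 ^ h * G.pathCount S t C ≤ 2 ^ h * τ.output + n * (10 * 2 ^ s) * G.pathCount S t C := by
  have hΛ' : Λ = X * 2 ^ (h + 1 - s) := by rw [hΛ]; congr 2; omega
  have hsum : n + m + C + G.maxWeight < 2 ^ b := by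
    rw [hb]; exact Nat.lt_size_self _
  have hE : E < 2 ^ Nat.size E := Nat.lt_size_self E
  have hsn : Nat.size n ≤ b := Nat.size_le.2 (by omega)
  have hsm : Nat.size m ≤ b := Nat.size_le.2 (by omega)
  have hXm : X ≤ m + 1 := hX ▸ G.countLength_le
  have hX0 : 0 < X := hX ▸ G.countLength_pos
  have hpb : 1 ≤ 2 ^ b := Nat.one_le_two_pow
  have hpE : 1 ≤ 2 ^ Nat.size E := Nat.one_le_two_pow
  have hpB : 2 ^ B = 4096 * (2 ^ b * 2 ^ b * 2 ^ b * 2 ^ Nat.size E) := by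
    rw [hB]; ring
  have hn : 0 < n := S.pos
  have hXb : X + 3 ≤ 4 * 2 ^ b := by omega
  have hp1 : 2 ^ b ≤ 2 ^ b * 2 ^ b * 2 ^ b * 2 ^ Nat.size E := by
    calc 2 ^ b = 2 ^ b * 1 * 1 * 1 := by ring
      _ ≤ _ := by gcongr
  have hp2 : 2 ^ Nat.size E ≤ 2 ^ b * 2 ^ b * 2 ^ b * 2 ^ Nat.size E := by
    calc 2 ^ Nat.size E = 1 * 1 * 1 * 2 ^ Nat.size E := by ring
      _ ≤ _ := by gcongr
  have hbX : (X + 3) * 2 ^ (h + 1) ≤ 2 ^ B := by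
    calc (X + 3) * 2 ^ (h + 1) ≤ 4 * 2 ^ b * 2 ^ (b + Nat.size E + 4 + (b + 1) + 1) :=
          Nat.mul_le_mul hXb (Nat.pow_le_pow_right (by norm_num) (by omega))
      _ = 256 * (2 ^ b * 2 ^ b * 2 ^ b * 2 ^ Nat.size E) := by ring
      _ ≤ _ := by rw [hpB]; omega
  have hΛB : m * (7 * Λ + 3) ≤ 320 * (2 ^ b * 2 ^ b * 2 ^ b * 2 ^ Nat.size E) := by
    have hΛ1 : 1 ≤ Λ := by rw [hΛ]; exact Nat.mul_pos hX0 (Nat.two_pow_pos _)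
    have hΛ2 : Λ ≤ 2 ^ b * 2 ^ (b + Nat.size E + 5) := by
      rw [hΛ]
      exact Nat.mul_le_mul (by omega) (Nat.pow_le_pow_right (by norm_num) (by omega))
    calc m * (7 * Λ + 3) ≤ 2 ^ b * (10 * (2 ^ b * 2 ^ (b + Nat.size E + 5))) :=
          Nat.mul_le_mul (by omega) (by omega)
      _ = _ := by ring
  have hlt : 3 + ∑ u, vertexCost G (X * 2 ^ (h + 1 - s)) u + n + 1 < 2 ^ B := by
    rw [← hΛ', sum_vertexCost, hpB]
    omega
  have hbdd : (G.input S t C E).Bdd B := by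
    have hw : ∀ a, G.weight a ≤ G.maxWeight := fun a =>
      Finset.le_sup (f := G.weight) (Finset.mem_univ _)
    have hle : ∀ x, x ≤ 2 ^ b → x < 2 ^ B := fun x hx => by omega
    constructor
    · intro x
      have hS := S.2
      have ht := t.2
      simp only [WeightedDAG.input]
      split <;> omega
    · intro a i
      simp only [WeightedDAG.input]
      split <;> try split_ifs with hi
      · have := (G.src ⟨i, hi⟩).2; exact hle _ (by omega)
      · exact hle _ (by omega)
      · have := (G.dst ⟨i, hi⟩).2; exact hle _ (by omega)
      · exact hle _ (by omega)
      · have := hw ⟨i, hi⟩; exact hle _ (by omega)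
      · exact hle _ (by omega)
      · exact hle _ (by omega)
  have hN : ∀ v c, G.pathCount S v c < 2 ^ X := by rw [hX]; exact G.pathCount_lt S
  have hrun : Wp b B countProg (fun τ U => U ≤ 10 * (Nat.size n + Nat.size m + Nat.size E) +
        264 * (m * (7 * Λ + 3) + 2 * n) +
        n * (50 * m + 200) + n * (n * (30 * m + 50) + 30) + 20 * Λ + 150 ∧
      τ.output ≤ G.pathCount S t C ∧
      2 ^ h * G.pathCount S t C ≤ 2 ^ h * τ.output + n * (10 * 2 ^ s) * G.pathCount S t C)
      (G.input S t C E) := by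
    refine .seq (.mono (wp_initProg (t := t) hs hh hX0 hbX (by omega) (by omega) hN hlt) ?_)
    rintro σ₁ T₁ ⟨p1, p2, p3⟩
    refine .seq (Wp.frame (wp_allProg p2) ?_)
    rintro σ₂ T₂ hfr ⟨q1, q2⟩
    have h3 : σ₂.var 3 = t := (hfr.1 3 (by decide)).trans p3
    refine .mono (wp_outProg q1 h3) ?_
    rintro σ₃ T₃ ⟨r1, r2, r3⟩
    refine ⟨?_, r2, r3⟩
    rw [doneCost, ← hΛ', sum_vertexCost, Finset.card_univ, Fintype.card_fin] at q2
    rw [← hΛ'] at r1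
    omega
  obtain ⟨τ, T, U, h1, h2, -, h3, h4, h5⟩ := hrun hbdd
  exact ⟨T, τ, U, h1, h2, h3, h4, h5⟩

/-- The word length is at least the binary logarithm of `max n 2`, so `log₂ (1 / ε) / b` is at most
the quotient under the ceiling. The constants are 17 = 3 + 12 + 2 from the quotient, one from the
summand `1`, and one for the quotient of logarithms. -/
theorem words_le_ceil {n b E : ℕ} {ε : ℝ} (hε : 0 < ε) (hε1 : ε ≤ 1) (hb : 0 < b)
    (hn : n < 2 ^ b) (hE : 0 < E) (hE2 : (E : ℝ) ≤ 2 * ε⁻¹) :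
    (((3 * b + Nat.size E + 12) / b + 1 : ℕ) : ℝ) ≤
      19 * (max 1 ⌈Real.log (1 / ε) / Real.log (max n 2 : ℕ)⌉₊ : ℕ) := by
  have hb1 : (1 : ℝ) ≤ b := by exact_mod_cast hb
  have hb0 : (0 : ℝ) < b := by linarith
  have hlog2 : (0 : ℝ) < Real.log 2 := Real.log_pos (by norm_num)
  have hlogε : 0 ≤ Real.log (1 / ε) := Real.log_nonneg (by rw [le_div_iff₀ hε]; linarith)
  have hmax2 : (2 : ℝ) ≤ (max n 2 : ℕ) := by exact_mod_cast le_max_right n 2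
  have hmax : ((max n 2 : ℕ) : ℝ) ≤ 2 ^ b := by
    have h2 : 2 ^ 1 ≤ 2 ^ b := Nat.pow_le_pow_right (by norm_num) hb
    exact_mod_cast max_le hn.le h2
  have hlogmax : 0 < Real.log (max n 2 : ℕ) := Real.log_pos (by linarith)
  have hlogb : Real.log (max n 2 : ℕ) ≤ Real.log 2 * b := by
    have := Real.log_le_log (by linarith) hmax
    rwa [Real.log_pow, mul_comm] at this
  have hsize : (Nat.size E : ℝ) ≤ Real.log (1 / ε) / Real.log 2 + 2 := by
    have h1 := Nat.size_le_logb_add_one hE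
    have h2 : Real.logb 2 E ≤ Real.logb 2 (2 * (1 / ε)) :=
      Real.logb_le_logb_of_le (by norm_num) (by exact_mod_cast hE) (by rwa [one_div])
    rw [Real.logb_mul (by norm_num) (by positivity), Real.logb_self_eq_one (by norm_num)] at h2
    rw [Real.logb] at h2 h1
    rw [Real.logb] at h2
    linarith
  have hdiv : Real.log (1 / ε) / Real.log 2 / b ≤ Real.log (1 / ε) / Real.log (max n 2 : ℕ) := by
    rw [div_div]
    exact div_le_div_of_nonneg_left hlogε hlogmax hlogb
  have hquot : (((3 * b + Nat.size E + 12) / b : ℕ) : ℝ) ≤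
      17 + Real.log (1 / ε) / Real.log (max n 2 : ℕ) := by
    refine Nat.cast_div_le.trans ?_
    rw [div_le_iff₀ hb0]
    rw [div_le_iff₀ hb0] at hdiv
    push_cast at *
    linarith
  have hceil := Nat.le_ceil (Real.log (1 / ε) / Real.log (max n 2 : ℕ))
  have hF1 : (1 : ℝ) ≤ (max 1 ⌈Real.log (1 / ε) / Real.log (max n 2 : ℕ)⌉₊ : ℕ) := by
    exact_mod_cast le_max_left _ _
  have hF2 : (⌈Real.log (1 / ε) / Real.log (max n 2 : ℕ)⌉₊ : ℝ) ≤
      (max 1 ⌈Real.log (1 / ε) / Real.log (max n 2 : ℕ)⌉₊ : ℕ) := by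
    exact_mod_cast le_max_right _ _
  rw [Nat.cast_add, Nat.cast_one]
  linarith

/-- By the choice of `h`, `2 ^ h ≥ 16 * n * E * 2 ^ s` with `E * ε ≥ 1`, so the total error `10 * n
* 2 ^ s` is at most `ε * 2 ^ h`. -/
theorem one_sub_mul_le_of_shift_le {n E h s N O : ℕ} {ε : ℝ} (hn : 0 < n) (hε : 0 < ε)
    (hE : 1 / ε ≤ E) (hh : h = Nat.size n + Nat.size E + 4 + s)
    (hO : 2 ^ h * N ≤ 2 ^ h * O + n * (10 * 2 ^ s) * N) : (1 - ε) * (N : ℝ) ≤ O := by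
  have hE' : 1 ≤ E * ε := by rwa [div_le_iff₀ hε] at hE
  have hpow : n * E * 16 * 2 ^ s ≤ 2 ^ h := by
    rw [hh, pow_add, pow_add, pow_add]
    have h1 := (Nat.lt_size_self n).le
    have h2 := (Nat.lt_size_self E).le
    gcongr
    norm_num
  have hpow' : (n : ℝ) * E * 16 * 2 ^ s ≤ 2 ^ h := by exact_mod_cast hpow
  have herr : (n : ℝ) * (10 * 2 ^ s) ≤ ε * 2 ^ h := by
    have hn0 : (0 : ℝ) ≤ n * 2 ^ s := by positivity
    nlinarith [mul_le_mul_of_nonneg_left hpow' hε.le, mul_le_mul_of_nonneg_left hE' hn0]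
  have hO' : (2 : ℝ) ^ h * N ≤ 2 ^ h * O + n * (10 * 2 ^ s) * N := by exact_mod_cast hO
  have herrN := mul_le_mul_of_nonneg_right herr (Nat.cast_nonneg (α := ℝ) N)
  have hp : (0 : ℝ) < 2 ^ h := by positivity
  refine le_of_mul_le_mul_left ?_ hp
  linarith

theorem countCost_le (G : WeightedDAG n m) (hn : 0 < n) {E U Λ : ℕ} {e : ℝ} (he : 1 ≤ e)
    (hE0 : 0 < E) (hE : (E : ℝ) ≤ 2 * e)
    (hΛ : Λ = G.countLength * 2 ^ (Nat.size n + Nat.size E + 5))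
    (hU : U ≤ 10 * (Nat.size n + Nat.size m + Nat.size E) + 264 * (m * (7 * Λ + 3) + 2 * n) +
      n * (50 * m + 200) + n * (n * (30 * m + 50) + 30) + 20 * Λ + 150) :
    (U : ℝ) ≤ 1500000 * ((max 1 m : ℕ) * (n : ℝ) ^ 2 * max 1 (Real.logb 2 ((m : ℝ) / n)) * e) := by
  set l : ℝ := max 1 (Real.logb 2 ((m : ℝ) / n)) with hl
  set M : ℝ := ((max 1 m : ℕ) : ℝ) with hM
  have hl1 : 1 ≤ l := le_max_left _ _
  have hM1 : 1 ≤ M := by rw [hM]; exact_mod_cast le_max_left _ _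
  have hmM : (m : ℝ) ≤ M := by rw [hM]; exact_mod_cast le_max_right _ _
  have hn1 : (1 : ℝ) ≤ n := by exact_mod_cast hn
  have hle1 : 1 ≤ l * e := one_le_mul_of_one_le_of_one_le hl1 he
  have hsq : (n : ℝ) ≤ n ^ 2 := by nlinarith
  -- The constant is 3 * 128 * 2, from the length of the counts, from `2 ^ (Nat.size n + Nat.size E
  -- + 5) ≤ 32 * (2 * n) * (2 * E)`, and from `E ≤ 2 * e`.
  have hΛ1 : (Λ : ℝ) ≤ 768 * ((n : ℝ) ^ 2 * (l * e)) := by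
    have h1 : Λ ≤ G.countLength * (128 * n * E) := by
      rw [hΛ, pow_add, pow_add]
      refine Nat.mul_le_mul_left _ ?_
      have := Nat.mul_le_mul (Nat.two_pow_size_le hn) (Nat.two_pow_size_le hE0)
      linarith
    have h2 : (Λ : ℝ) ≤ G.countLength * (128 * n * E) := by exact_mod_cast h1
    calc (Λ : ℝ) ≤ G.countLength * (128 * n * E) := h2
      _ ≤ (3 * (n * l)) * (128 * n * (2 * e)) := by
        gcongr
        exact G.countLength_le_mul hn
      _ = _ := by ring
  set Q : ℝ := M * (n : ℝ) ^ 2 * l * e with hQ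
  -- Each term of the step count splits into a factor bounded by `M` and one bounded by the rest of
  -- `Q`; the dominant one has the coefficient 264 * 7 * 768.
  have hbase : ∀ x y : ℝ, 0 ≤ y → x ≤ M → y ≤ (n : ℝ) ^ 2 * (l * e) → x * y ≤ Q := by
    intro x y h0 hx hy
    calc x * y ≤ M * ((n : ℝ) ^ 2 * (l * e)) := mul_le_mul hx hy h0 (by linarith)
      _ = Q := by rw [hQ]; ring
  have hn2 : (n : ℝ) ^ 2 ≤ (n : ℝ) ^ 2 * (l * e) := le_mul_of_one_le_right (by positivity) hle1
  have hsm : (Nat.size m : ℝ) ≤ m := by exact_mod_cast Nat.size_le_self m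
  have hsn : (Nat.size n : ℝ) ≤ n := by exact_mod_cast Nat.size_le_self n
  have hsE : (Nat.size E : ℝ) ≤ E := by exact_mod_cast Nat.size_le_self E
  have q1 := hbase m 1 zero_le_one hmM (by linarith)
  have q2 := hbase 1 n (by linarith) hM1 (by linarith)
  have q3 := hbase 1 (n ^ 2) (by positivity) hM1 hn2
  have q4 := hbase m n (by linarith) hmM (by linarith)
  have q5 := hbase m (n ^ 2) (by positivity) hmM hn2
  have q6 := hbase 1 e (by linarith) hM1 (by
    calc e = 1 * (1 * e) := by ring
      _ ≤ _ := by gcongr; linarith)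
  have q7 := hbase m (Λ / 768) (by positivity) hmM (by linarith)
  have q8 := hbase 1 (Λ / 768) (by positivity) hM1 (by linarith)
  have hU' : (U : ℝ) ≤ 10 * (Nat.size n + Nat.size m + Nat.size E) +
      264 * (m * (7 * Λ + 3) + 2 * n) +
      n * (50 * m + 200) + n * (n * (30 * m + 50) + 30) + 20 * Λ + 150 := by exact_mod_cast hU
  linarith

end RAM

theorem theorem5 :
    ∃ (P : RAM.Prog) (K : ℝ), ∀ (n m : ℕ) (G : WeightedDAG n m) (s t : Fin n) (C : ℕ) (ε : ℝ),
      0 < ε → ε ≤ 1 →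
        ∃ (T : ℕ) (τ : RAM.Store),
          RAM.Exec (G.wordLength C) P (G.input s t C ⌈1 / ε⌉₊) T τ ∧
          (1 - ε) * (G.pathCount s t C : ℝ) ≤ (τ.output : ℝ) ∧
          τ.output ≤ G.pathCount s t C ∧
          (T : ℝ) ≤ K * ((max 1 m : ℕ) * (n : ℝ) ^ 2 * max 1 (Real.logb 2 ((m : ℝ) / n)) * ε⁻¹ *
            (max 1 ⌈Real.log (1 / ε) / Real.log (max n 2 : ℕ)⌉₊ : ℕ)) := by
  refine ⟨RAM.countProg, 19 * 1500000, fun n m G s t C ε hε hε1 => ?_⟩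
  have hn : 0 < n := s.pos
  have he : 1 ≤ ε⁻¹ := (one_le_inv₀ hε).2 hε1
  have hE1 : 1 / ε ≤ (⌈1 / ε⌉₊ : ℝ) := Nat.le_ceil _
  have hE0 : 0 < ⌈1 / ε⌉₊ := Nat.ceil_pos.2 (by positivity)
  have hE2 : (⌈1 / ε⌉₊ : ℝ) ≤ 2 * ε⁻¹ := by
    have := Nat.ceil_lt_add_one (a := 1 / ε) (by positivity)
    rw [one_div] at this ⊢
    linarith
  have hnb : n < 2 ^ G.wordLength C := by
    have := Nat.lt_size_self (n + m + C + G.maxWeight)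
    rw [WeightedDAG.wordLength]
    omega
  have hb : 0 < G.wordLength C := Nat.size_pos.2 (by omega)
  obtain ⟨T, τ, U, hexec, hT, hU, hle, hge⟩ :=
    RAM.countProg_exec G s t C ⌈1 / ε⌉₊ rfl rfl rfl rfl rfl rfl
  refine ⟨T, τ, hexec, RAM.one_sub_mul_le_of_shift_le hn hε hE1 rfl hge, hle, ?_⟩
  have hcost := RAM.countCost_le G hn he hE0 hE2 rfl hU
  have hwords := RAM.words_le_ceil hε hε1 hb hnb hE0 hE2
  calc (T : ℝ) ≤ U * (((3 * G.wordLength C + Nat.size ⌈1 / ε⌉₊ + 12) / G.wordLength C + 1 : ℕ) : ℝ) :=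
        by exact_mod_cast hT
    _ ≤ _ := mul_le_mul hcost hwords (Nat.cast_nonneg _) ((Nat.cast_nonneg _).trans hcost)
    _ = _ := by ring
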